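/- **Notation.** Let $d\ge 1$, $s>0$, and write $s=m+\sigma$ with $m\in\{0,1,2,\dots\}$, $0\le\sigma<1$. For an open set $\Omega\subset\mathbb R^d$ and weak derivatives $D^\alpha u$ on $\Omega$, put $$\|u\|_{\dot H^s(\Omega)}^2=\sum_{|\alpha|=m}\frac{m!}{\alpha!}\int_\Omega|D^\alpha u|^2\quad(\sigma=0),\qquad \|u\|_{\dot H^s(\Omega)}^2=c_{d,\sigma}\sum_{|\alpha|=m}\frac{m!}{\alpha!}\int_\Omega\!\int_\Omega\frac{|D^\alpha u(x)-D^\alpha u(y)|^2}{|x-y|^{d+2\sigma}}\,dx\,dy\quad(0<\sigma<1),$$ where $c_{d,\sigma}=\frac{2^{2\sigma-1}}{\pi^{d/2}}\frac{\Gamma(d/2+\sigma)}{|\Gamma(-\sigma)|}$, and $\|u\|_{H^s(\Omega)}^2=\|u\|_{\dot H^s(\Omega)}^2+\sum_{|\alpha|\le m}\int_\Omega|D^\alpha u|^2$; $H^s(\Omega)$ is the space of functions on $\Omega$ for which these weak derivatives exist and this norm is finite. These definitions are used for all exponents $t\ge 0$. On $\mathbb R^d$, $(-\Delta)^s$ is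 defined by $\langle u,(-\Delta)^su\rangle=\int|p|^{2s}|\hat u(p)|^2dp$ with the unitary Fourier transform, and $\|u\|_{H^s(\mathbb R^d)}^2=\|u\|_{L^2}^2+\langle u,(-\Delta)^su\rangle$. Let $$C_{\rm GN}=\inf_{u\in H^s(\mathbb R^d),\ \|u\|_{L^2}=1}\frac{\langle u,(-\Delta)^su\rangle}{\int_{\mathbb R^d}|u|^{2(1+2s/d)}}.$$ An open set $\Omega$ is an *$s$-extension domain* if there is a linear operator $T$, mapping functions on $\Omega$ to functions on $\mathbb R^d$, with $Tu|_\Omega=u$ and such that $T:H^t(\Omega)\to H^t(\mathbb R^d)$ is bounded for all $0\le t\le s$. We write $\Omega\subset\subset\widetilde\Omega$ if $\Omega\subset\widetilde\Omega$ and $\mathrm{dist}(\Omega,\mathbb R^d\setminus\widetilde\Omega)>0$ (with $\mathrm{dist}(\Omega,\emptyset)=+\infty$). For $N\ge1$ and a normalized $\Psi\in L^2(\mathbb R^{dN})$, let $\Psi_j^{y}$ be the function $x\mapsto\Psi(x_1,\dots,x_{j-1},x,x_{j+1},\dots,x_N)$ with $y=(x_i)_{i\ne j}$ fixed, and let $$\rho_\Psi(x)=\sum_{j=1}^N\int_{\mathbb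 R^{d(N-1)}}|\Psi_j^y(x)|^2\,dy,\qquad \Big\langle\Psi,\sum_{j=1}^N(-\Delta_{x_j})^s_{|\widetilde\Omega}\Psi\Big\rangle=\sum_{j=1}^N\int_{\mathbb R^{d(N-1)}}\big\|\Psi_j^y\big\|^2_{\dot H^s(\widetilde\Omega)}\,dy\in[0,\infty],$$ where $\|u\|^2_{\dot H^s(\widetilde\Omega)}$ is read as $+\infty$ if $u|_{\widetilde\Omega}\notin H^s(\widetilde\Omega)$. **Lemma 4.2 (Local uncertainty principle II).** Let $d\ge1$ and $s>0$. To every $\delta\in(0,1)$ and all nonempty open sets $\Omega\subset\subset\widetilde\Omega\subset\mathbb R^d$ with $\widetilde\Omega$ an $s$-extension domain one can assign a constant $C_{\delta,\Omega,\widetilde\Omega}\ge0$ (depending also on $d,s$), with $C_{\delta,\Omega,\widetilde\Omega}>0$ if $\widetilde\Omega\ne\mathbb R^d$, such that for every $N\ge1$ and every normalized $\Psi\in L^2(\mathbb R^{dN})$ $$\Big\langle\Psi,\sum_{i=1}^N(-\Delta_{x_i})^s_{|\widetilde\Omega}\Psi\Big\rangle\ \ge\ C_{\rm GN}(1-\delta)\,\frac{\int_\Omega\rho_\Psi^{1+2s/d}}{\big(\int_{\widetilde\Omega}\rho_\Psi\big)^{2s/d}}-C_{\delta,\Omega,\widetilde\Omega}\int_{\widetilde\Omega}\rho_\Psi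 ,$$ where the quotient is read as $0$ if $\int_{\widetilde\Omega}\rho_\Psi=0$ (and the left side is $+\infty$ whenever the numerator is). The constant is independent of $\Psi$ and $N$, and $$C_{\delta,\Omega,\widetilde\Omega}=C_{\delta,L\Omega,L\widetilde\Omega}\,L^{2s}\qquad\text{for all }L>0,\quad L\Omega:=\{Lx:x\in\Omega\}.$$ -/

import Mathlib

open MeasureTheory Set
open scoped ENNReal NNReal ContDiff FourierTransform Pointwise

noncomputable section

namespace LocalUncertainty

/-- One-particle configuration space `ℝ^d` with its Euclidean norm. -/
abbrev E (d : ℕ) : Type := EuclideanSpace ℝ (Fin d)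

/-! ### Weak derivatives and Sobolev spaces -/

/-- Classical partial derivative in the `k`-th coordinate direction. -/
def partialDeriv {d : ℕ} (k : Fin d) (f : E d → ℝ) : E d → ℝ :=
  fun x => fderiv ℝ f x (EuclideanSpace.single k 1)

/-- Classical multi-index derivative `D^α f = ∂₁^{α₁} ⋯ ∂_d^{α_d} f` (used for smooth `f`). -/
def multiDeriv {d : ℕ} (α : Fin d → ℕ) (f : E d → ℝ) : E d → ℝ :=
  (List.finRange d).foldr (fun k g => (partialDeriv k)^[α k] g) f

/-- `v` is the weak derivative `D^α u` on the open set `Ω`. -/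
structure HasWeakDeriv {d : ℕ} (Ω : Set (E d)) (α : Fin d → ℕ) (u v : E d → ℂ) : Prop where
  locallyIntegrable : LocallyIntegrableOn u Ω
  locallyIntegrable_deriv : LocallyIntegrableOn v Ω
  integral_eq : ∀ φ : E d → ℝ, ContDiff ℝ ∞ φ → HasCompactSupport φ → tsupport φ ⊆ Ω →
    ∫ x in Ω, multiDeriv α φ x • u x = (-1 : ℂ) ^ (∑ i, α i) * ∫ x in Ω, φ x • v x

open Classical in
/-- The weak derivative `D^α u` on `Ω`, which is unique almost everywhere on `Ω`
(with value `0` if it does not exist). -/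
def weakDeriv {d : ℕ} (Ω : Set (E d)) (α : Fin d → ℕ) (u : E d → ℂ) : E d → ℂ :=
  if h : ∃ v, HasWeakDeriv Ω α u v then h.choose else 0

/-- The constant `c_{d,σ} = 2^{2σ-1} π^{-d/2} Γ(d/2+σ) / |Γ(-σ)|`. -/
def gagliardoConst (d : ℕ) (σ : ℝ) : ℝ :=
  2 ^ (2 * σ - 1) / Real.pi ^ ((d : ℝ) / 2) * (Real.Gamma ((d : ℝ) / 2 + σ) / |Real.Gamma (-σ)|)

/-- The squared seminorm `‖u‖²_{Ḣ^s(Ω)}`, where `s = m + σ` with `m = ⌊s⌋₊` and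
`σ = Int.fract s ∈ [0,1)`. The sums run over the multi-indices with `|α| = m`, and
`Nat.multinomial` is `m! / α!`. -/
def hsSeminormSq {d : ℕ} (s : ℝ) (Ω : Set (E d)) (u : E d → ℂ) : ℝ≥0∞ :=
  if Int.fract s = 0 then
    ∑ α ∈ Finset.piAntidiag (Finset.univ : Finset (Fin d)) ⌊s⌋₊,
      (Nat.multinomial Finset.univ α : ℝ≥0∞) * ∫⁻ x in Ω, ‖weakDeriv Ω α u x‖ₑ ^ 2
  else
    ENNReal.ofReal (gagliardoConst d (Int.fract s)) *
      ∑ α ∈ Finset.piAntidiag (Finset.univ : Finset (Fin d)) ⌊s⌋₊,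
        (Nat.multinomial Finset.univ α : ℝ≥0∞) *
          ∫⁻ x in Ω, ∫⁻ y in Ω, ‖weakDeriv Ω α u x - weakDeriv Ω α u y‖ₑ ^ 2 /
            ENNReal.ofReal (‖x - y‖ ^ ((d : ℝ) + 2 * Int.fract s))

/-- The squared norm `‖u‖²_{H^s(Ω)} = ‖u‖²_{Ḣ^s(Ω)} + ∑_{|α| ≤ m} ∫_Ω |D^α u|²`. -/
def hsNormSq {d : ℕ} (s : ℝ) (Ω : Set (E d)) (u : E d → ℂ) : ℝ≥0∞ :=
  hsSeminormSq s Ω u +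
    ∑ j ∈ Finset.range (⌊s⌋₊ + 1), ∑ α ∈ Finset.piAntidiag (Finset.univ : Finset (Fin d)) j,
      ∫⁻ x in Ω, ‖weakDeriv Ω α u x‖ₑ ^ 2

/-- `u ∈ H^s(Ω)`: the weak derivatives up to order `⌊s⌋₊` exist and `‖u‖_{H^s(Ω)}` is finite. -/
def MemHs {d : ℕ} (s : ℝ) (Ω : Set (E d)) (u : E d → ℂ) : Prop :=
  (∀ α : Fin d → ℕ, ∑ i, α i ≤ ⌊s⌋₊ → ∃ v, HasWeakDeriv Ω α u v) ∧ hsNormSq s Ω u < ⊤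

/-- `⟨u, (-Δ)^s u⟩ = ∫ |p|^{2s} |û(p)|² dp ∈ [0,∞]` for `u ∈ L²(ℝ^d)` and the unitary Fourier
transform `û(p) = (2π)^{-d/2} ∫ u(x) e^{-ip·x} dx`. Mathlib's `𝓕 u` has kernel `e^{-2πi x·ξ}`, so
that `p = 2πξ`. -/
def fracLaplaceEnergy {d : ℕ} (s : ℝ) (u : Lp ℂ 2 (volume : Measure (E d))) : ℝ≥0∞ :=
  ∫⁻ ξ : E d, ENNReal.ofReal ((2 * Real.pi * ‖ξ‖) ^ (2 * s)) *
    ‖((𝓕 u : Lp ℂ 2 (volume : Measure (E d))) : E d → ℂ) ξ‖ₑ ^ 2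

/-- `‖u‖²_{H^s(ℝ^d)} = ‖u‖²_{L²} + ⟨u, (-Δ)^s u⟩`. -/
def hsNormSqFull {d : ℕ} (s : ℝ) (u : Lp ℂ 2 (volume : Measure (E d))) : ℝ≥0∞ :=
  ‖u‖ₑ ^ 2 + fracLaplaceEnergy s u

/-- The one-body Gagliardo–Nirenberg constant `C_GN(s,d)`, the infimum of
`⟨u, (-Δ)^s u⟩ / ∫ |u|^{2(1+2s/d)}` over all `L²`-normalized `u ∈ H^s(ℝ^d)`. -/
def gnConst (d : ℕ) (s : ℝ) : ℝ≥0∞ :=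
  ⨅ (u : Lp ℂ 2 (volume : Measure (E d))) (_ : ‖u‖ = 1) (_ : hsNormSqFull s u < ⊤),
    fracLaplaceEnergy s u / ∫⁻ x, ‖u x‖ₑ ^ (2 * (1 + 2 * s / (d : ℝ)))

/-- `Ω` is an `s`-extension domain: it is open, and there is a linear extension operator `T` which
is bounded from `H^t(Ω)` to `H^t(ℝ^d)` for every `0 ≤ t ≤ s`. As `H^0 = L²` contains all the other
spaces, `T` is a map on `L²(Ω)`. -/
def IsExtensionDomain {d : ℕ} (s : ℝ) (Ω : Set (E d)) : Prop :=
  IsOpen Ω ∧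
  ∃ T : Lp ℂ 2 (volume.restrict Ω) →ₗ[ℂ] Lp ℂ 2 (volume : Measure (E d)),
    (∀ u, (T u : E d → ℂ) =ᵐ[volume.restrict Ω] u) ∧
    ∀ t : ℝ, 0 ≤ t → t ≤ s → ∃ C : ℝ≥0, ∀ u : Lp ℂ 2 (volume.restrict Ω),
      MemHs t Ω u → hsNormSqFull t (T u) ≤ C * hsNormSq t Ω u

/-- `Ω ⊂⊂ Ω'`: `Ω ⊆ Ω'` and `dist(Ω, ℝ^d \ Ω') > 0` (the distance to `∅` being `+∞`). -/
def WellInside {d : ℕ} (Ω Ω' : Set (E d)) : Prop :=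
  Ω ⊆ Ω' ∧ ∃ r : ℝ, 0 < r ∧ ∀ x ∈ Ω, ∀ y ∉ Ω', r ≤ dist x y

/-! ### Many-body wave functions -/

/-- `Ψ` is a normalized wave function in `L²((ℝ^d)^n)`. -/
def IsNormalized {d n : ℕ} (Ψ : (Fin n → E d) → ℂ) : Prop :=
  MemLp Ψ 2 volume ∧ eLpNorm Ψ 2 volume = 1

/-- The function `x ↦ Ψ(x₁,…,x_{j-1},x,x_{j+1},…)` of the `j`-th of `n + 1` particles, the
positions `y` of the other `n` particles being fixed. -/
def slice {d n : ℕ} (Ψ : (Fin (n + 1) → E d) → ℂ) (j : Fin (n + 1)) (y : Fin n → E d) :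
    E d → ℂ :=
  fun x => Ψ (j.insertNth x y)

/-- The one-body density `ρ_Ψ`. -/
def density {d n : ℕ} (Ψ : (Fin (n + 1) → E d) → ℂ) (x : E d) : ℝ≥0∞ :=
  ∑ j, ∫⁻ y : Fin n → E d, ‖slice Ψ j y x‖ₑ ^ 2

open Classical in
/-- The quadratic form of the localized operator `(-Δ)^s_{|Ω}`: it is `‖u‖²_{Ḣ^s(Ω)}` if the
restriction of `u` to `Ω` belongs to `H^s(Ω)`, and `+∞` outside this form domain. -/
def localEnergy {d : ℕ} (s : ℝ) (Ω : Set (E d)) (u : E d → ℂ) : ℝ≥0∞ :=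
  if MemHs s Ω u then hsSeminormSq s Ω u else ⊤

/-- `⟨Ψ, ∑_j (-Δ_{x_j})^s_{|Ω} Ψ⟩ ∈ [0,∞]`: the form of `(-Δ)^s_{|Ω}` acts in the `j`-th variable,
and is integrated over the other variables. -/
def localKineticEnergy {d n : ℕ} (s : ℝ) (Ω : Set (E d)) (Ψ : (Fin (n + 1) → E d) → ℂ) : ℝ≥0∞ :=
  ∑ j, ∫⁻ y : Fin n → E d, localEnergy s Ω (slice Ψ j y)

end LocalUncertainty

end

open LocalUncertainty

/-!
The proof reduces the many-body inequality to an inequality for a single function `u` on `Ω'`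
(`OneBodyBound`), whose left side is the functional `F(ρ) = ∫_Ω ρ^{1+q} / (∫_Ω' ρ)^q` of
`ρ = |u|²`, with `q = 2s/d`. This functional is convex and homogeneous of degree one, so that
`F(ρ_Ψ)` is at most the sum over `j` of the integrals over `y` of `F(|Ψ_j^y|²)`. This is Hölder's
inequality (`lintegral_rpow_div_lintegral_le`), and a one-body bound yields the many-body bound
with the same constant (`OneBodyBound.many_body`).

For the one-body bound (`exists_oneBodyBound`), the Gagliardo–Nirenberg inequality is applied to
`χ u`, where `χ` is a cut-off function between `Ω` and `Ω'`. It remains to bound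
`⟨χ u, (-Δ)^s χ u⟩` by `(1 + ε) ‖u‖²_{Ḣ^s(Ω')}` plus a multiple of `‖u‖²_{L²(Ω')}`:
* The energy of `χ u` is the multinomial sum of the energies of order `σ = s - ⌊s⌋` of
  `D^α (χ u)`, `|α| = ⌊s⌋` (`fracLaplaceEnergy_eq_sum`). By the Leibniz rule (`exists_leibniz`)
  these derivatives are `χ D^α u` up to terms of lower order.
* The energy of order `σ ∈ (0,1)` is the Gagliardo double integral with the sharp constant
  `c_{d,σ}` (`gagliardo_eq_fracLaplaceEnergy`), and multiplication by `χ` raises the double integral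
  over `Ω' × Ω'` by little, up to an `L²` norm (`exists_gagliardoSq_cutoff_le`).
* The derivatives of order less than `s` are absorbed into the seminorm on `Ω'`
  (`exists_lowerOrderSq_le`): on `ℝ^d` this is seen by Fourier transform, and the extension operator
  of `Ω'` carries it over to `Ω'`. Only its boundedness for `t = s` and `t = 0` is used.

As for the constant, the optimal one scales like `L^{-2s}` under dilations (`OneBodyBound.dilate`).
It may vanish, and `dist(Ω, ℝ^d \ Ω')^{-2s}`, which scales in the same way, is added to make it
positive (`localConst`).
-/

noncomputable section

namespace LocalUncertainty

/-! ### Calculus of multi-indices -/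

variable {d : ℕ}

/-- Every multi-index is reached from `0` by adding unit vectors. -/
theorem multiIndex_induction {P : (Fin d → ℕ) → Prop} (h0 : P 0)
    (hstep : ∀ α k, P α → P (α + Pi.single k 1)) (α : Fin d → ℕ) : P α := by
  induction hn : ∑ i, α i generalizing α with
  | zero =>
    have : α = 0 := by
      ext i
      simpa using (Finset.sum_eq_zero_iff.1 hn) i (Finset.mem_univ i)
    rwa [this]
  | succ n ih =>
    obtain ⟨k, hk⟩ : ∃ k, α k ≠ 0 := by
      by_contra! h
      simp [h] at hn
    have hle : (Pi.single k 1 : Fin d → ℕ) ≤ α := by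
      intro i
      by_cases hik : i = k
      · subst hik; simp; omega
      · simp [hik]
    have hα : α - Pi.single k 1 + Pi.single k 1 = α := tsub_add_cancel_of_le hle
    rw [← hα]
    refine hstep _ _ (ih _ ?_)
    have := congrArg (fun β : Fin d → ℕ => ∑ i, β i) hα
    simp only [Pi.add_apply, Finset.sum_add_distrib, Finset.sum_pi_single', Finset.mem_univ,
      if_true, hn] at this
    simpa using this

theorem sum_add_single (α : Fin d → ℕ) (k : Fin d) :
    ∑ i, (α + Pi.single k 1 : Fin d → ℕ) i = ∑ i, α i + 1 := by
  simp [Finset.sum_add_distrib]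

theorem contDiff_partialDeriv (k : Fin d) {f : E d → ℝ} (hf : ContDiff ℝ ∞ f) :
    ContDiff ℝ ∞ (partialDeriv k f) :=
  (hf.fderiv_right (m := ∞) (by simp)).clm_apply contDiff_const

theorem tsupport_partialDeriv_subset (k : Fin d) (f : E d → ℝ) :
    tsupport (partialDeriv k f) ⊆ tsupport f := by
  refine (closure_mono ?_).trans (tsupport_fderiv_subset ℝ (f := f))
  intro x hx h
  exact hx (by simp [partialDeriv, h])

theorem partialDeriv_comm (j k : Fin d) {f : E d → ℝ} (hf : ContDiff ℝ ∞ f) :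
    partialDeriv j (partialDeriv k f) = partialDeriv k (partialDeriv j f) := by
  have key : ∀ (i l : Fin d) (x : E d), partialDeriv i (partialDeriv l f) x =
      fderiv ℝ (fderiv ℝ f) x (EuclideanSpace.single i 1) (EuclideanSpace.single l 1) := by
    intro i l x
    have hd : DifferentiableAt ℝ (fderiv ℝ f) x :=
      ((hf.fderiv_right (m := ∞) (by simp)).differentiable (by simp)) x
    change fderiv ℝ (fun y => fderiv ℝ f y (EuclideanSpace.single l 1)) x _ = _
    rw [fderiv_clm_apply hd (differentiableAt_const _)]
    simp
  ext x
  rw [key, key]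
  have h2 : minSmoothness ℝ 2 ≤ (∞ : WithTop ℕ∞) := by
    rw [minSmoothness_of_isRCLikeNormedField]
    exact WithTop.coe_le_coe.2 (le_top : (2 : ℕ∞) ≤ ⊤)
  exact (hf.contDiffAt.isSymmSndFDerivAt h2) _ _

theorem contDiff_iterate_partialDeriv (k : Fin d) (n : ℕ) {f : E d → ℝ} (hf : ContDiff ℝ ∞ f) :
    ContDiff ℝ ∞ ((partialDeriv k)^[n] f) := by
  induction n generalizing f with
  | zero => exact hf
  | succ n ih => exact ih (contDiff_partialDeriv k hf)

theorem tsupport_iterate_partialDeriv_subset (k : Fin d) (n : ℕ) (f : E d → ℝ) :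
    tsupport ((partialDeriv k)^[n] f) ⊆ tsupport f := by
  induction n generalizing f with
  | zero => exact subset_rfl
  | succ n ih => exact (ih _).trans (tsupport_partialDeriv_subset k f)

theorem iterate_partialDeriv_comm (j k : Fin d) (n : ℕ) {f : E d → ℝ} (hf : ContDiff ℝ ∞ f) :
    (partialDeriv j)^[n] (partialDeriv k f) = partialDeriv k ((partialDeriv j)^[n] f) := by
  induction n generalizing f with
  | zero => rfl
  | succ n ih =>
    simp only [Function.iterate_succ, Function.comp_apply]
    rw [partialDeriv_comm j k hf, ih (contDiff_partialDeriv j hf)]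

theorem contDiff_foldr_partialDeriv (l : List (Fin d)) (α : Fin d → ℕ) {f : E d → ℝ}
    (hf : ContDiff ℝ ∞ f) :
    ContDiff ℝ ∞ (l.foldr (fun k g => (partialDeriv k)^[α k] g) f) := by
  induction l with
  | nil => exact hf
  | cons j l ih => exact contDiff_iterate_partialDeriv j _ ih

theorem contDiff_multiDeriv (α : Fin d → ℕ) {f : E d → ℝ} (hf : ContDiff ℝ ∞ f) :
    ContDiff ℝ ∞ (multiDeriv α f) :=
  contDiff_foldr_partialDeriv _ α hf

theorem tsupport_multiDeriv_subset (α : Fin d → ℕ) (f : E d → ℝ) :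
    tsupport (multiDeriv α f) ⊆ tsupport f := by
  unfold multiDeriv
  induction List.finRange d with
  | nil => exact subset_rfl
  | cons j l ih => exact (tsupport_iterate_partialDeriv_subset j _ _).trans ih

theorem foldr_partialDeriv_comm (l : List (Fin d)) (α : Fin d → ℕ) (k : Fin d) {f : E d → ℝ}
    (hf : ContDiff ℝ ∞ f) :
    l.foldr (fun j g => (partialDeriv j)^[α j] g) (partialDeriv k f) =
      partialDeriv k (l.foldr (fun j g => (partialDeriv j)^[α j] g) f) := by
  induction l with
  | nil => rfl
  | cons j l ih =>
    simp only [List.foldr_cons]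
    rw [ih, iterate_partialDeriv_comm j k _ (contDiff_foldr_partialDeriv l α hf)]

theorem foldr_partialDeriv_add_single (l : List (Fin d)) (hl : l.Nodup) (α : Fin d → ℕ)
    (k : Fin d) {f : E d → ℝ} (hf : ContDiff ℝ ∞ f) :
    l.foldr (fun j g => (partialDeriv j)^[(α + Pi.single k 1 : Fin d → ℕ) j] g) f =
      if k ∈ l then partialDeriv k (l.foldr (fun j g => (partialDeriv j)^[α j] g) f)
      else l.foldr (fun j g => (partialDeriv j)^[α j] g) f := by
  induction l with
  | nil => simp
  | cons j l ih =>
    rw [List.nodup_cons] at hl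
    simp only [List.foldr_cons]
    rw [ih hl.2]
    by_cases hjk : k = j
    · subst hjk
      simp only [hl.1, if_false, List.mem_cons, true_or, if_true, Pi.add_apply, Pi.single_eq_same]
      rw [Function.iterate_succ_apply']
    · by_cases hkl : k ∈ l
      · simp only [hkl, if_true, List.mem_cons, or_true, Pi.add_apply, Pi.single_apply,
          Ne.symm hjk, if_false, add_zero]
        rw [iterate_partialDeriv_comm j k _ (contDiff_foldr_partialDeriv l α hf)]
      · simp [hkl, hjk, Ne.symm hjk]

theorem multiDeriv_add_single (α : Fin d → ℕ) (k : Fin d) {f : E d → ℝ} (hf : ContDiff ℝ ∞ f) :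
    multiDeriv (α + Pi.single k 1) f = multiDeriv α (partialDeriv k f) := by
  unfold multiDeriv
  rw [foldr_partialDeriv_add_single _ (List.nodup_finRange d) α k hf,
    foldr_partialDeriv_comm _ α k hf]
  simp

theorem multiDeriv_zero (f : E d → ℝ) : multiDeriv (0 : Fin d → ℕ) f = f := by
  unfold multiDeriv
  induction List.finRange d with
  | nil => rfl
  | cons j l ih => simp

theorem multiDeriv_single (k : Fin d) {f : E d → ℝ} (hf : ContDiff ℝ ∞ f) :
    multiDeriv (Pi.single k 1) f = partialDeriv k f := by
  rw [← zero_add (Pi.single k 1 : Fin d → ℕ), multiDeriv_add_single 0 k hf, multiDeriv_zero]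

/-! ### Weak derivatives -/

/-- A test function times a locally integrable function is integrable. -/
theorem integrableOn_smul_of_tsupport_subset {Ω : Set (E d)} {u : E d → ℂ}
    (hu : LocallyIntegrableOn u Ω) {φ : E d → ℝ} (hφ : Continuous φ) (hc : HasCompactSupport φ)
    (hs : tsupport φ ⊆ Ω) : IntegrableOn (fun x => φ x • u x) Ω := by
  have h1 : IntegrableOn u (tsupport φ) := hu.integrableOn_compact_subset hs hc
  have h2 : IntegrableOn (fun x => φ x • u x) (tsupport φ) :=
    h1.continuousOn_smul hφ.continuousOn hc
  refine (h2.integrable_of_forall_notMem_eq_zero ?_).integrableOn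
  intro x hx
  simp [image_eq_zero_of_notMem_tsupport hx]

theorem locallyIntegrableOn_of_memLp {Ω : Set (E d)} {u : E d → ℂ}
    (hu : MemLp u 2 (volume.restrict Ω)) : LocallyIntegrableOn u Ω :=
  locallyIntegrableOn_of_locallyIntegrable_restrict (hu.locallyIntegrable (by norm_num))

theorem locallyIntegrableOn_congr_ae {Ω : Set (E d)} (hΩ : IsOpen Ω) {u u' : E d → ℂ}
    (h : u =ᵐ[volume.restrict Ω] u') (hu : LocallyIntegrableOn u Ω) :
    LocallyIntegrableOn u' Ω := by
  rw [locallyIntegrableOn_iff hΩ.isLocallyClosed] at hu ⊢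
  intro k hk hkc
  exact (hu k hk hkc).congr_fun_ae (ae_restrict_of_ae_restrict_of_subset hk h)

theorem HasWeakDeriv.congr {Ω : Set (E d)} (hΩ : IsOpen Ω) {α : Fin d → ℕ} {u u' v v' : E d → ℂ}
    (hu : u =ᵐ[volume.restrict Ω] u') (hv : v =ᵐ[volume.restrict Ω] v')
    (h : HasWeakDeriv Ω α u v) : HasWeakDeriv Ω α u' v' where
  locallyIntegrable := locallyIntegrableOn_congr_ae hΩ hu h.locallyIntegrable
  locallyIntegrable_deriv := locallyIntegrableOn_congr_ae hΩ hv h.locallyIntegrable_deriv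
  integral_eq φ h1 h2 h3 := by
    have e1 : ∫ x in Ω, multiDeriv α φ x • u' x = ∫ x in Ω, multiDeriv α φ x • u x :=
      integral_congr_ae (by filter_upwards [hu] with x hx using by rw [hx])
    have e2 : ∫ x in Ω, φ x • v' x = ∫ x in Ω, φ x • v x :=
      integral_congr_ae (by filter_upwards [hv] with x hx using by rw [hx])
    rw [e1, e2, h.integral_eq φ h1 h2 h3]

theorem HasWeakDeriv.unique {Ω : Set (E d)} (hΩ : IsOpen Ω) {α : Fin d → ℕ} {u v v' : E d → ℂ}
    (h : HasWeakDeriv Ω α u v) (h' : HasWeakDeriv Ω α u v') : v =ᵐ[volume.restrict Ω] v' := by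
  have key := hΩ.ae_eq_zero_of_integral_contDiff_smul_eq_zero (μ := volume) (f := v - v')
    (h.locallyIntegrable_deriv.sub h'.locallyIntegrable_deriv) (fun g hg hgc hgs => ?_)
  · rw [Filter.EventuallyEq, ae_restrict_iff' hΩ.measurableSet]
    filter_upwards [key] with x hx hxΩ
    exact sub_eq_zero.1 (hx hxΩ)
  · have i1 := integrableOn_smul_of_tsupport_subset h.locallyIntegrable_deriv hg.continuous hgc hgs
    have i2 := integrableOn_smul_of_tsupport_subset h'.locallyIntegrable_deriv hg.continuous hgc hgs
    have e : ∫ x in Ω, g x • v x = ∫ x in Ω, g x • v' x := by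
      have := (h.integral_eq g hg hgc hgs).symm.trans (h'.integral_eq g hg hgc hgs)
      exact mul_left_cancel₀ (pow_ne_zero _ (by norm_num)) this
    have : ∫ x, g x • (v - v') x = ∫ x in Ω, g x • (v - v') x := by
      refine (setIntegral_eq_integral_of_forall_compl_eq_zero fun x hx => ?_).symm
      rw [image_eq_zero_of_notMem_tsupport (fun h => hx (hgs h)), zero_smul]
    rw [this]
    simp only [Pi.sub_apply, smul_sub]
    rw [integral_sub i1 i2, e, sub_self]

theorem hasWeakDeriv_weakDeriv {Ω : Set (E d)} {α : Fin d → ℕ} {u : E d → ℂ}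
    (h : ∃ v, HasWeakDeriv Ω α u v) : HasWeakDeriv Ω α u (weakDeriv Ω α u) := by
  rw [weakDeriv, dif_pos h]
  exact h.choose_spec

theorem HasWeakDeriv.weakDeriv_ae_eq {Ω : Set (E d)} (hΩ : IsOpen Ω) {α : Fin d → ℕ}
    {u v : E d → ℂ} (h : HasWeakDeriv Ω α u v) : weakDeriv Ω α u =ᵐ[volume.restrict Ω] v :=
  (hasWeakDeriv_weakDeriv ⟨v, h⟩).unique hΩ h

theorem hasWeakDeriv_eq_of_ae_eq {Ω : Set (E d)} (hΩ : IsOpen Ω) {u u' : E d → ℂ}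
    (h : u =ᵐ[volume.restrict Ω] u') (α : Fin d → ℕ) :
    HasWeakDeriv Ω α u = HasWeakDeriv Ω α u' := by
  ext v
  exact ⟨fun h' => h'.congr hΩ h .rfl, fun h' => h'.congr hΩ h.symm .rfl⟩

/-- The chosen weak derivative depends only on the almost everywhere class of the function. -/
theorem weakDeriv_congr {Ω : Set (E d)} (hΩ : IsOpen Ω) {u u' : E d → ℂ}
    (h : u =ᵐ[volume.restrict Ω] u') (α : Fin d → ℕ) : weakDeriv Ω α u = weakDeriv Ω α u' := by
  unfold weakDeriv
  rw [hasWeakDeriv_eq_of_ae_eq hΩ h α]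

theorem hsSeminormSq_congr {Ω : Set (E d)} (hΩ : IsOpen Ω) {u u' : E d → ℂ} (s : ℝ)
    (h : u =ᵐ[volume.restrict Ω] u') : hsSeminormSq s Ω u = hsSeminormSq s Ω u' := by
  simp only [hsSeminormSq, weakDeriv_congr hΩ h]

theorem hsNormSq_congr {Ω : Set (E d)} (hΩ : IsOpen Ω) {u u' : E d → ℂ} (s : ℝ)
    (h : u =ᵐ[volume.restrict Ω] u') : hsNormSq s Ω u = hsNormSq s Ω u' := by
  simp only [hsNormSq, hsSeminormSq_congr hΩ s h, weakDeriv_congr hΩ h]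

theorem memHs_congr {Ω : Set (E d)} (hΩ : IsOpen Ω) {u u' : E d → ℂ} (s : ℝ)
    (h : u =ᵐ[volume.restrict Ω] u') : MemHs s Ω u ↔ MemHs s Ω u' := by
  simp only [MemHs, hsNormSq_congr hΩ s h, hasWeakDeriv_eq_of_ae_eq hΩ h]

theorem localEnergy_congr {Ω : Set (E d)} (hΩ : IsOpen Ω) {u u' : E d → ℂ} (s : ℝ)
    (h : u =ᵐ[volume.restrict Ω] u') : localEnergy s Ω u = localEnergy s Ω u' := by
  unfold localEnergy
  rw [hsSeminormSq_congr hΩ s h]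
  congr 1
  exact propext (memHs_congr hΩ s h)

theorem hasWeakDeriv_zero {Ω : Set (E d)} {u : E d → ℂ} (hu : LocallyIntegrableOn u Ω) :
    HasWeakDeriv Ω 0 u u where
  locallyIntegrable := hu
  locallyIntegrable_deriv := hu
  integral_eq φ _ _ _ := by simp [multiDeriv_zero]

/-- If `v = D^α u` and `v' = D^{α + e_k} u`, then `v' = ∂_k v`. -/
theorem HasWeakDeriv.step {Ω : Set (E d)} {α : Fin d → ℕ} {k : Fin d} {u v v' : E d → ℂ}
    (h : HasWeakDeriv Ω α u v) (h' : HasWeakDeriv Ω (α + Pi.single k 1) u v') :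
    HasWeakDeriv Ω (Pi.single k 1) v v' where
  locallyIntegrable := h.locallyIntegrable_deriv
  locallyIntegrable_deriv := h'.locallyIntegrable_deriv
  integral_eq φ h1 h2 h3 := by
    have e1 := h'.integral_eq φ h1 h2 h3
    have hs := tsupport_partialDeriv_subset k φ
    have e2 := h.integral_eq (partialDeriv k φ) (contDiff_partialDeriv k h1)
      (h2.of_isClosed_subset (isClosed_tsupport _) hs) (hs.trans h3)
    rw [multiDeriv_add_single α k h1, e2, sum_add_single, pow_succ, mul_assoc] at e1
    have e3 := mul_left_cancel₀ (pow_ne_zero _ (by norm_num)) e1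
    rw [multiDeriv_single k h1, e3]
    simp

/-- Conversely to `HasWeakDeriv.step`, weak derivatives compose. -/
theorem HasWeakDeriv.comp {Ω : Set (E d)} {α : Fin d → ℕ} {k : Fin d} {u v v' : E d → ℂ}
    (h : HasWeakDeriv Ω α u v) (h' : HasWeakDeriv Ω (Pi.single k 1) v v') :
    HasWeakDeriv Ω (α + Pi.single k 1) u v' where
  locallyIntegrable := h.locallyIntegrable
  locallyIntegrable_deriv := h'.locallyIntegrable_deriv
  integral_eq φ h1 h2 h3 := by
    have e1 := h'.integral_eq φ h1 h2 h3
    have hs := tsupport_partialDeriv_subset k φ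
    have e2 := h.integral_eq (partialDeriv k φ) (contDiff_partialDeriv k h1)
      (h2.of_isClosed_subset (isClosed_tsupport _) hs) (hs.trans h3)
    rw [multiDeriv_single k h1] at e1
    rw [multiDeriv_add_single α k h1, e2, e1, sum_add_single, pow_succ, mul_assoc]
    simp

theorem HasWeakDeriv.mono {Ω Ω' : Set (E d)} (hΩ : Ω ⊆ Ω') {α : Fin d → ℕ} {u v : E d → ℂ}
    (h : HasWeakDeriv Ω' α u v) : HasWeakDeriv Ω α u v where
  locallyIntegrable := h.locallyIntegrable.mono_set hΩ
  locallyIntegrable_deriv := h.locallyIntegrable_deriv.mono_set hΩ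
  integral_eq φ h1 h2 h3 := by
    have z : ∀ (Ω : Set (E d)), tsupport φ ⊆ Ω → ∀ (ψ : E d → ℝ) (w : E d → ℂ),
        tsupport ψ ⊆ tsupport φ → ∫ x in Ω, ψ x • w x = ∫ x, ψ x • w x := by
      intro Ω h ψ w hs
      refine setIntegral_eq_integral_of_forall_compl_eq_zero fun x hx => ?_
      rw [image_eq_zero_of_notMem_tsupport (fun h' => hx (h (hs h'))), zero_smul]
    have := h.integral_eq φ h1 h2 (h3.trans hΩ)
    rw [z _ (h3.trans hΩ) _ _ subset_rfl, z _ (h3.trans hΩ) _ _ (tsupport_multiDeriv_subset α φ)]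
      at this
    rw [z _ h3 _ _ subset_rfl, z _ h3 _ _ (tsupport_multiDeriv_subset α φ), this]

end LocalUncertainty
end

noncomputable section

namespace LocalUncertainty

/-! ### From one particle to many -/

variable {d : ℕ}

/-- Jensen's inequality for the convex, 1-homogeneous function `(a, b) ↦ a ^ (1 + q) / b ^ q`. -/
theorem lintegral_rpow_div_le {Y : Type*} [MeasurableSpace Y] {ν : Measure Y} {q : ℝ} (hq : 0 < q)
    {a b : Y → ℝ≥0∞} (ha : Measurable a) (hb : Measurable b) (hfin : ∫⁻ y, b y ∂ν ≠ ⊤)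
    (h0 : ∀ᵐ y ∂ν, b y = 0 → a y = 0) :
    (∫⁻ y, a y ∂ν) ^ (1 + q) / (∫⁻ y, b y ∂ν) ^ q ≤ ∫⁻ y, a y ^ (1 + q) / b y ^ q ∂ν := by
  have hp : 0 < 1 + q := by linarith
  have hconj : (1 + q).HolderConjugate ((1 + q) / q) := by
    rw [Real.holderConjugate_iff]
    refine ⟨by linarith, ?_⟩
    field_simp
  have hbfin : ∀ᵐ y ∂ν, b y < ⊤ := ae_lt_top hb hfin
  set θ : ℝ := q / (1 + q) with hθ
  have hθpos : 0 < θ := by positivity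
  have h1 : ∫⁻ y, a y ∂ν ≤ ∫⁻ y, ((fun y => a y / b y ^ θ) * fun y => b y ^ θ) y ∂ν := by
    refine lintegral_mono_ae ?_
    filter_upwards [h0, hbfin] with y hy hyf
    simp only [Pi.mul_apply]
    by_cases hb0 : b y = 0
    · simp [hy hb0]
    · rw [ENNReal.div_mul_cancel]
      · simp [hb0, hyf.ne]
      · exact ENNReal.rpow_ne_top_of_nonneg hθpos.le hyf.ne
  have h2 := ENNReal.lintegral_mul_le_Lp_mul_Lq ν hconj (f := fun y => a y / b y ^ θ)
    (g := fun y => b y ^ θ) (by fun_prop) (by fun_prop)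
  have e1 : ∀ y, (a y / b y ^ θ) ^ (1 + q) = a y ^ (1 + q) / b y ^ q := by
    intro y
    rw [ENNReal.div_rpow_of_nonneg _ _ hp.le, ← ENNReal.rpow_mul, hθ, div_mul_cancel₀ _ hp.ne']
  have e2 : ∀ y, (b y ^ θ) ^ ((1 + q) / q) = b y := by
    intro y
    rw [← ENNReal.rpow_mul, hθ, div_mul_div_comm, mul_comm q, div_self (by positivity),
      ENNReal.rpow_one]
  simp only [e1, e2] at h2
  have h3 := h1.trans h2
  have h4 := ENNReal.rpow_le_rpow h3 hp.le
  rw [ENNReal.mul_rpow_of_nonneg _ _ hp.le, ← ENNReal.rpow_mul, ← ENNReal.rpow_mul,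
    one_div_mul_cancel hp.ne', ENNReal.rpow_one,
    show 1 / ((1 + q) / q) * (1 + q) = q by field_simp] at h4
  exact ENNReal.div_le_of_le_mul h4

/-- The functional `ρ ↦ (∫_A ρ^{1+q}) / (∫_B ρ)^q` is convex and 1-homogeneous, so that it
decreases when an average (with respect to any measure) is taken. -/
theorem lintegral_rpow_div_lintegral_le {X Y : Type*} [MeasurableSpace X] [MeasurableSpace Y]
    {μ : Measure X} {ν : Measure Y} [SFinite μ] [SFinite ν] {q : ℝ} (hq : 0 < q) {A B : Set X}
    (hAB : A ⊆ B) {g : X → Y → ℝ≥0∞} (hg : Measurable (Function.uncurry g))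
    (hfin : ∫⁻ x in B, ∫⁻ y, g x y ∂ν ∂μ ≠ ⊤) :
    (∫⁻ x in A, (∫⁻ y, g x y ∂ν) ^ (1 + q) ∂μ) / (∫⁻ x in B, ∫⁻ y, g x y ∂ν ∂μ) ^ q ≤
      ∫⁻ y, (∫⁻ x in A, g x y ^ (1 + q) ∂μ) / (∫⁻ x in B, g x y ∂μ) ^ q ∂ν := by
  set b : Y → ℝ≥0∞ := fun y => ∫⁻ x in B, g x y ∂μ with hb
  have hbm : Measurable b := hg.lintegral_prod_left'
  have hswap : ∫⁻ x in B, ∫⁻ y, g x y ∂ν ∂μ = ∫⁻ y, b y ∂ν :=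
    lintegral_lintegral_swap hg.aemeasurable
  rw [hswap] at hfin ⊢
  -- where `b` vanishes, so does `g`
  have hzero : ∀ᵐ x ∂μ.restrict A, ∀ᵐ y ∂ν, b y = 0 → g x y = 0 := by
    have hm : Measurable (Function.uncurry fun x y => ({0} : Set ℝ≥0∞).indicator 1 (b y) * g x y) :=
      ((measurable_one.indicator (measurableSet_singleton 0)).comp
        (hbm.comp measurable_snd)).mul hg
    have hint : ∫⁻ x in A, ∫⁻ y, ({0} : Set ℝ≥0∞).indicator 1 (b y) * g x y ∂ν ∂μ = 0 := by
      rw [lintegral_lintegral_swap hm.aemeasurable]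
      refine (lintegral_congr fun y => ?_).trans lintegral_zero
      have : Measurable fun x => g x y := hg.comp (measurable_id.prodMk measurable_const)
      rw [lintegral_const_mul _ this]
      by_cases hy : b y = 0
      · have : ∫⁻ x in A, g x y ∂μ = 0 :=
          le_antisymm ((lintegral_mono_set hAB).trans hy.le) bot_le
        simp [this]
      · simp [hy]
    have hint' := (lintegral_eq_zero_iff hm.lintegral_prod_right').1 hint
    filter_upwards [hint'] with x hx
    have hmx : Measurable fun y => ({0} : Set ℝ≥0∞).indicator 1 (b y) * g x y :=
      hm.comp (measurable_const.prodMk measurable_id)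
    have hx' := (lintegral_eq_zero_iff hmx).1 hx
    filter_upwards [hx'] with y hy hby
    simpa [hby] using hy
  have hbq : Measurable fun y => b y ^ q := hbm.pow_const q
  calc (∫⁻ x in A, (∫⁻ y, g x y ∂ν) ^ (1 + q) ∂μ) / (∫⁻ y, b y ∂ν) ^ q
      = ∫⁻ x in A, (∫⁻ y, g x y ∂ν) ^ (1 + q) / (∫⁻ y, b y ∂ν) ^ q ∂μ := by
        simp only [div_eq_mul_inv]
        have hm : Measurable fun x => (∫⁻ y, g x y ∂ν) ^ (1 + q) :=
          hg.lintegral_prod_right'.pow_const _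
        rw [lintegral_mul_const _ hm]
    _ ≤ ∫⁻ x in A, ∫⁻ y, g x y ^ (1 + q) / b y ^ q ∂ν ∂μ := by
        refine lintegral_mono_ae ?_
        filter_upwards [hzero] with x hx
        exact lintegral_rpow_div_le hq (hg.comp (measurable_const.prodMk measurable_id)) hbm
          hfin hx
    _ = ∫⁻ y, ∫⁻ x in A, g x y ^ (1 + q) / b y ^ q ∂μ ∂ν := by
        refine lintegral_lintegral_swap (Measurable.aemeasurable ?_)
        exact (hg.pow_const _).div (hbq.comp measurable_snd)
    _ = ∫⁻ y, (∫⁻ x in A, g x y ^ (1 + q) ∂μ) / b y ^ q ∂ν := by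
        refine lintegral_congr fun y => ?_
        simp only [div_eq_mul_inv]
        rw [lintegral_mul_const]
        exact (hg.comp (measurable_id.prodMk measurable_const)).pow_const _

/-- The case of one particle: the local uncertainty inequality with constant `C` for all functions
in `L²(Ω')`. -/
def OneBodyBound (s δ : ℝ) (Ω Ω' : Set (E d)) (C : ℝ) : Prop :=
  ∀ u : E d → ℂ, MemLp u 2 (volume.restrict Ω') →
    gnConst d s * ENNReal.ofReal (1 - δ) *
        ((∫⁻ x in Ω, (‖u x‖ₑ ^ 2) ^ (1 + 2 * s / (d : ℝ))) /
          (∫⁻ x in Ω', ‖u x‖ₑ ^ 2) ^ (2 * s / (d : ℝ)))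
      ≤ localEnergy s Ω' u + ENNReal.ofReal C * ∫⁻ x in Ω', ‖u x‖ₑ ^ 2

theorem measurePreserving_insertNth {n : ℕ} (j : Fin (n + 1)) :
    MeasurePreserving (fun p : E d × (Fin n → E d) => (j.insertNth p.1 p.2 : Fin (n + 1) → E d))
      (volume.prod volume) volume :=
  (volume_preserving_piFinSuccAbove (fun _ : Fin (n + 1) => E d) j).symm

/-- A one-particle bound carries over to any number of particles, with the same constants. -/
theorem OneBodyBound.many_body (hd : 1 ≤ d) {s δ C : ℝ} (hs : 0 < s) {Ω Ω' : Set (E d)}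
    (hΩ' : IsOpen Ω') (hsub : Ω ⊆ Ω') (h : OneBodyBound s δ Ω Ω' C) {n : ℕ}
    {Ψ : (Fin (n + 1) → E d) → ℂ} (hΨ : MemLp Ψ 2 volume) :
    gnConst d s * ENNReal.ofReal (1 - δ) *
        ((∫⁻ x in Ω, density Ψ x ^ (1 + 2 * s / (d : ℝ))) /
          (∫⁻ x in Ω', density Ψ x) ^ (2 * s / (d : ℝ)))
      ≤ localKineticEnergy s Ω' Ψ + ENNReal.ofReal C * ∫⁻ x in Ω', density Ψ x := by
  have hq : 0 < 2 * s / (d : ℝ) := by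
    have : (0 : ℝ) < d := by exact_mod_cast hd
    positivity
  set q := 2 * s / (d : ℝ)
  set K := gnConst d s * ENNReal.ofReal (1 - δ)
  -- pass to a measurable representative
  set Φ : (Fin (n + 1) → E d) → ℂ := hΨ.1.mk Ψ with hΦ
  have hΦm : Measurable Φ := hΨ.1.stronglyMeasurable_mk.measurable
  have hΨΦ : Ψ =ᵐ[volume] Φ := hΨ.1.ae_eq_mk
  have hprod : ∀ j : Fin (n + 1), ∀ᵐ p : E d × (Fin n → E d) ∂(volume.prod volume),
      slice Ψ j p.2 p.1 = slice Φ j p.2 p.1 := fun j =>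
    (measurePreserving_insertNth j).quasiMeasurePreserving.ae hΨΦ
  have hmeas : ∀ j : Fin (n + 1),
      Measurable (Function.uncurry fun (x : E d) (y : Fin n → E d) => ‖slice Φ j y x‖ₑ ^ 2) := by
    intro j
    exact (hΦm.comp (measurePreserving_insertNth j).measurable).enorm.pow_const 2
  have hdens : density Ψ =ᵐ[volume] density Φ := by
    have : ∀ᵐ x : E d, ∀ j : Fin (n + 1), ∀ᵐ y : Fin n → E d,
        slice Ψ j y x = slice Φ j y x := by
      rw [ae_all_iff]
      exact fun j => Measure.ae_ae_of_ae_prod (hprod j)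
    filter_upwards [this] with x hx
    refine Finset.sum_congr rfl fun j _ => lintegral_congr_ae ?_
    filter_upwards [hx j] with y hy
    rw [hy]
  have hkin : localKineticEnergy s Ω' Ψ = localKineticEnergy s Ω' Φ := by
    refine Finset.sum_congr rfl fun j _ => lintegral_congr_ae ?_
    have : ∀ᵐ y : Fin n → E d, ∀ᵐ x : E d, slice Ψ j y x = slice Φ j y x :=
      Measure.ae_ae_of_ae_prod
        ((Measure.measurePreserving_swap (μ := (volume : Measure (Fin n → E d)))
          (ν := (volume : Measure (E d)))).quasiMeasurePreserving.ae (hprod j))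
    filter_upwards [this] with y hy
    exact localEnergy_congr hΩ' s (ae_restrict_of_ae hy)
  have e1 : ∫⁻ x in Ω, density Ψ x ^ (1 + q) = ∫⁻ x in Ω, density Φ x ^ (1 + q) :=
    lintegral_congr_ae (by
      filter_upwards [ae_restrict_of_ae hdens] with x hx
      rw [hx])
  have e2 : ∫⁻ x in Ω', density Ψ x = ∫⁻ x in Ω', density Φ x :=
    lintegral_congr_ae (ae_restrict_of_ae hdens)
  rw [e1, e2, hkin]
  set ρ : E d → Fin (n + 1) → ℝ≥0∞ := fun x j => ∫⁻ y : Fin n → E d, ‖slice Φ j y x‖ₑ ^ 2 with hρ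
  have hρm : ∀ j, Measurable fun x => ρ x j := fun j => (hmeas j).lintegral_prod_right'
  have hρfin : ∀ j, ∫⁻ x in Ω', ρ x j ≠ ⊤ := by
    intro j
    have hΦ2 : ∫⁻ z, ‖Φ z‖ₑ ^ 2 ≠ ⊤ := by
      have := (hΨ.ae_eq hΨΦ).2
      rw [eLpNorm_lt_top_iff_lintegral_rpow_enorm_lt_top (by norm_num) (by norm_num)] at this
      simpa using this.ne
    have : ∫⁻ x, ρ x j = ∫⁻ z, ‖Φ z‖ₑ ^ 2 := by
      rw [← (measurePreserving_insertNth j).lintegral_comp (hΦm.enorm.pow_const 2),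
        lintegral_prod]
      · rfl
      · exact (hmeas j).aemeasurable
    exact ne_top_of_le_ne_top (this ▸ hΦ2) (setLIntegral_le_lintegral _ _)
  have hsum : ∀ x, density Φ x = ∫⁻ j, ρ x j ∂Measure.count := by
    intro x
    rw [lintegral_count, tsum_fintype]
    rfl
  have hfinsum : ∫⁻ x in Ω', ∫⁻ j, ρ x j ∂Measure.count ≠ ⊤ := by
    simp only [lintegral_count, tsum_fintype]
    rw [lintegral_finsetSum _ fun j _ => hρm j]
    exact (ENNReal.sum_lt_top.2 fun j _ => (hρfin j).lt_top).ne
  have hρm' : Measurable (Function.uncurry ρ) :=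
    measurable_from_prod_countable_left fun j => hρm j
  -- convexity, first for the sum over the particles, then for the other variables
  have step1 := lintegral_rpow_div_lintegral_le (μ := (volume : Measure (E d)))
    (ν := (Measure.count : Measure (Fin (n + 1)))) hq hsub hρm' hfinsum
  have step2 : ∀ j, (∫⁻ x in Ω, ρ x j ^ (1 + q)) / (∫⁻ x in Ω', ρ x j) ^ q ≤
      ∫⁻ y : Fin n → E d, (∫⁻ x in Ω, (‖slice Φ j y x‖ₑ ^ 2) ^ (1 + q)) /
        (∫⁻ x in Ω', ‖slice Φ j y x‖ₑ ^ 2) ^ q := fun j =>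
    lintegral_rpow_div_lintegral_le hq hsub (hmeas j) (hρfin j)
  simp only [← hsum] at step1
  have step3 : ∀ j, K * ∫⁻ y : Fin n → E d, (∫⁻ x in Ω, (‖slice Φ j y x‖ₑ ^ 2) ^ (1 + q)) /
        (∫⁻ x in Ω', ‖slice Φ j y x‖ₑ ^ 2) ^ q ≤
      (∫⁻ y : Fin n → E d, localEnergy s Ω' (slice Φ j y)) +
        ENNReal.ofReal C * ∫⁻ x in Ω', ρ x j := by
    intro j
    have hbm : Measurable fun y : Fin n → E d => ∫⁻ x in Ω', ‖slice Φ j y x‖ₑ ^ 2 :=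
      (hmeas j).lintegral_prod_left'
    have ham : Measurable fun y : Fin n → E d =>
        ∫⁻ x in Ω, (‖slice Φ j y x‖ₑ ^ 2) ^ (1 + q) :=
      ((hmeas j).pow_const (1 + q)).lintegral_prod_left'
    have hdiv : Measurable fun y : Fin n → E d =>
        (∫⁻ x in Ω, (‖slice Φ j y x‖ₑ ^ 2) ^ (1 + q)) /
          (∫⁻ x in Ω', ‖slice Φ j y x‖ₑ ^ 2) ^ q := ham.div (hbm.pow_const q)
    have hswap : ∫⁻ x in Ω', ρ x j = ∫⁻ y : Fin n → E d, ∫⁻ x in Ω', ‖slice Φ j y x‖ₑ ^ 2 :=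
      lintegral_lintegral_swap (hmeas j).aemeasurable
    rw [hswap, ← lintegral_const_mul _ hbm, ← lintegral_add_right _ (hbm.const_mul _),
      ← lintegral_const_mul _ hdiv]
    refine lintegral_mono_ae ?_
    filter_upwards [ae_lt_top hbm (hswap ▸ hρfin j)] with y hy
    refine h _ ⟨?_, ?_⟩
    · refine (Measurable.stronglyMeasurable ?_).aestronglyMeasurable
      exact hΦm.comp ((measurePreserving_insertNth j).measurable.comp
        (measurable_id.prodMk measurable_const))
    · rw [eLpNorm_lt_top_iff_lintegral_rpow_enorm_lt_top (by norm_num) (by norm_num)]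
      simpa using hy
  calc K * ((∫⁻ x in Ω, density Φ x ^ (1 + q)) / (∫⁻ x in Ω', density Φ x) ^ q)
      ≤ K * ∑ j, (∫⁻ x in Ω, ρ x j ^ (1 + q)) / (∫⁻ x in Ω', ρ x j) ^ q := by
        gcongr
        simpa [lintegral_count, tsum_fintype] using step1
    _ ≤ ∑ j, ((∫⁻ y : Fin n → E d, localEnergy s Ω' (slice Φ j y)) +
        ENNReal.ofReal C * ∫⁻ x in Ω', ρ x j) := by
        rw [Finset.mul_sum]
        refine Finset.sum_le_sum fun j _ => le_trans ?_ (step3 j)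
        gcongr
        exact step2 j
    _ = localKineticEnergy s Ω' Φ + ENNReal.ofReal C * ∫⁻ x in Ω', density Φ x := by
        rw [Finset.sum_add_distrib, ← Finset.mul_sum,
          ← lintegral_finsetSum _ fun j _ => hρm j]
        rfl

end LocalUncertainty
end

noncomputable section

namespace LocalUncertainty

/-! ### Dilations -/

variable {d : ℕ} {L : ℝ}

theorem map_smul_volume (hL : 0 < L) :
    Measure.map (fun x : E d => L • x) volume = ENNReal.ofReal (L ^ (-(d : ℝ))) • volume := by
  have h := Measure.map_addHaar_smul (volume : Measure (E d)) hL.ne'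
  rw [finrank_euclideanSpace_fin, abs_of_pos (by positivity)] at h
  rw [h, Real.rpow_neg hL.le, Real.rpow_natCast]

theorem measurableEmbedding_smul (hL : 0 < L) : MeasurableEmbedding fun x : E d => L • x :=
  (Homeomorph.smulOfNeZero L hL.ne').measurableEmbedding

theorem preimage_smul_dilate (hL : 0 < L) (S : Set (E d)) :
    (fun x : E d => L • x) ⁻¹' (L • S) = S := by
  ext x
  simp [smul_mem_smul_set_iff₀ hL.ne']

theorem setLIntegral_comp_dilate (hL : 0 < L) (f : E d → ℝ≥0∞) (S : Set (E d)) :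
    ∫⁻ x in S, f (L • x) = ENNReal.ofReal (L ^ (-(d : ℝ))) * ∫⁻ x in L • S, f x := by
  have h := (measurableEmbedding_smul (d := d) hL).lintegral_map (μ := volume.restrict S) f
  have h2 := (measurableEmbedding_smul (d := d) hL).restrict_map volume (L • S)
  rw [preimage_smul_dilate hL, map_smul_volume hL, Measure.restrict_smul] at h2
  rw [← h, ← h2, lintegral_smul_measure, smul_eq_mul]

theorem setIntegral_comp_dilate (hL : 0 < L) (f : E d → ℂ) (S : Set (E d)) :
    ∫ x in S, f (L • x) = (L ^ (-(d : ℝ)) : ℝ) • ∫ x in L • S, f x := by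
  have h := (measurableEmbedding_smul (d := d) hL).setIntegral_map (μ := volume) f (L • S)
  rw [preimage_smul_dilate hL, map_smul_volume hL, Measure.restrict_smul, integral_smul_measure,
    ENNReal.toReal_ofReal (by positivity)] at h
  exact h.symm

theorem locallyIntegrableOn_comp_dilate (hL : 0 < L) {Ω : Set (E d)} (hΩ : IsOpen Ω)
    {u : E d → ℂ} (hu : LocallyIntegrableOn u (L • Ω)) :
    LocallyIntegrableOn (fun x => u (L • x)) Ω := by
  rw [locallyIntegrableOn_iff hΩ.isLocallyClosed]
  intro K hK hKc
  have h1 : IntegrableOn u (L • K) :=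
    hu.integrableOn_compact_subset (smul_set_mono hK) (hKc.smul L)
  have h2 : IntegrableOn u (L • K) (Measure.map (fun x : E d => L • x) volume) := by
    rw [map_smul_volume hL, IntegrableOn, Measure.restrict_smul]
    exact h1.smul_measure ENNReal.ofReal_ne_top
  rw [(measurableEmbedding_smul (d := d) hL).integrableOn_map_iff, preimage_smul_dilate hL] at h2
  exact h2

theorem memLp_comp_dilate (hL : 0 < L) {Ω : Set (E d)} {u : E d → ℂ}
    (hu : MemLp u 2 (volume.restrict (L • Ω))) :
    MemLp (fun x => u (L • x)) 2 (volume.restrict Ω) := by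
  have h2 : MemLp u 2 ((Measure.map (fun x : E d => L • x) volume).restrict (L • Ω)) := by
    rw [map_smul_volume hL, Measure.restrict_smul]
    exact hu.smul_measure ENNReal.ofReal_ne_top
  rw [(measurableEmbedding_smul (d := d) hL).restrict_map, preimage_smul_dilate hL,
    (measurableEmbedding_smul (d := d) hL).memLp_map_measure_iff] at h2
  exact h2

theorem partialDeriv_comp_dilate (c : ℝ) (k : Fin d) (f : E d → ℝ) :
    partialDeriv k (fun x => f (c • x)) = fun x => c * partialDeriv k f (c • x) := by
  ext x
  simp only [partialDeriv]
  rw [fderiv_comp_smul]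
  simp

theorem multiDeriv_const_mul (c : ℝ) (α : Fin d → ℕ) {f : E d → ℝ} (hf : ContDiff ℝ ∞ f) :
    multiDeriv α (fun x => c * f x) = fun x => c * multiDeriv α f x := by
  induction α using multiIndex_induction generalizing f with
  | h0 => simp [multiDeriv_zero]
  | hstep α k ih =>
    have : partialDeriv k (fun x => c * f x) = fun x => c * partialDeriv k f x := by
      ext x
      simp only [partialDeriv]
      rw [fderiv_const_mul (hf.differentiable (by simp) x)]
      simp
    rw [multiDeriv_add_single α k (contDiff_const.mul hf), this, ih (contDiff_partialDeriv k hf),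
      multiDeriv_add_single α k hf]

theorem contDiff_comp_dilate (c : ℝ) {f : E d → ℝ} (hf : ContDiff ℝ ∞ f) :
    ContDiff ℝ ∞ fun x => f (c • x) :=
  hf.comp (contDiff_const_smul c)

theorem multiDeriv_comp_dilate (c : ℝ) (α : Fin d → ℕ) {f : E d → ℝ} (hf : ContDiff ℝ ∞ f) :
    multiDeriv α (fun x => f (c • x)) = fun x => c ^ (∑ i, α i) * multiDeriv α f (c • x) := by
  induction α using multiIndex_induction generalizing f with
  | h0 => simp [multiDeriv_zero]
  | hstep α k ih =>
    rw [multiDeriv_add_single α k (contDiff_comp_dilate c hf), partialDeriv_comp_dilate,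
      multiDeriv_const_mul c α (contDiff_comp_dilate c (contDiff_partialDeriv k hf)),
      ih (contDiff_partialDeriv k hf), sum_add_single, multiDeriv_add_single α k hf]
    ext x
    ring

theorem HasWeakDeriv.comp_dilate (hL : 0 < L) {Ω : Set (E d)} (hΩ : IsOpen Ω) {α : Fin d → ℕ}
    {u v : E d → ℂ} (h : HasWeakDeriv (L • Ω) α u v) :
    HasWeakDeriv Ω α (fun x => u (L • x)) (fun x => (L ^ (∑ i, α i) : ℝ) • v (L • x)) where
  locallyIntegrable := locallyIntegrableOn_comp_dilate hL hΩ h.locallyIntegrable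
  locallyIntegrable_deriv :=
    LocallyIntegrableOn.smul (𝕜 := ℝ)
      (locallyIntegrableOn_comp_dilate hL hΩ h.locallyIntegrable_deriv) (L ^ (∑ i, α i))
  integral_eq φ h1 h2 h3 := by
    have hh := h.integral_eq (fun x => φ (L⁻¹ • x)) (contDiff_comp_dilate _ h1)
      (h2.comp_smul (inv_ne_zero hL.ne')) ?_
    · rw [multiDeriv_comp_dilate _ α h1] at hh
      have e1 := setIntegral_comp_dilate hL (fun y => multiDeriv α φ (L⁻¹ • y) • u y) Ω
      have e2 := setIntegral_comp_dilate hL (fun y => φ (L⁻¹ • y) • v y) Ω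
      simp only [inv_smul_smul₀ hL.ne'] at e1 e2
      have e3 : ∫ x in L • Ω, (L⁻¹ ^ (∑ i, α i) * multiDeriv α φ (L⁻¹ • x)) • u x =
          (L⁻¹ ^ (∑ i, α i) : ℝ) • ∫ x in L • Ω, multiDeriv α φ (L⁻¹ • x) • u x := by
        rw [← integral_smul]
        simp only [mul_smul]
      have e4 : ∫ x in Ω, φ x • (L ^ (∑ i, α i) : ℝ) • v (L • x) =
          (L ^ (∑ i, α i) : ℝ) • ∫ x in Ω, φ x • v (L • x) := by
        rw [← integral_smul]
        simp only [smul_comm (φ _)]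
      have e5 : ∫ x in L • Ω, multiDeriv α φ (L⁻¹ • x) • u x =
          (L ^ (∑ i, α i) : ℝ) • ((-1 : ℂ) ^ (∑ i, α i) * ∫ x in L • Ω, φ (L⁻¹ • x) • v x) := by
        rw [← hh, e3, smul_smul, ← mul_pow, mul_inv_cancel₀ hL.ne', one_pow, one_smul]
      rw [e1, e4, e2, e5]
      simp only [Complex.real_smul]
      ring
    · intro x hx
      have : (fun x : E d => φ (L⁻¹ • x)) =
          φ ∘ (Homeomorph.smulOfNeZero L⁻¹ (inv_ne_zero hL.ne')) := rfl
      rw [this, tsupport_comp_eq_preimage] at hx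
      rw [mem_smul_set_iff_inv_smul_mem₀ hL.ne']
      exact h3 hx

theorem isOpen_dilate (hL : 0 < L) {Ω : Set (E d)} (hΩ : IsOpen Ω) : IsOpen (L • Ω) :=
  hΩ.smul₀ hL.ne'

theorem weakDeriv_comp_dilate_ae (hL : 0 < L) {Ω : Set (E d)} (hΩ : IsOpen Ω) {α : Fin d → ℕ}
    {u : E d → ℂ} (h : ∃ v, HasWeakDeriv (L • Ω) α u v) :
    weakDeriv Ω α (fun x => u (L • x)) =ᵐ[volume.restrict Ω]
      fun x => (L ^ (∑ i, α i) : ℝ) • weakDeriv (L • Ω) α u (L • x) :=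
  ((hasWeakDeriv_weakDeriv h).comp_dilate hL hΩ).weakDeriv_ae_eq hΩ

theorem enorm_real_smul_sq {c : ℝ} (hc : 0 ≤ c) (z : ℂ) :
    ‖c • z‖ₑ ^ 2 = ENNReal.ofReal (c ^ 2) * ‖z‖ₑ ^ 2 := by
  rw [enorm_smul, mul_pow, ENNReal.ofReal_pow hc, Real.enorm_of_nonneg hc]

theorem lintegral_weakDeriv_comp_dilate (hL : 0 < L) {Ω : Set (E d)} (hΩ : IsOpen Ω)
    {α : Fin d → ℕ} {u : E d → ℂ} (h : ∃ v, HasWeakDeriv (L • Ω) α u v) :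
    ∫⁻ x in Ω, ‖weakDeriv Ω α (fun x => u (L • x)) x‖ₑ ^ 2 =
      ENNReal.ofReal (L ^ (2 * ((∑ i, α i : ℕ) : ℝ) - d)) *
        ∫⁻ x in L • Ω, ‖weakDeriv (L • Ω) α u x‖ₑ ^ 2 := by
  have e : ∫⁻ x in Ω, ‖weakDeriv Ω α (fun x => u (L • x)) x‖ₑ ^ 2 =
      ∫⁻ x in Ω, ENNReal.ofReal ((L ^ (∑ i, α i)) ^ 2) * ‖weakDeriv (L • Ω) α u (L • x)‖ₑ ^ 2 := by
    refine lintegral_congr_ae ?_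
    filter_upwards [weakDeriv_comp_dilate_ae hL hΩ h] with x hx
    rw [hx, enorm_real_smul_sq (by positivity)]
  rw [e, lintegral_const_mul' _ _ ENNReal.ofReal_ne_top,
    setLIntegral_comp_dilate hL (fun y => ‖weakDeriv (L • Ω) α u y‖ₑ ^ 2), ← mul_assoc,
    ← ENNReal.ofReal_mul (by positivity), ← pow_mul, ← Real.rpow_natCast, ← Real.rpow_add hL]
  congr 3
  push_cast
  ring

theorem gagliardo_weakDeriv_comp_dilate (hL : 0 < L) {Ω : Set (E d)} (hΩ : IsOpen Ω)
    {α : Fin d → ℕ} {u : E d → ℂ} (σ : ℝ) (h : ∃ v, HasWeakDeriv (L • Ω) α u v) :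
    ∫⁻ x in Ω, ∫⁻ y in Ω, ‖weakDeriv Ω α (fun x => u (L • x)) x -
        weakDeriv Ω α (fun x => u (L • x)) y‖ₑ ^ 2 / ENNReal.ofReal (‖x - y‖ ^ ((d : ℝ) + 2 * σ)) =
      ENNReal.ofReal (L ^ (2 * (((∑ i, α i : ℕ) : ℝ) + σ) - d)) *
        ∫⁻ x in L • Ω, ∫⁻ y in L • Ω, ‖weakDeriv (L • Ω) α u x - weakDeriv (L • Ω) α u y‖ₑ ^ 2 /
          ENNReal.ofReal (‖x - y‖ ^ ((d : ℝ) + 2 * σ)) := by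
  set v := weakDeriv (L • Ω) α u with hv
  set w := weakDeriv Ω α (fun x => u (L • x)) with hw
  have hae := weakDeriv_comp_dilate_ae hL hΩ h
  set M : ℝ := (L ^ (∑ i, α i)) ^ 2 * L ^ ((d : ℝ) + 2 * σ) with hM
  have hMpos : 0 < M := by positivity
  have e : ∫⁻ x in Ω, ∫⁻ y in Ω, ‖w x - w y‖ₑ ^ 2 / ENNReal.ofReal (‖x - y‖ ^ ((d : ℝ) + 2 * σ)) =
      ∫⁻ x in Ω, ∫⁻ y in Ω, ENNReal.ofReal M * (‖v (L • x) - v (L • y)‖ₑ ^ 2 /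
        ENNReal.ofReal (‖L • x - L • y‖ ^ ((d : ℝ) + 2 * σ))) := by
    refine lintegral_congr_ae ?_
    filter_upwards [hae] with x hx
    refine lintegral_congr_ae ?_
    filter_upwards [hae] with y hy
    have hcp : 0 < L ^ ((d : ℝ) + 2 * σ) := by positivity
    rw [hw, hx, hy, ← smul_sub, enorm_real_smul_sq (by positivity), ← smul_sub L, norm_smul,
      Real.norm_of_nonneg hL.le, Real.mul_rpow hL.le (norm_nonneg _), ENNReal.ofReal_mul hcp.le, hM,
      ENNReal.ofReal_mul (by positivity), mul_assoc, mul_div_assoc]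
    congr 1
    rw [← mul_div_assoc, ENNReal.mul_div_mul_left _ _ (by simpa using hcp) ENNReal.ofReal_ne_top]
  rw [e]
  have e2 : ∀ x, ∫⁻ y in Ω, ENNReal.ofReal M * (‖v (L • x) - v (L • y)‖ₑ ^ 2 /
        ENNReal.ofReal (‖L • x - L • y‖ ^ ((d : ℝ) + 2 * σ))) =
      ENNReal.ofReal M * (ENNReal.ofReal (L ^ (-(d : ℝ))) * ∫⁻ y in L • Ω, ‖v (L • x) - v y‖ₑ ^ 2 /
        ENNReal.ofReal (‖L • x - y‖ ^ ((d : ℝ) + 2 * σ))) := by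
    intro x
    rw [lintegral_const_mul' _ _ ENNReal.ofReal_ne_top,
      setLIntegral_comp_dilate hL (fun y => ‖v (L • x) - v y‖ₑ ^ 2 /
        ENNReal.ofReal (‖L • x - y‖ ^ ((d : ℝ) + 2 * σ)))]
  simp only [e2]
  rw [lintegral_const_mul' _ _ ENNReal.ofReal_ne_top,
    lintegral_const_mul' _ _ ENNReal.ofReal_ne_top,
    setLIntegral_comp_dilate hL (fun x => ∫⁻ y in L • Ω, ‖v x - v y‖ₑ ^ 2 /
        ENNReal.ofReal (‖x - y‖ ^ ((d : ℝ) + 2 * σ))), ← mul_assoc, ← mul_assoc,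
    ← ENNReal.ofReal_mul (by positivity), ← ENNReal.ofReal_mul (by positivity), hM, ← pow_mul,
    ← Real.rpow_natCast, ← Real.rpow_add hL, ← Real.rpow_add hL, ← Real.rpow_add hL]
  congr 3
  push_cast
  ring

theorem floor_add_fract_eq {s : ℝ} (hs : 0 < s) : (⌊s⌋₊ : ℝ) + Int.fract s = s := by
  rw [natCast_floor_eq_intCast_floor hs.le]
  exact Int.floor_add_fract s

theorem hsSeminormSq_comp_dilate (hL : 0 < L) {Ω : Set (E d)} (hΩ : IsOpen Ω) {s : ℝ} (hs : 0 < s)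
    {u : E d → ℂ} (h : ∀ α : Fin d → ℕ, ∑ i, α i ≤ ⌊s⌋₊ → ∃ v, HasWeakDeriv (L • Ω) α u v) :
    hsSeminormSq s Ω (fun x => u (L • x)) =
      ENNReal.ofReal (L ^ (2 * s - d)) * hsSeminormSq s (L • Ω) u := by
  have hfl := floor_add_fract_eq hs
  unfold hsSeminormSq
  split_ifs with h0
  · rw [Finset.mul_sum]
    apply Finset.sum_congr rfl
    intro α hα
    have hα' : ∑ i, α i = ⌊s⌋₊ := (Finset.mem_piAntidiag.1 hα).1
    rw [lintegral_weakDeriv_comp_dilate hL hΩ (h α hα'.le), hα']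
    rw [h0, add_zero] at hfl
    rw [hfl]
    ring
  · rw [mul_left_comm (ENNReal.ofReal (L ^ (2 * s - (d : ℝ))))]
    congr 1
    rw [Finset.mul_sum]
    apply Finset.sum_congr rfl
    intro α hα
    have hα' : ∑ i, α i = ⌊s⌋₊ := (Finset.mem_piAntidiag.1 hα).1
    rw [gagliardo_weakDeriv_comp_dilate hL hΩ _ (h α hα'.le), hα', hfl]
    ring

theorem MemHs.comp_dilate (hL : 0 < L) {Ω : Set (E d)} (hΩ : IsOpen Ω) {s : ℝ} (hs : 0 < s)
    {u : E d → ℂ} (h : MemHs s (L • Ω) u) : MemHs s Ω (fun x => u (L • x)) := by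
  refine ⟨fun α hα => ?_, ?_⟩
  · obtain ⟨v, hv⟩ := h.1 α hα
    exact ⟨_, hv.comp_dilate hL hΩ⟩
  · have hfin := h.2
    unfold hsNormSq at hfin ⊢
    rw [ENNReal.add_lt_top] at hfin ⊢
    refine ⟨?_, ?_⟩
    · rw [hsSeminormSq_comp_dilate hL hΩ hs h.1]
      exact ENNReal.mul_lt_top ENNReal.ofReal_lt_top hfin.1
    · simp only [ENNReal.sum_lt_top] at hfin ⊢
      intro j hj α hα
      have hα' : ∑ i, α i = j := (Finset.mem_piAntidiag.1 hα).1
      rw [lintegral_weakDeriv_comp_dilate hL hΩ (h.1 α (by rw [Finset.mem_range] at hj; omega))]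
      exact ENNReal.mul_lt_top ENNReal.ofReal_lt_top (hfin.2 j hj α hα)

theorem localEnergy_comp_dilate_le (hL : 0 < L) {Ω : Set (E d)} (hΩ : IsOpen Ω) {s : ℝ} (hs : 0 < s)
    (u : E d → ℂ) : localEnergy s Ω (fun x => u (L • x)) ≤
      ENNReal.ofReal (L ^ (2 * s - d)) * localEnergy s (L • Ω) u := by
  unfold localEnergy
  by_cases h : MemHs s (L • Ω) u
  · rw [if_pos h, if_pos (h.comp_dilate hL hΩ hs), hsSeminormSq_comp_dilate hL hΩ hs h.1]
  · rw [if_neg h, ENNReal.mul_top (by simpa using Real.rpow_pos_of_pos hL _)]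
    exact le_top

theorem OneBodyBound.dilate (hd : 1 ≤ d) (hL : 0 < L) {s δ C : ℝ} (hs : 0 < s) (hC : 0 ≤ C)
    {Ω Ω' : Set (E d)} (hΩ' : IsOpen Ω') (h : OneBodyBound s δ Ω Ω' C) :
    OneBodyBound s δ (L • Ω) (L • Ω') (L ^ (-(2 * s)) * C) := by
  intro u hu
  have hd' : (0 : ℝ) < d := by exact_mod_cast hd
  have hw := h (fun x => u (L • x)) (memLp_comp_dilate hL hu)
  set q := 2 * s / (d : ℝ) with hq
  have hqpos : 0 < q := by positivity
  rw [setLIntegral_comp_dilate hL (fun x => (‖u x‖ₑ ^ 2) ^ (1 + q)),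
    setLIntegral_comp_dilate hL (fun x => ‖u x‖ₑ ^ 2)] at hw
  have hw2 := hw.trans (add_le_add_left (localEnergy_comp_dilate_le hL hΩ' hs u) _)
  set A := ∫⁻ x in L • Ω, (‖u x‖ₑ ^ 2) ^ (1 + q)
  set B := ∫⁻ x in L • Ω', ‖u x‖ₑ ^ 2
  set c : ℝ≥0∞ := ENNReal.ofReal (L ^ (2 * s - d)) with hc
  have hc0 : c ≠ 0 := by simpa [hc] using Real.rpow_pos_of_pos hL _
  have hct : c ≠ ⊤ := ENNReal.ofReal_ne_top
  have e1 : ENNReal.ofReal (L ^ (-(d : ℝ))) * A / (ENNReal.ofReal (L ^ (-(d : ℝ))) * B) ^ q =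
      c * (A / B ^ q) := by
    have hp : 0 < L ^ (-(d : ℝ) * q) := by positivity
    rw [ENNReal.mul_rpow_of_nonneg _ _ hqpos.le, ENNReal.ofReal_rpow_of_pos (by positivity),
      ← Real.rpow_mul hL.le,
      show L ^ (-(d : ℝ)) = L ^ (-(d : ℝ) * q) * L ^ (2 * s - d) by
        rw [← Real.rpow_add hL]; congr 1; rw [hq]; field_simp; ring,
      ENNReal.ofReal_mul hp.le, mul_assoc,
      ENNReal.mul_div_mul_left _ _ (by simpa using hp) ENNReal.ofReal_ne_top, mul_div_assoc]
  have e2 : ENNReal.ofReal C * (ENNReal.ofReal (L ^ (-(d : ℝ))) * B) =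
      c * (ENNReal.ofReal (L ^ (-(2 * s)) * C) * B) := by
    rw [← mul_assoc, ← mul_assoc, hc, ← ENNReal.ofReal_mul hC,
      ← ENNReal.ofReal_mul (by positivity), ← mul_assoc (L ^ _), ← Real.rpow_add hL]
    congr 2
    rw [mul_comm]
    congr 2
    ring
  rw [e1, e2, mul_left_comm, ← mul_add] at hw2
  exact (ENNReal.mul_le_mul_iff_right hc0 hct).1 hw2

/-- The set of valid constants is closed, so that it contains its infimum. -/
theorem OneBodyBound.sInf {s δ : ℝ} {Ω Ω' : Set (E d)}
    (hne : {C : ℝ | 0 ≤ C ∧ OneBodyBound s δ Ω Ω' C}.Nonempty) :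
    OneBodyBound s δ Ω Ω' (sInf {C : ℝ | 0 ≤ C ∧ OneBodyBound s δ Ω Ω' C}) := by
  intro u hu
  have hB : ∫⁻ x in Ω', ‖u x‖ₑ ^ 2 ≠ ⊤ := by
    have := hu.2
    rw [eLpNorm_lt_top_iff_lintegral_rpow_enorm_lt_top (by norm_num) (by norm_num)] at this
    simpa using this.ne
  set S := {C : ℝ | 0 ≤ C ∧ OneBodyBound s δ Ω Ω' C}
  obtain ⟨v, -, hv, hvS⟩ := exists_seq_tendsto_sInf hne ⟨0, fun C hC => hC.1⟩
  refine ge_of_tendsto' (x := Filter.atTop) (f := fun n => localEnergy s Ω' u +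
    ENNReal.ofReal (v n) * ∫⁻ x in Ω', ‖u x‖ₑ ^ 2) ?_ fun n => (hvS n).2 u hu
  exact tendsto_const_nhds.add
    (ENNReal.Tendsto.mul_const (ENNReal.tendsto_ofReal hv) (Or.inr hB))

theorem OneBodyBound.mono {s δ C C' : ℝ} {Ω Ω' : Set (E d)} (hC : C ≤ C')
    (h : OneBodyBound s δ Ω Ω' C) : OneBodyBound s δ Ω Ω' C' := fun u hu =>
  (h u hu).trans (by gcongr)

/-- The optimal constant in the one-particle bound, plus `dist(Ω, ℝ^d \ Ω')^{-2s}`. The second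
term makes the constant positive for `Ω' ≠ ℝ^d`; it vanishes for `Ω' = ℝ^d`, where the infimum is
taken over the empty set and both `sInf ∅` and `0 ^ (-2s)` are zero. -/
def localConst (s δ : ℝ) (Ω Ω' : Set (E d)) : ℝ :=
  sInf {C : ℝ | 0 ≤ C ∧ OneBodyBound s δ Ω Ω' C} +
    sInf {r : ℝ | ∃ x ∈ Ω, ∃ y ∉ Ω', r = dist x y} ^ (-(2 * s))

theorem sInf_bounds_nonneg {s δ : ℝ} {Ω Ω' : Set (E d)} :
    0 ≤ sInf {C : ℝ | 0 ≤ C ∧ OneBodyBound s δ Ω Ω' C} :=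
  Real.sInf_nonneg fun _ hC => hC.1

theorem sInf_dist_nonneg {Ω Ω' : Set (E d)} :
    0 ≤ sInf {r : ℝ | ∃ x ∈ Ω, ∃ y ∉ Ω', r = dist x y} := by
  refine Real.sInf_nonneg ?_
  rintro _ ⟨x, -, y, -, rfl⟩
  exact dist_nonneg

theorem localConst_nonneg (s δ : ℝ) (Ω Ω' : Set (E d)) : 0 ≤ localConst s δ Ω Ω' :=
  add_nonneg sInf_bounds_nonneg (Real.rpow_nonneg sInf_dist_nonneg _)

theorem localConst_pos {s δ : ℝ} {Ω Ω' : Set (E d)} (hne : Ω.Nonempty) (hw : WellInside Ω Ω')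
    (h : Ω' ≠ univ) : 0 < localConst s δ Ω Ω' := by
  refine add_pos_of_nonneg_of_pos sInf_bounds_nonneg (Real.rpow_pos_of_pos ?_ _)
  obtain ⟨r, hr, hdist⟩ := hw.2
  obtain ⟨x, hx⟩ := hne
  obtain ⟨y, hy⟩ := (ne_univ_iff_exists_notMem Ω').1 h
  refine hr.trans_le (le_csInf ⟨_, x, hx, y, hy, rfl⟩ ?_)
  rintro _ ⟨x, hx, y, hy, rfl⟩
  exact hdist x hx y hy

theorem OneBodyBound.localConst {s δ : ℝ} {Ω Ω' : Set (E d)}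
    (hne : {C : ℝ | 0 ≤ C ∧ OneBodyBound s δ Ω Ω' C}.Nonempty) :
    OneBodyBound s δ Ω Ω' (localConst s δ Ω Ω') :=
  (OneBodyBound.sInf hne).mono
    (le_add_of_nonneg_right (Real.rpow_nonneg sInf_dist_nonneg _))

theorem localConst_dilate (hd : 1 ≤ d) (hL : 0 < L) {s : ℝ} (hs : 0 < s) (δ : ℝ) {Ω Ω' : Set (E d)}
    (hΩ' : IsOpen Ω') : localConst s δ Ω Ω' = localConst s δ (L • Ω) (L • Ω') * L ^ (2 * s) := by
  have hLs : 0 < L ^ (2 * s) := by positivity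
  have h1 : {C : ℝ | 0 ≤ C ∧ OneBodyBound s δ Ω Ω' C} =
      L ^ (2 * s) • {C : ℝ | 0 ≤ C ∧ OneBodyBound s δ (L • Ω) (L • Ω') C} := by
    ext C
    rw [mem_smul_set_iff_inv_smul_mem₀ hLs.ne', smul_eq_mul, ← Real.rpow_neg hL.le]
    constructor
    · rintro ⟨hC, h⟩
      exact ⟨by positivity, h.dilate hd hL hs hC hΩ'⟩
    · rintro ⟨hC, h⟩
      have hC' : 0 ≤ C := by
        by_contra! hneg
        exact absurd hC (not_le.2 (mul_neg_of_pos_of_neg (by positivity) hneg))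
      refine ⟨hC', ?_⟩
      have := h.dilate hd (inv_pos.2 hL) hs hC (isOpen_dilate hL hΩ')
      rwa [inv_smul_smul₀ hL.ne', inv_smul_smul₀ hL.ne', Real.inv_rpow hL.le,
        ← Real.rpow_neg hL.le, ← mul_assoc, ← Real.rpow_add hL, neg_neg, add_neg_cancel,
        Real.rpow_zero, one_mul] at this
  have h2 : {r : ℝ | ∃ x ∈ L • Ω, ∃ y ∉ L • Ω', r = dist x y} =
      L • {r : ℝ | ∃ x ∈ Ω, ∃ y ∉ Ω', r = dist x y} := by
    ext r
    rw [mem_smul_set]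
    constructor
    · rintro ⟨x, hx, y, hy, rfl⟩
      rw [mem_smul_set_iff_inv_smul_mem₀ hL.ne'] at hx hy
      refine ⟨_, ⟨_, hx, _, hy, rfl⟩, ?_⟩
      rw [dist_smul₀, smul_eq_mul, norm_inv, Real.norm_of_nonneg hL.le, mul_inv_cancel_left₀ hL.ne']
    · rintro ⟨_, ⟨x, hx, y, hy, rfl⟩, rfl⟩
      refine ⟨L • x, smul_mem_smul_set hx, L • y, ?_, ?_⟩
      · rwa [smul_mem_smul_set_iff₀ hL.ne']
      · rw [dist_smul₀, smul_eq_mul, Real.norm_of_nonneg hL.le]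
  unfold localConst
  rw [h1, h2, Real.sInf_smul_of_nonneg hLs.le, Real.sInf_smul_of_nonneg hL.le, smul_eq_mul,
    smul_eq_mul, Real.mul_rpow hL.le sInf_dist_nonneg, add_mul, mul_comm (L ^ (2 * s)),
    mul_right_comm, ← Real.rpow_add hL, neg_add_cancel, Real.rpow_zero, one_mul]

end LocalUncertainty
end

noncomputable section

namespace LocalUncertainty

/-! ### The Fourier transform on `L²` -/

open scoped SchwartzMap LineDeriv

variable {d : ℕ}

/-- The one-particle Hilbert space `L²(ℝ^d)`. -/
abbrev L2 (d : ℕ) : Type := Lp ℂ 2 (volume : Measure (E d))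

/-- The self-adjointness of the Fourier transform, for a Schwartz function and an `L²` function. -/
theorem integral_fourier_mul (φ : 𝓢(E d, ℂ)) (f : L2 d) :
    ∫ x, (𝓕 φ) x * f x = ∫ x, φ x * (𝓕 f : L2 d) x := by
  have h := congrArg (fun T : 𝓢'(E d, ℂ) => T φ) (Lp.fourier_toTemperedDistribution_eq f)
  simpa [TemperedDistribution.fourier_apply, Lp.toTemperedDistribution_apply] using h

theorem integrable_schwartz_mul (φ : 𝓢(E d, ℂ)) (f : L2 d) :
    Integrable fun x => φ x * f x :=
  (φ.memLp 2 volume).integrable_mul (Lp.memLp f)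

theorem locallyIntegrable_L2 (f : L2 d) : LocallyIntegrable f volume :=
  (Lp.memLp f).locallyIntegrable (by norm_num)

theorem locallyIntegrableOn_L2 (f : L2 d) (Ω : Set (E d)) : LocallyIntegrableOn f Ω :=
  (locallyIntegrable_L2 f).locallyIntegrableOn Ω

theorem lintegral_enorm_sq_L2 (f : L2 d) : ∫⁻ x, ‖f x‖ₑ ^ 2 = ‖f‖ₑ ^ 2 := by
  rw [Lp.enorm_def, eLpNorm_eq_lintegral_rpow_enorm_toReal (by norm_num) (by norm_num),
    ← ENNReal.rpow_natCast, ← ENNReal.rpow_mul]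
  simp

/-- Plancherel's theorem. -/
theorem lintegral_enorm_sq_fourier (f : L2 d) :
    ∫⁻ ξ, ‖(𝓕 f : L2 d) ξ‖ₑ ^ 2 = ∫⁻ x, ‖f x‖ₑ ^ 2 := by
  rw [lintegral_enorm_sq_L2, lintegral_enorm_sq_L2, ← ofReal_norm, ← ofReal_norm,
    Lp.norm_fourier_eq]

theorem contDiff_ofReal_comp {g : E d → ℝ} (hg : ContDiff ℝ ∞ g) :
    ContDiff ℝ ∞ fun x => (g x : ℂ) :=
  Complex.ofRealCLM.contDiff.comp hg

theorem hasCompactSupport_ofReal_comp {g : E d → ℝ} (hg : HasCompactSupport g) :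
    HasCompactSupport fun x => (g x : ℂ) :=
  hg.comp_left (g := fun t : ℝ => (t : ℂ)) Complex.ofReal_zero

/-- The phase `e^{2πi h·ξ}` by which a translation by `h` acts on the Fourier side. -/
def phase (h ξ : E d) : ℂ := Complex.exp (2 * Real.pi * (inner ℝ h ξ : ℝ) * Complex.I)

theorem contDiff_phase (h : E d) : ContDiff ℝ ∞ (phase h) := by
  unfold phase
  refine Complex.contDiff_exp.comp (ContDiff.mul (contDiff_const.mul ?_) contDiff_const)
  exact Complex.ofRealCLM.contDiff.comp (innerSL ℝ h).contDiff

theorem norm_phase (h ξ : E d) : ‖phase h ξ‖ = 1 := by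
  unfold phase
  rw [show (2 : ℂ) * Real.pi * (inner ℝ h ξ : ℝ) * Complex.I =
    ((2 * Real.pi * inner ℝ h ξ : ℝ) : ℂ) * Complex.I by push_cast; ring]
  exact Complex.norm_exp_ofReal_mul_I _

theorem fourier_phase_mul (h : E d) (φ : E d → ℂ) (x : E d) :
    𝓕 (fun ξ => phase h ξ * φ ξ) x = 𝓕 φ (x - h) := by
  rw [Real.fourier_eq', Real.fourier_eq']
  refine integral_congr_ae (.of_forall fun ξ => ?_)
  simp only [phase, smul_eq_mul]
  rw [← mul_assoc, ← Complex.exp_add, inner_sub_right, real_inner_comm ξ h]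
  congr 2
  push_cast
  ring

/-- Translations act by phases on the Fourier side. -/
theorem fourier_translate (h : E d) {f fh : L2 d} (hf : fh =ᵐ[volume] fun x => f (x + h)) :
    (𝓕 fh : L2 d) =ᵐ[volume] fun ξ => phase h ξ * (𝓕 f : L2 d) ξ := by
  have hloc : LocallyIntegrable (fun ξ => phase h ξ * (𝓕 f : L2 d) ξ) volume := by
    refine (locallyIntegrable_L2 (𝓕 f : L2 d)).mono
      ((contDiff_phase h).continuous.aestronglyMeasurable.mul (Lp.aestronglyMeasurable _))
      (.of_forall fun ξ => ?_)
    rw [norm_mul, norm_phase, one_mul]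
  refine ae_eq_of_integral_contDiff_smul_eq (locallyIntegrable_L2 _) hloc fun g hg hgc => ?_
  set φ : 𝓢(E d, ℂ) :=
    (hasCompactSupport_ofReal_comp hgc).toSchwartzMap (contDiff_ofReal_comp hg) with hφ
  set ψ : 𝓢(E d, ℂ) := ((hasCompactSupport_ofReal_comp hgc).mul_left
    (f := phase h)).toSchwartzMap ((contDiff_phase h).mul (contDiff_ofReal_comp hg)) with hψ
  have hφc : ∀ x, φ x = g x := fun x => rfl
  have hψc : ∀ x, ψ x = phase h x * g x := fun x => rfl
  have e1 : ∫ x, g x • (𝓕 fh : L2 d) x = ∫ x, (𝓕 φ) x * fh x := by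
    rw [integral_fourier_mul]
    simp [hφc]
  have e2 : ∫ x, g x • (phase h x * (𝓕 f : L2 d) x) = ∫ x, (𝓕 ψ) x * f x := by
    rw [integral_fourier_mul]
    refine integral_congr_ae (.of_forall fun x => ?_)
    simp only [hψc, Complex.real_smul]
    ring
  have e3 : ∀ x, (𝓕 ψ) (x + h) = (𝓕 φ) x := by
    intro x
    rw [SchwartzMap.fourier_coe, SchwartzMap.fourier_coe]
    have := fourier_phase_mul h φ (x + h)
    rw [add_sub_cancel_right] at this
    rw [← this]
    rfl
  rw [e1, e2, ← integral_add_right_eq_self (fun x => (𝓕 ψ : 𝓢(E d, ℂ)) x * f x) h]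
  refine integral_congr_ae ?_
  filter_upwards [hf] with x hx
  rw [hx, e3]

theorem inner_single_right (ξ : E d) (k : Fin d) :
    inner ℝ ξ (EuclideanSpace.single k (1 : ℝ)) = ξ k := by
  simp [EuclideanSpace.inner_single_right]

theorem lineDeriv_fourier_apply (ψ : 𝓢(E d, ℂ)) (k : Fin d) :
    ∂_{EuclideanSpace.single k (1 : ℝ)} (𝓕 ψ) =
      𝓕 (-(2 * Real.pi * Complex.I) •
        SchwartzMap.smulLeftCLM ℂ (inner ℝ · (EuclideanSpace.single k (1 : ℝ))) ψ) :=
  SchwartzMap.lineDerivOp_fourier_eq ψ _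

theorem smul_smulLeftCLM_apply (ψ : 𝓢(E d, ℂ)) (k : Fin d) (ξ : E d) :
    (-(2 * Real.pi * Complex.I) •
        SchwartzMap.smulLeftCLM ℂ (inner ℝ · (EuclideanSpace.single k (1 : ℝ))) ψ) ξ =
      -(ψ ξ * (2 * Real.pi * Complex.I * ξ k)) := by
  have : (inner ℝ · (EuclideanSpace.single k (1 : ℝ)) : E d → ℝ).HasTemperateGrowth := by fun_prop
  rw [smul_apply, SchwartzMap.smulLeftCLM_apply_apply this, inner_single_right,
    smul_eq_mul, Complex.real_smul]
  ring

/-- If `𝓕 g = 2πi ξ_k 𝓕 f`, then `g` is the distributional derivative of `f`. -/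
theorem integral_lineDeriv_of_fourier {f g : L2 d} {k : Fin d}
    (h : (𝓕 g : L2 d) =ᵐ[volume] fun ξ => 2 * Real.pi * Complex.I * ξ k * (𝓕 f : L2 d) ξ)
    (φ : 𝓢(E d, ℂ)) :
    ∫ x, (∂_{EuclideanSpace.single k (1 : ℝ)} φ) x * f x = -∫ x, φ x * g x := by
  obtain ⟨ψ, rfl⟩ : ∃ ψ, 𝓕 ψ = φ := ⟨𝓕⁻ φ, FourierTransform.fourier_fourierInv_eq φ⟩
  rw [lineDeriv_fourier_apply, integral_fourier_mul, integral_fourier_mul, ← integral_neg]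
  refine integral_congr_ae ?_
  filter_upwards [h] with ξ hξ
  rw [smul_smulLeftCLM_apply, hξ]
  ring

theorem hasWeakDeriv_of_fourier {f g : L2 d} {k : Fin d}
    (h : (𝓕 g : L2 d) =ᵐ[volume] fun ξ => 2 * Real.pi * Complex.I * ξ k * (𝓕 f : L2 d) ξ) :
    HasWeakDeriv univ (Pi.single k 1) f g where
  locallyIntegrable := locallyIntegrableOn_L2 f _
  locallyIntegrable_deriv := locallyIntegrableOn_L2 g _
  integral_eq φ h1 h2 _ := by
    have hφ := integral_lineDeriv_of_fourier h
      ((hasCompactSupport_ofReal_comp h2).toSchwartzMap (contDiff_ofReal_comp h1))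
    have e : ∀ x, (∂_{EuclideanSpace.single k (1 : ℝ)} ((hasCompactSupport_ofReal_comp
        h2).toSchwartzMap (contDiff_ofReal_comp h1) : 𝓢(E d, ℂ))) x =
        (partialDeriv k φ x : ℂ) := by
      intro x
      rw [SchwartzMap.lineDerivOp_apply_eq_fderiv]
      have hd : HasFDerivAt φ (fderiv ℝ φ x) x := (h1.differentiable (by simp) x).hasFDerivAt
      have := (Complex.ofRealCLM.hasFDerivAt.comp x hd).fderiv
      change fderiv ℝ (Complex.ofRealCLM ∘ φ) x _ = _
      rw [this]
      rfl
    rw [multiDeriv_single k h1]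
    simp only [e] at hφ
    simpa using hφ

/-- A cut-off argument: the distributional identity `g = ∂_k f`, known for real test functions,
holds for complex Schwartz functions as well. -/
theorem integral_lineDeriv_schwartz {f g : L2 d} {k : Fin d}
    (h : ∀ φ : E d → ℝ, ContDiff ℝ ∞ φ → HasCompactSupport φ →
      ∫ x, partialDeriv k φ x • f x = -∫ x, φ x • g x) (φ : 𝓢(E d, ℂ)) :
    ∫ x, fderiv ℝ φ x (EuclideanSpace.single k (1 : ℝ)) * f x = -∫ x, φ x * g x := by
  set e : E d := EuclideanSpace.single k (1 : ℝ) with he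
  -- complex test functions
  have hc : ∀ φ : E d → ℂ, ContDiff ℝ ∞ φ → HasCompactSupport φ →
      ∫ x, fderiv ℝ φ x e * f x = -∫ x, φ x * g x := by
    intro φ h1 h2
    have hre : ContDiff ℝ ∞ fun x => (φ x).re := Complex.reCLM.contDiff.comp h1
    have him : ContDiff ℝ ∞ fun x => (φ x).im := Complex.imCLM.contDiff.comp h1
    have hrec : HasCompactSupport fun x => (φ x).re := h2.comp_left (g := Complex.re) rfl
    have himc : HasCompactSupport fun x => (φ x).im := h2.comp_left (g := Complex.im) rfl
    have i : ∀ (u : L2 d) (ψ : E d → ℝ), ContDiff ℝ ∞ ψ → HasCompactSupport ψ →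
        Integrable fun x => ψ x • u x := by
      intro u ψ p1 p2
      have := integrableOn_smul_of_tsupport_subset (locallyIntegrableOn_L2 u univ)
        p1.continuous p2 (subset_univ _)
      rwa [integrableOn_univ] at this
    have hcp : ∀ ψ : E d → ℝ, HasCompactSupport ψ → HasCompactSupport (partialDeriv k ψ) :=
      fun ψ p => p.of_isClosed_subset (isClosed_tsupport _) (tsupport_partialDeriv_subset k ψ)
    have hd : ∀ x, HasFDerivAt φ (fderiv ℝ φ x) x := fun x =>
      (h1.differentiable (by simp) x).hasFDerivAt
    have d1 : ∀ x, partialDeriv k (fun x => (φ x).re) x = (fderiv ℝ φ x e).re := by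
      intro x
      have := (Complex.reCLM.hasFDerivAt.comp x (hd x)).fderiv
      change fderiv ℝ (Complex.reCLM ∘ φ) x _ = _
      rw [this]
      rfl
    have d2 : ∀ x, partialDeriv k (fun x => (φ x).im) x = (fderiv ℝ φ x e).im := by
      intro x
      have := (Complex.imCLM.hasFDerivAt.comp x (hd x)).fderiv
      change fderiv ℝ (Complex.imCLM ∘ φ) x _ = _
      rw [this]
      rfl
    have e1 : ∀ x, fderiv ℝ φ x e * f x = partialDeriv k (fun x => (φ x).re) x • f x +
        Complex.I * (partialDeriv k (fun x => (φ x).im) x • f x) := by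
      intro x
      rw [d1, d2, Complex.real_smul, Complex.real_smul]
      nth_rewrite 1 [← Complex.re_add_im (fderiv ℝ φ x e)]
      ring
    have e2 : ∀ x, φ x * g x = (φ x).re • g x + Complex.I * ((φ x).im • g x) := by
      intro x
      rw [Complex.real_smul, Complex.real_smul]
      nth_rewrite 1 [← Complex.re_add_im (φ x)]
      ring
    simp only [e1, e2]
    rw [integral_add (i f _ (contDiff_partialDeriv k hre) (hcp _ hrec))
      ((i f _ (contDiff_partialDeriv k him) (hcp _ himc)).const_mul _),
      integral_add (i g _ hre hrec) ((i g _ him himc).const_mul _), integral_const_mul,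
      integral_const_mul, h _ hre hrec, h _ him himc]
    ring
  -- dominated convergence along a sequence of cut-offs
  let χ : ContDiffBump (0 : E d) := ⟨1, 2, one_pos, one_lt_two⟩
  have hχ : ContDiff ℝ ∞ (χ : E d → ℝ) := χ.contDiff
  obtain ⟨M, hM⟩ : ∃ M, ∀ x, ‖fderiv ℝ χ x‖ ≤ M := by
    have h1 : HasCompactSupport (fderiv ℝ (χ : E d → ℝ)) := χ.hasCompactSupport.fderiv ℝ
    exact h1.exists_bound_of_continuous (hχ.continuous_fderiv (by simp))
  have hM0 : 0 ≤ M := (norm_nonneg _).trans (hM 0)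
  let c : ℕ → ℝ := fun n => ((n : ℝ) + 1)⁻¹
  have hcpos : ∀ n, 0 < c n := fun n => by positivity
  have hc1 : ∀ n, c n ≤ 1 := fun n => inv_le_one_of_one_le₀ (by simp)
  have hclim : Filter.Tendsto c Filter.atTop (nhds 0) := by
    simpa [c, one_div] using tendsto_one_div_add_atTop_nhds_zero_nat (𝕜 := ℝ)
  let φn : ℕ → E d → ℂ := fun n x => (χ (c n • x) : ℂ) * φ x
  have hφd : ∀ x, HasFDerivAt φ (fderiv ℝ φ x) x := fun x => φ.differentiableAt.hasFDerivAt
  have hcut : ∀ n x, HasFDerivAt (fun x => (χ (c n • x) : ℂ))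
      (Complex.ofRealCLM.comp ((fderiv ℝ χ (c n • x)).comp (c n • ContinuousLinearMap.id ℝ (E d))))
      x := by
    intro n x
    have h1 : HasFDerivAt (fun x : E d => c n • x) (c n • ContinuousLinearMap.id ℝ (E d)) x :=
      (hasFDerivAt_id x).const_smul (c n)
    have h2 := ((hχ.differentiable (by simp) (c n • x)).hasFDerivAt).comp x h1
    exact Complex.ofRealCLM.hasFDerivAt.comp x h2
  have hder : ∀ n x, fderiv ℝ (φn n) x e = (χ (c n • x) : ℂ) * fderiv ℝ φ x e +
      φ x * ((c n * fderiv ℝ χ (c n • x) e : ℝ) : ℂ) := by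
    intro n x
    have hm : HasFDerivAt (φn n) _ x := (hcut n x).mul (hφd x)
    rw [hm.fderiv]
    simp
  have hsm : ∀ n, ContDiff ℝ ∞ (φn n) := fun n =>
    (contDiff_ofReal_comp (contDiff_comp_dilate _ hχ)).mul (φ.smooth ⊤)
  have hcs : ∀ n, HasCompactSupport (φn n) := fun n =>
    (hasCompactSupport_ofReal_comp (χ.hasCompactSupport.comp_smul (hcpos n).ne')).mul_right
  have hχlim : ∀ x : E d, Filter.Tendsto (fun n => (χ (c n • x) : ℂ)) Filter.atTop (nhds 1) := by
    intro x
    have h1 : Filter.Tendsto (fun n => c n • x) Filter.atTop (nhds 0) := by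
      simpa using hclim.smul_const x
    have h2 := (hχ.continuous.tendsto 0).comp h1
    have h3 : χ (0 : E d) = 1 := χ.one_of_mem_closedBall (by simp [χ])
    rw [h3] at h2
    exact (Complex.continuous_ofReal.tendsto 1).comp h2
  have hχle : ∀ x, ‖(χ x : ℂ)‖ ≤ 1 := by
    intro x
    rw [Complex.norm_real, Real.norm_of_nonneg χ.nonneg]
    exact χ.le_one
  have lim1 : Filter.Tendsto (fun n => ∫ x, fderiv ℝ (φn n) x e * f x) Filter.atTop
      (nhds (∫ x, fderiv ℝ φ x e * f x)) := by
    have i1 : Integrable fun x => (∂_{e} φ) x * f x := integrable_schwartz_mul _ f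
    have i2 : Integrable fun x => φ x * f x := integrable_schwartz_mul _ f
    refine tendsto_integral_of_dominated_convergence
      (fun x => ‖fderiv ℝ φ x e * f x‖ + M * ‖e‖ * ‖φ x * f x‖) (fun n => ?_)
      (i1.norm.add (i2.norm.const_mul _)) (fun n => .of_forall fun x => ?_)
      (.of_forall fun x => ?_)
    · refine AEStronglyMeasurable.mul (Continuous.aestronglyMeasurable ?_)
        (Lp.aestronglyMeasurable f)
      exact ((hsm n).continuous_fderiv (by simp)).clm_apply continuous_const
    · rw [hder, add_mul]
      refine (norm_add_le _ _).trans (add_le_add ?_ ?_)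
      · rw [mul_assoc, norm_mul]
        exact mul_le_of_le_one_left (norm_nonneg _) (hχle _)
      · rw [mul_right_comm, norm_mul, mul_comm (M * ‖e‖)]
        refine mul_le_mul_of_nonneg_left ?_ (norm_nonneg _)
        rw [Complex.norm_real, norm_mul, Real.norm_of_nonneg (hcpos n).le]
        calc c n * ‖fderiv ℝ χ (c n • x) e‖ ≤ 1 * (M * ‖e‖) := by
              refine mul_le_mul (hc1 n) ?_ (norm_nonneg _) zero_le_one
              exact ((fderiv ℝ χ (c n • x)).le_opNorm e).trans
                (mul_le_mul_of_nonneg_right (hM _) (norm_nonneg _))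
          _ = M * ‖e‖ := one_mul _
    · refine Filter.Tendsto.mul_const _ ?_
      simp only [hder]
      have l2 : Filter.Tendsto (fun n => ((c n * fderiv ℝ χ (c n • x) e : ℝ) : ℂ)) Filter.atTop
          (nhds ((0 : ℝ) : ℂ)) := by
        refine (Complex.continuous_ofReal.tendsto 0).comp ?_
        have h1 : Filter.Tendsto (fun n => c n • x) Filter.atTop (nhds 0) := by
          simpa using hclim.smul_const x
        have h2 := (((hχ.continuous_fderiv (by simp)).clm_apply
          (continuous_const (y := e))).tendsto 0).comp h1
        simpa using hclim.mul h2
      simpa using ((hχlim x).mul_const (fderiv ℝ φ x e)).add (l2.const_mul (φ x))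
  have lim2 : Filter.Tendsto (fun n => ∫ x, φn n x * g x) Filter.atTop
      (nhds (∫ x, φ x * g x)) := by
    refine tendsto_integral_of_dominated_convergence (fun x => ‖φ x * g x‖) (fun n => ?_)
      (integrable_schwartz_mul φ g).norm (fun n => .of_forall fun x => ?_)
      (.of_forall fun x => ?_)
    · exact (hsm n).continuous.aestronglyMeasurable.mul (Lp.aestronglyMeasurable g)
    · rw [mul_assoc, norm_mul]
      exact mul_le_of_le_one_left (norm_nonneg _) (hχle _)
    · refine Filter.Tendsto.mul_const _ ?_
      simpa using (hχlim x).mul_const (φ x)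
  refine tendsto_nhds_unique lim1 ?_
  simp only [fun n => hc (φn n) (hsm n) (hcs n)]
  exact lim2.neg

/-- Conversely to `hasWeakDeriv_of_fourier`: weak derivatives are multiplications by `2πi ξ_k` on
the Fourier side. -/
theorem fourier_of_weak {f g : L2 d} {k : Fin d}
    (h : ∀ φ : E d → ℝ, ContDiff ℝ ∞ φ → HasCompactSupport φ →
      ∫ x, partialDeriv k φ x • f x = -∫ x, φ x • g x) :
    (𝓕 g : L2 d) =ᵐ[volume] fun ξ => 2 * Real.pi * Complex.I * ξ k * (𝓕 f : L2 d) ξ := by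
  have hcont : Continuous fun ξ : E d => (2 * Real.pi * Complex.I * ξ k : ℂ) := by fun_prop
  have hloc : LocallyIntegrable
      (fun ξ => 2 * Real.pi * Complex.I * ξ k * (𝓕 f : L2 d) ξ) volume := by
    have := LocallyIntegrableOn.continuousOn_mul
      ((locallyIntegrable_L2 (𝓕 f : L2 d)).locallyIntegrableOn univ) hcont.continuousOn
      isOpen_univ.isLocallyClosed
    rwa [locallyIntegrableOn_univ] at this
  refine ae_eq_of_integral_contDiff_smul_eq (locallyIntegrable_L2 _) hloc fun ψ h1 h2 => ?_
  set Ψ : 𝓢(E d, ℂ) :=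
    (hasCompactSupport_ofReal_comp h2).toSchwartzMap (contDiff_ofReal_comp h1) with hΨ
  have hΨc : ∀ x, Ψ x = ψ x := fun x => rfl
  have e1 : ∫ x, ψ x • (𝓕 g : L2 d) x = ∫ x, (𝓕 Ψ) x * g x := by
    rw [integral_fourier_mul]
    simp [hΨc]
  have e2 := integral_lineDeriv_schwartz h (𝓕 Ψ)
  have e3 : ∫ x, fderiv ℝ (𝓕 Ψ : 𝓢(E d, ℂ)) x (EuclideanSpace.single k (1 : ℝ)) * f x =
      ∫ x, (∂_{EuclideanSpace.single k (1 : ℝ)} (𝓕 Ψ : 𝓢(E d, ℂ))) x * f x := rfl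
  rw [e3, lineDeriv_fourier_apply, integral_fourier_mul] at e2
  rw [e1, ← neg_eq_iff_eq_neg.2 e2, ← integral_neg]
  refine integral_congr_ae (.of_forall fun ξ => ?_)
  simp only [smul_smulLeftCLM_apply, hΨc, Complex.real_smul]
  ring

end LocalUncertainty
end

noncomputable section

namespace LocalUncertainty

/-! ### Lower-order derivatives on extension domains -/

variable {d : ℕ}

/-- The Fourier symbol `∏ᵢ (2πi ξᵢ)^{αᵢ}` of `D^α`. -/
def symb (α : Fin d → ℕ) (ξ : E d) : ℂ := ∏ i, (2 * Real.pi * Complex.I * ξ i) ^ α i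

theorem symb_zero (ξ : E d) : symb 0 ξ = 1 := by simp [symb]

theorem symb_add_single (α : Fin d → ℕ) (k : Fin d) (ξ : E d) :
    symb (α + Pi.single k 1) ξ = 2 * Real.pi * Complex.I * ξ k * symb α ξ := by
  simp only [symb, Pi.add_apply, pow_add, Finset.prod_mul_distrib]
  have : ∏ i, (2 * Real.pi * Complex.I * ξ i : ℂ) ^ (Pi.single k 1 : Fin d → ℕ) i =
      2 * Real.pi * Complex.I * ξ k := by
    rw [Finset.prod_eq_single k]
    · simp
    · intro i _ hi
      simp [hi]
    · simp
  rw [this, mul_comm]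

theorem continuous_symb (α : Fin d → ℕ) : Continuous (symb α) := by
  unfold symb
  fun_prop

theorem sum_multinomial_symb (m : ℕ) (ξ : E d) :
    ∑ α ∈ Finset.piAntidiag (Finset.univ : Finset (Fin d)) m,
      (Nat.multinomial Finset.univ α : ℝ≥0∞) * ‖symb α ξ‖ₑ ^ 2 =
        ENNReal.ofReal ((2 * Real.pi * ‖ξ‖) ^ (2 * (m : ℝ))) := by
  have hpos : 0 ≤ 2 * Real.pi * ‖ξ‖ := by positivity
  have h1 : (2 * Real.pi * ‖ξ‖) ^ (2 * (m : ℝ)) = (∑ i, (2 * Real.pi * ξ i) ^ 2) ^ m := by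
    rw [show (2 : ℝ) * (m : ℝ) = ((2 * m : ℕ) : ℝ) by push_cast; ring, Real.rpow_natCast, pow_mul]
    congr 1
    rw [mul_pow, EuclideanSpace.real_norm_sq_eq, Finset.mul_sum]
    simp only [mul_pow]
  have h2 : ∀ α : Fin d → ℕ, (Nat.multinomial Finset.univ α : ℝ≥0∞) * ‖symb α ξ‖ₑ ^ 2 =
      ENNReal.ofReal ((Nat.multinomial Finset.univ α : ℝ) *
        ∏ i, ((2 * Real.pi * ξ i) ^ 2) ^ α i) := by
    intro α
    rw [ENNReal.ofReal_mul (by positivity), ENNReal.ofReal_natCast, ← ofReal_norm,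
      ← ENNReal.ofReal_pow (norm_nonneg _)]
    congr 2
    rw [symb, norm_prod, ← Finset.prod_pow]
    refine Finset.prod_congr rfl fun i _ => ?_
    rw [norm_pow, ← pow_mul, mul_comm (α i), pow_mul]
    congr 1
    simp [mul_pow, abs_of_pos Real.pi_pos]
  rw [h1, Finset.sum_pow_eq_sum_piAntidiag, ENNReal.ofReal_sum_of_nonneg]
  · exact Finset.sum_congr rfl fun α _ => h2 α
  · intro α _
    positivity

theorem one_le_multinomial (α : Fin d → ℕ) :
    (1 : ℝ≥0∞) ≤ (Nat.multinomial Finset.univ α : ℝ≥0∞) := by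
  have : 1 ≤ Nat.multinomial Finset.univ α := Nat.multinomial_pos _ _
  exact_mod_cast this

theorem enorm_symb_sq_le (α : Fin d → ℕ) (ξ : E d) :
    ‖symb α ξ‖ₑ ^ 2 ≤ ENNReal.ofReal ((2 * Real.pi * ‖ξ‖) ^ (2 * ((∑ i, α i : ℕ) : ℝ))) := by
  rw [← sum_multinomial_symb]
  have hmem : α ∈ Finset.piAntidiag (Finset.univ : Finset (Fin d)) (∑ i, α i) := by simp
  refine le_trans ?_ (Finset.single_le_sum (fun _ _ => zero_le) hmem)
  exact le_mul_of_one_le_left zero_le (one_le_multinomial α)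

/-- The elementary inequality `r^{2t} ≤ η r^{2s} + C` behind the interpolation between `L²` and
`H^s`, uniformly in `t ≤ t₀ < s`. -/
theorem exists_rpow_le {s t₀ η : ℝ} (ht : t₀ < s) (hη : 0 < η) :
    ∃ C : ℝ≥0, ∀ t : ℝ, 0 ≤ t → t ≤ t₀ → ∀ r : ℝ, 0 ≤ r →
      ENNReal.ofReal (r ^ (2 * t)) ≤ ENNReal.ofReal η * ENNReal.ofReal (r ^ (2 * s)) + C := by
  obtain ⟨R, hR1, hR⟩ : ∃ R : ℝ, 1 ≤ R ∧ ∀ r, R ≤ r → r ^ (-(2 * (s - t₀))) ≤ η := by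
    have hlim := tendsto_rpow_neg_atTop (y := 2 * (s - t₀)) (by linarith)
    obtain ⟨R, hR⟩ := Filter.eventually_atTop.1 (hlim.eventually_le_const hη)
    exact ⟨max 1 R, le_max_left _ _, fun r hr => hR r ((le_max_right _ _).trans hr)⟩
  refine ⟨(R ^ (2 * t₀)).toNNReal, fun t ht0 htt r hr => ?_⟩
  rcases le_total r R with h | h
  · refine le_add_left ?_
    change ENNReal.ofReal (r ^ (2 * t)) ≤ ENNReal.ofReal (R ^ (2 * t₀))
    refine ENNReal.ofReal_le_ofReal ?_
    exact (Real.rpow_le_rpow hr h (by linarith)).trans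
      (Real.rpow_le_rpow_of_exponent_le hR1 (by linarith))
  · refine le_add_right ?_
    rw [← ENNReal.ofReal_mul hη.le]
    refine ENNReal.ofReal_le_ofReal ?_
    have hr1 : 1 ≤ r := hR1.trans h
    calc r ^ (2 * t) ≤ r ^ (2 * t₀) := Real.rpow_le_rpow_of_exponent_le hr1 (by linarith)
      _ = r ^ (-(2 * (s - t₀))) * r ^ (2 * s) := by
        rw [← Real.rpow_add (by linarith)]
        congr 1
        ring
      _ ≤ η * r ^ (2 * s) := by
        gcongr
        exact hR r h

theorem aemeasurable_fourier_sq (w : L2 d) :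
    AEMeasurable (fun ξ => ‖(𝓕 w : L2 d) ξ‖ₑ ^ 2) volume :=
  (Lp.aestronglyMeasurable _).enorm.pow_const 2

theorem measurable_fracWeight (s : ℝ) :
    Measurable fun ξ : E d => ENNReal.ofReal ((2 * Real.pi * ‖ξ‖) ^ (2 * s)) := by
  fun_prop

theorem fracLaplaceEnergy_le {s t : ℝ} {η : ℝ} {C : ℝ≥0} (w : L2 d)
    (h : ∀ r : ℝ, 0 ≤ r →
      ENNReal.ofReal (r ^ (2 * t)) ≤ ENNReal.ofReal η * ENNReal.ofReal (r ^ (2 * s)) + C) :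
    fracLaplaceEnergy t w ≤ ENNReal.ofReal η * fracLaplaceEnergy s w + C * ‖w‖ₑ ^ 2 := by
  have hm : AEMeasurable (fun ξ : E d => ENNReal.ofReal ((2 * Real.pi * ‖ξ‖) ^ (2 * s)) *
      ‖(𝓕 w : L2 d) ξ‖ₑ ^ 2) volume :=
    (measurable_fracWeight s).aemeasurable.mul (aemeasurable_fourier_sq w)
  unfold fracLaplaceEnergy
  rw [← lintegral_enorm_sq_L2, ← lintegral_enorm_sq_fourier, ← lintegral_const_mul'' _ hm,
    ← lintegral_const_mul'' _ (aemeasurable_fourier_sq w),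
    ← lintegral_add_right' _ ((aemeasurable_fourier_sq w).const_mul _)]
  refine lintegral_mono fun ξ => ?_
  rw [← mul_assoc, ← add_mul]
  gcongr
  exact h _ (by positivity)

/-- The multiplier `∏ᵢ (2πi ξᵢ)^{αᵢ}` produces the weak derivative `D^α w`, as long as the
resulting function is square integrable. -/
theorem exists_L2_weakDeriv {s : ℝ} {w : L2 d} (hw : fracLaplaceEnergy s w < ⊤) (α : Fin d → ℕ)
    (hα : ((∑ i, α i : ℕ) : ℝ) ≤ s) :
    ∃ v : L2 d, HasWeakDeriv univ α w v ∧
      (𝓕 v : L2 d) =ᵐ[volume] fun ξ => symb α ξ * (𝓕 w : L2 d) ξ := by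
  induction α using multiIndex_induction with
  | h0 =>
    refine ⟨w, hasWeakDeriv_zero (locallyIntegrableOn_L2 w _), .of_forall fun ξ => ?_⟩
    simp [symb_zero]
  | hstep α k ih =>
    have hα' : ((∑ i, α i : ℕ) : ℝ) ≤ s := by
      rw [sum_add_single] at hα
      push_cast at hα ⊢
      linarith
    obtain ⟨v, hv, hvF⟩ := ih hα'
    set β : Fin d → ℕ := α + Pi.single k 1 with hβ
    set t : ℝ := ((∑ i, β i : ℕ) : ℝ) with ht
    have ht0 : 0 ≤ t := Nat.cast_nonneg _
    have hle : fracLaplaceEnergy t w ≤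
        ENNReal.ofReal 1 * fracLaplaceEnergy s w + (1 : ℝ≥0) * ‖w‖ₑ ^ 2 := by
      refine fracLaplaceEnergy_le w fun r hr => ?_
      rw [ENNReal.ofReal_one, one_mul]
      rcases le_total r 1 with h | h
      · refine le_add_left ?_
        rw [ENNReal.coe_one, ← ENNReal.ofReal_one]
        exact ENNReal.ofReal_le_ofReal (Real.rpow_le_one hr h (by linarith))
      · exact le_add_right (ENNReal.ofReal_le_ofReal
          (Real.rpow_le_rpow_of_exponent_le h (by linarith)))
    have hmem : MemLp (fun ξ => symb β ξ * (𝓕 w : L2 d) ξ) 2 volume := by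
      refine ⟨(continuous_symb β).aestronglyMeasurable.mul (Lp.aestronglyMeasurable _), ?_⟩
      rw [eLpNorm_lt_top_iff_lintegral_rpow_enorm_lt_top (by norm_num) (by norm_num)]
      have : ∫⁻ ξ, ‖symb β ξ * (𝓕 w : L2 d) ξ‖ₑ ^ 2 ≤ fracLaplaceEnergy t w := by
        refine lintegral_mono fun ξ => ?_
        simp only
        rw [enorm_mul, mul_pow]
        gcongr
        exact enorm_symb_sq_le β ξ
      have hfin := (this.trans hle).trans_lt (ENNReal.add_lt_top.2
        ⟨ENNReal.mul_lt_top ENNReal.ofReal_lt_top hw,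
          ENNReal.mul_lt_top ENNReal.coe_lt_top (ENNReal.pow_lt_top enorm_lt_top)⟩)
      simpa using hfin
    set v' : L2 d := 𝓕⁻ hmem.toLp with hv'
    have hF : (𝓕 v' : L2 d) =ᵐ[volume] fun ξ => symb β ξ * (𝓕 w : L2 d) ξ := by
      rw [hv', FourierTransform.fourier_fourierInv_eq]
      exact hmem.coeFn_toLp
    refine ⟨v', hv.comp (hasWeakDeriv_of_fourier ?_), hF⟩
    filter_upwards [hF, hvF] with ξ h1 h2
    rw [h1, h2, symb_add_single, mul_assoc]

/-- The sum of `‖D^α u‖²_{L²(Ω)}` over all `|α| < s`. -/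
def lowerOrderSq (s : ℝ) (Ω : Set (E d)) (u : E d → ℂ) : ℝ≥0∞ :=
  ∑ k ∈ Finset.range ⌈s⌉₊, ∑ α ∈ Finset.piAntidiag (Finset.univ : Finset (Fin d)) k,
    ∫⁻ x in Ω, ‖weakDeriv Ω α u x‖ₑ ^ 2

theorem ceil_eq_floor_of_fract_eq_zero {s : ℝ} (hs : 0 < s) (h : Int.fract s = 0) :
    ⌈s⌉₊ = ⌊s⌋₊ := by
  have := floor_add_fract_eq hs
  rw [h, add_zero] at this
  nth_rewrite 1 [← this]
  exact Nat.ceil_natCast _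

theorem ceil_eq_floor_add_one_of_fract_ne_zero {s : ℝ} (hs : 0 < s) (h : Int.fract s ≠ 0) :
    ⌈s⌉₊ = ⌊s⌋₊ + 1 := by
  have h1 := floor_add_fract_eq hs
  have h2 : 0 < Int.fract s := lt_of_le_of_ne (Int.fract_nonneg s) (Ne.symm h)
  have h3 := Int.fract_lt_one s
  rw [Nat.ceil_eq_iff (by omega)]
  push_cast
  constructor
  · linarith
  · linarith

theorem hsNormSq_le {s : ℝ} (hs : 0 < s) (Ω : Set (E d)) (u : E d → ℂ) :
    hsNormSq s Ω u ≤ 2 * hsSeminormSq s Ω u + lowerOrderSq s Ω u := by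
  unfold hsNormSq lowerOrderSq
  rw [two_mul, add_assoc]
  gcongr
  by_cases h : Int.fract s = 0
  · rw [ceil_eq_floor_of_fract_eq_zero hs h, Finset.sum_range_succ, add_comm]
    gcongr
    rw [hsSeminormSq, if_pos h]
    exact Finset.sum_le_sum fun α _ => le_mul_of_one_le_left zero_le (one_le_multinomial α)
  · rw [ceil_eq_floor_add_one_of_fract_ne_zero hs h]
    exact le_add_left le_rfl

theorem ceil_le_floor_add_one (s : ℝ) : ⌈s⌉₊ ≤ ⌊s⌋₊ + 1 := Nat.ceil_le_floor_add_one s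

theorem lowerOrderSq_le_hsNormSq (s : ℝ) (Ω : Set (E d)) (u : E d → ℂ) :
    lowerOrderSq s Ω u ≤ hsNormSq s Ω u := by
  unfold hsNormSq lowerOrderSq
  refine le_add_left (Finset.sum_le_sum_of_subset ?_)
  exact Finset.range_subset_range.2 (ceil_le_floor_add_one s)

theorem hsNormSq_zero {Ω : Set (E d)} (hΩ : IsOpen Ω) {u : E d → ℂ}
    (hu : MemLp u 2 (volume.restrict Ω)) : hsNormSq 0 Ω u = 2 * ∫⁻ x in Ω, ‖u x‖ₑ ^ 2 := by
  have h : ∫⁻ x in Ω, ‖weakDeriv Ω 0 u x‖ₑ ^ 2 = ∫⁻ x in Ω, ‖u x‖ₑ ^ 2 := by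
    refine lintegral_congr_ae ?_
    filter_upwards [(hasWeakDeriv_zero (locallyIntegrableOn_of_memLp hu)).weakDeriv_ae_eq hΩ]
      with x hx
    rw [hx]
  simp [hsNormSq, hsSeminormSq, h, two_mul, Nat.multinomial]

theorem memHs_zero {Ω : Set (E d)} (hΩ : IsOpen Ω) {u : E d → ℂ}
    (hu : MemLp u 2 (volume.restrict Ω)) : MemHs 0 Ω u := by
  refine ⟨fun α hα => ?_, ?_⟩
  · have : α = 0 := by
      ext i
      rw [Nat.floor_zero, Nat.le_zero, Finset.sum_eq_zero_iff] at hα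
      simpa using hα i (Finset.mem_univ i)
    exact ⟨u, this ▸ hasWeakDeriv_zero (locallyIntegrableOn_of_memLp hu)⟩
  · rw [hsNormSq_zero hΩ hu]
    have := hu.2
    rw [eLpNorm_lt_top_iff_lintegral_rpow_enorm_lt_top (by norm_num) (by norm_num)] at this
    exact ENNReal.mul_lt_top (by norm_num) (by simpa using this)

/-- The arithmetic of `exists_lowerOrderSq_le`: the term with `Λ` on the right side has a
coefficient of at most `1/2` and is absorbed into the left side. -/
theorem absorb_le {Λ S B : ℝ≥0∞} {N : ℕ} {η a ε : ℝ} {Cs Cη C0 : ℝ≥0} (hη : 0 ≤ η)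
    (ha1 : a ≤ 1 / 2) (ha2 : a ≤ ε / 4) (hNη : N * η * Cs ≤ a) (hε : 0 ≤ ε) (hΛ : Λ ≠ ⊤)
    (hS : S ≠ ⊤) (hB : B ≠ ⊤)
    (h : Λ ≤ N * (ENNReal.ofReal η * (Cs * (2 * S + Λ)) + Cη * (C0 * (2 * B)))) :
    Λ ≤ ENNReal.ofReal ε * S + (2 * (N * Cη * (C0 * 2)) : ℝ≥0) * B := by
  lift Λ to ℝ≥0 using hΛ
  lift S to ℝ≥0 using hS
  lift B to ℝ≥0 using hB
  lift ε to ℝ≥0 using hε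
  lift η to ℝ≥0 using hη
  rw [ENNReal.ofReal_coe_nnreal] at h ⊢
  norm_cast at h ⊢
  rw [← NNReal.coe_le_coe] at h ⊢
  push_cast at h ⊢
  have h1 : N * (η * (Cs * (2 * (S : ℝ) + Λ))) ≤ a * (2 * S + Λ) := by
    have : 0 ≤ 2 * (S : ℝ) + Λ := by positivity
    calc N * (η * (Cs * (2 * (S : ℝ) + Λ))) = N * η * Cs * (2 * S + Λ) := by ring
      _ ≤ a * (2 * S + Λ) := mul_le_mul_of_nonneg_right hNη this
  have h2 : a * Λ ≤ 1 / 2 * Λ := mul_le_mul_of_nonneg_right ha1 Λ.2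
  have h3 : a * S ≤ ε / 4 * S := mul_le_mul_of_nonneg_right ha2 S.2
  linarith

/-- On an extension domain, the derivatives of order less than `s` are bounded by an arbitrarily
small multiple of the `Ḣ^s` seminorm, up to a multiple of the `L²` norm: this holds on `ℝ^d` by
Fourier transform, and the extension operator, bounded for `t = s` and `t = 0`, carries it over. -/
theorem exists_lowerOrderSq_le {s : ℝ} (hs : 0 < s) {Ω : Set (E d)} (hΩ : IsExtensionDomain s Ω)
    {ε : ℝ} (hε : 0 < ε) :
    ∃ C : ℝ≥0, ∀ u : E d → ℂ, MemLp u 2 (volume.restrict Ω) → MemHs s Ω u →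
      lowerOrderSq s Ω u ≤ ENNReal.ofReal ε * hsSeminormSq s Ω u +
        C * ∫⁻ x in Ω, ‖u x‖ₑ ^ 2 := by
  obtain ⟨hopen, T, hT, hTb⟩ := hΩ
  obtain ⟨Cs, hCs⟩ := hTb s hs.le le_rfl
  obtain ⟨C0, hC0⟩ := hTb 0 le_rfl hs.le
  obtain ⟨N, hN⟩ : ∃ N : ℕ, N = ∑ k ∈ Finset.range ⌈s⌉₊,
    (Finset.piAntidiag (Finset.univ : Finset (Fin d)) k).card := ⟨_, rfl⟩
  obtain ⟨a, hapos, ha1, ha2⟩ : ∃ a : ℝ, 0 < a ∧ a ≤ 1 / 2 ∧ a ≤ ε / 4 :=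
    ⟨min (1 / 2) (ε / 4), lt_min (by norm_num) (by linarith), min_le_left _ _, min_le_right _ _⟩
  obtain ⟨η, hηpos, hNη⟩ : ∃ η : ℝ, 0 < η ∧ N * η * Cs ≤ a := by
    have h0 : (0 : ℝ) ≤ N * Cs := mul_nonneg (Nat.cast_nonneg N) Cs.2
    refine ⟨a / (N * Cs + 1), div_pos hapos (by linarith), ?_⟩
    rw [mul_div_assoc', div_mul_eq_mul_div, div_le_iff₀ (by linarith)]
    nlinarith
  have hceil : 0 < ⌈s⌉₊ := Nat.ceil_pos.2 hs
  have ht₀ : ((⌈s⌉₊ - 1 : ℕ) : ℝ) < s := Nat.lt_ceil.1 (by omega)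
  obtain ⟨Cη, hCη⟩ := exists_rpow_le ht₀ hηpos
  refine ⟨2 * (N * Cη * (C0 * 2)), fun u hu hus => ?_⟩
  set U : Lp ℂ 2 (volume.restrict Ω) := hu.toLp u with hU
  have hUu : (U : E d → ℂ) =ᵐ[volume.restrict Ω] u := hu.coeFn_toLp
  set w : L2 d := T U with hw
  have hwu : (w : E d → ℂ) =ᵐ[volume.restrict Ω] u := (hT U).trans hUu
  have b1 : fracLaplaceEnergy s w ≤ Cs * hsNormSq s Ω u := by
    have := hCs U ((memHs_congr hopen s hUu).2 hus)
    rw [hsNormSq_congr hopen s hUu] at this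
    exact (le_add_left le_rfl).trans this
  have b0 : ‖w‖ₑ ^ 2 ≤ C0 * (2 * ∫⁻ x in Ω, ‖u x‖ₑ ^ 2) := by
    have := hC0 U ((memHs_congr hopen 0 hUu).2 (memHs_zero hopen hu))
    rw [hsNormSq_congr hopen 0 hUu, hsNormSq_zero hopen hu] at this
    exact (le_add_right le_rfl).trans this
  have hfin : fracLaplaceEnergy s w < ⊤ :=
    b1.trans_lt (ENNReal.mul_lt_top ENNReal.coe_lt_top hus.2)
  have hterm : ∀ k ∈ Finset.range ⌈s⌉₊,
      ∀ α ∈ Finset.piAntidiag (Finset.univ : Finset (Fin d)) k,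
        ∫⁻ x in Ω, ‖weakDeriv Ω α u x‖ₑ ^ 2 ≤
          ENNReal.ofReal η * fracLaplaceEnergy s w + Cη * ‖w‖ₑ ^ 2 := by
    intro k hk α hα
    rw [Finset.mem_range] at hk
    have hα' : ∑ i, α i = k := (Finset.mem_piAntidiag.1 hα).1
    have hk' : (k : ℝ) ≤ ((⌈s⌉₊ - 1 : ℕ) : ℝ) := by exact_mod_cast (by omega : k ≤ ⌈s⌉₊ - 1)
    obtain ⟨v, hv, hvF⟩ := exists_L2_weakDeriv hfin α (by rw [hα']; linarith)
    have hae : weakDeriv Ω α u =ᵐ[volume.restrict Ω] v :=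
      ((hv.mono (subset_univ Ω)).congr hopen hwu .rfl).weakDeriv_ae_eq hopen
    calc ∫⁻ x in Ω, ‖weakDeriv Ω α u x‖ₑ ^ 2 = ∫⁻ x in Ω, ‖v x‖ₑ ^ 2 :=
          lintegral_congr_ae (by filter_upwards [hae] with x hx using by rw [hx])
      _ ≤ ∫⁻ x, ‖v x‖ₑ ^ 2 := setLIntegral_le_lintegral _ _
      _ = ∫⁻ ξ, ‖(𝓕 v : L2 d) ξ‖ₑ ^ 2 := (lintegral_enorm_sq_fourier v).symm
      _ ≤ fracLaplaceEnergy (k : ℝ) w := by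
          refine lintegral_mono_ae ?_
          filter_upwards [hvF] with ξ hξ
          rw [hξ, enorm_mul, mul_pow, ← hα']
          gcongr
          exact enorm_symb_sq_le α ξ
      _ ≤ ENNReal.ofReal η * fracLaplaceEnergy s w + Cη * ‖w‖ₑ ^ 2 :=
          fracLaplaceEnergy_le w (hCη k (Nat.cast_nonneg _) hk')
  have hsum : lowerOrderSq s Ω u ≤
      N * (ENNReal.ofReal η * fracLaplaceEnergy s w + Cη * ‖w‖ₑ ^ 2) := by
    refine (Finset.sum_le_sum fun k hk => Finset.sum_le_sum fun α hα => hterm k hk α hα).trans ?_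
    simp only [Finset.sum_const, nsmul_eq_mul]
    rw [← Finset.sum_mul, hN]
    push_cast
    exact le_rfl
  -- absorb the lower-order terms into the left side
  have hLfin : lowerOrderSq s Ω u ≠ ⊤ := ((lowerOrderSq_le_hsNormSq s Ω u).trans_lt hus.2).ne
  have hSfin : hsSeminormSq s Ω u ≠ ⊤ := (lt_of_le_of_lt (le_add_right le_rfl) hus.2).ne
  have hBfin : ∫⁻ x in Ω, ‖u x‖ₑ ^ 2 ≠ ⊤ := by
    have := hu.2
    rw [eLpNorm_lt_top_iff_lintegral_rpow_enorm_lt_top (by norm_num) (by norm_num)] at this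
    simpa using this.ne
  have hall : lowerOrderSq s Ω u ≤ N * (ENNReal.ofReal η * (Cs * (2 * hsSeminormSq s Ω u +
      lowerOrderSq s Ω u)) + Cη * (C0 * (2 * ∫⁻ x in Ω, ‖u x‖ₑ ^ 2))) := by
    refine hsum.trans ?_
    gcongr
    exact b1.trans (by gcongr; exact hsNormSq_le hs Ω u)
  exact absorb_le hηpos.le ha1 ha2 hNη hε.le hLfin hSfin hBfin hall

end LocalUncertainty
end

noncomputable section

namespace LocalUncertainty

/-! ### The Gagliardo seminorm on the whole space -/

variable {d : ℕ}

/-- The Gamma integral, as a Lebesgue integral. -/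
theorem lintegral_rpow_mul_exp {p r : ℝ} (hp : 0 < p) (hr : 0 < r) :
    ∫⁻ t in Ioi (0 : ℝ), ENNReal.ofReal (t ^ (p - 1) * Real.exp (-(r * t))) =
      ENNReal.ofReal ((1 / r) ^ p * Real.Gamma p) := by
  have h := Real.integral_rpow_mul_exp_neg_mul_Ioi hp hr
  have hne : ∫ t in Ioi (0 : ℝ), t ^ (p - 1) * Real.exp (-(r * t)) ≠ 0 := by
    rw [h]
    have := Real.Gamma_pos_of_pos hp
    positivity
  have hint : IntegrableOn (fun t : ℝ => t ^ (p - 1) * Real.exp (-(r * t))) (Ioi 0) := by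
    by_contra hc
    exact hne (integral_undef hc)
  rw [← h, ofReal_integral_eq_lintegral_ofReal hint]
  filter_upwards [ae_restrict_mem measurableSet_Ioi] with t ht
  have : (0 : ℝ) < t := ht
  positivity

theorem lintegral_rpow_mul_exp_inv {σ b : ℝ} (hσ : σ < 1) (hb : 0 < b) :
    ∫⁻ t in Ioi (0 : ℝ), ENNReal.ofReal (t ^ (σ - 2) * Real.exp (-(b / t))) =
      ENNReal.ofReal (b ^ (σ - 1) * Real.Gamma (1 - σ)) := by
  have h0 := Real.integral_rpow_mul_exp_neg_mul_Ioi (a := 1 - σ) (by linarith) hb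
  have h1 := integral_comp_rpow_Ioi (fun r : ℝ => r ^ ((1 - σ) - 1) * Real.exp (-(b * r)))
    (p := -1) (by norm_num)
  have h2 : ∫ t in Ioi (0 : ℝ), t ^ (σ - 2) * Real.exp (-(b / t)) =
      b ^ (σ - 1) * Real.Gamma (1 - σ) := by
    have e : (1 / b) ^ (1 - σ) = b ^ (σ - 1) := by
      rw [one_div, Real.inv_rpow hb.le, ← Real.rpow_neg hb.le]
      congr 1
      ring
    rw [← e, ← h0, ← h1]
    refine setIntegral_congr_fun measurableSet_Ioi fun t ht => ?_
    have ht' : (0 : ℝ) < t := ht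
    simp only [abs_neg, abs_one, one_mul, smul_eq_mul]
    rw [Real.rpow_neg_one, div_eq_mul_inv, ← mul_assoc, Real.inv_rpow ht'.le,
      ← Real.rpow_neg ht'.le, ← Real.rpow_add ht']
    congr 2
    ring
  have hne : ∫ t in Ioi (0 : ℝ), t ^ (σ - 2) * Real.exp (-(b / t)) ≠ 0 := by
    rw [h2]
    have := Real.Gamma_pos_of_pos (s := 1 - σ) (by linarith)
    positivity
  have hint : IntegrableOn (fun t : ℝ => t ^ (σ - 2) * Real.exp (-(b / t))) (Ioi 0) := by
    by_contra hc
    exact hne (integral_undef hc)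
  rw [← h2, ofReal_integral_eq_lintegral_ofReal hint]
  filter_upwards [ae_restrict_mem measurableSet_Ioi] with t ht
  have : (0 : ℝ) < t := ht
  positivity

theorem lintegral_Ioc_exp {a t : ℝ} (ha : 0 ≤ a) (ht : 0 < t) :
    ∫⁻ b in Ioc (0 : ℝ) a, ENNReal.ofReal (t⁻¹ * Real.exp (-(b / t))) =
      ENNReal.ofReal (1 - Real.exp (-(a / t))) := by
  have hder : ∀ b : ℝ, HasDerivAt (fun b : ℝ => -Real.exp (-(b / t)))
      (t⁻¹ * Real.exp (-(b / t))) b := by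
    intro b
    have h : HasDerivAt (fun b : ℝ => -Real.exp (-(b / t))) (-(Real.exp (-(b / t)) * -(1 / t))) b :=
      ((((hasDerivAt_id b).div_const t).neg).exp).neg
    exact h.congr_deriv (by ring)
  have hc : Continuous fun b : ℝ => t⁻¹ * Real.exp (-(b / t)) := by fun_prop
  have h := intervalIntegral.integral_eq_sub_of_hasDerivAt (a := 0) (b := a)
    (fun b _ => hder b) (hc.intervalIntegrable 0 a)
  rw [intervalIntegral.integral_of_le ha] at h
  rw [← ofReal_integral_eq_lintegral_ofReal, h]
  · congr 1
    simp
    ring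
  · exact (hc.intervalIntegrable 0 a).1
  · exact .of_forall fun b => by positivity

theorem lintegral_Ioc_rpow {a σ : ℝ} (ha : 0 ≤ a) (hσ : 0 < σ) :
    ∫⁻ b in Ioc (0 : ℝ) a, ENNReal.ofReal (b ^ (σ - 1)) = ENNReal.ofReal (a ^ σ / σ) := by
  have hi : IntervalIntegrable (fun b : ℝ => b ^ (σ - 1)) volume 0 a :=
    intervalIntegral.intervalIntegrable_rpow' (by linarith)
  have h : ∫ b in (0 : ℝ)..a, b ^ (σ - 1) = a ^ σ / σ := by
    rw [integral_rpow (Or.inl (by linarith)), sub_add_cancel, Real.zero_rpow hσ.ne', sub_zero]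
  rw [intervalIntegral.integral_of_le ha] at h
  rw [← h, ofReal_integral_eq_lintegral_ofReal hi.1]
  filter_upwards [ae_restrict_mem measurableSet_Ioc] with t ht
  exact Real.rpow_nonneg ht.1.le _

/-- `∫₀^∞ t^{σ-1} (1 - e^{-a/t}) dt = a^σ Γ(1-σ) / σ`. -/
theorem lintegral_rpow_mul_one_sub_exp {a σ : ℝ} (ha : 0 ≤ a) (hσ : 0 < σ) (hσ1 : σ < 1) :
    ∫⁻ t in Ioi (0 : ℝ), ENNReal.ofReal (t ^ (σ - 1) * (1 - Real.exp (-(a / t)))) =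
      ENNReal.ofReal (a ^ σ / σ * Real.Gamma (1 - σ)) := by
  have e1 : ∫⁻ t in Ioi (0 : ℝ), ENNReal.ofReal (t ^ (σ - 1) * (1 - Real.exp (-(a / t)))) =
      ∫⁻ t in Ioi (0 : ℝ), ∫⁻ b in Ioc (0 : ℝ) a,
        ENNReal.ofReal (t ^ (σ - 2) * Real.exp (-(b / t))) := by
    refine setLIntegral_congr_fun measurableSet_Ioi fun t ht => ?_
    have ht' : (0 : ℝ) < t := ht
    rw [ENNReal.ofReal_mul (by positivity), ← lintegral_Ioc_exp ha ht',
      ← lintegral_const_mul' _ _ ENNReal.ofReal_ne_top]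
    refine lintegral_congr fun b => ?_
    rw [← ENNReal.ofReal_mul (by positivity), ← mul_assoc, ← Real.rpow_neg_one t,
      ← Real.rpow_add ht']
    congr 3
    ring
  rw [e1, lintegral_lintegral_swap (by fun_prop)]
  have e2 : ∫⁻ b in Ioc (0 : ℝ) a, ∫⁻ t in Ioi (0 : ℝ),
        ENNReal.ofReal (t ^ (σ - 2) * Real.exp (-(b / t))) =
      ∫⁻ b in Ioc (0 : ℝ) a,
        ENNReal.ofReal (b ^ (σ - 1)) * ENNReal.ofReal (Real.Gamma (1 - σ)) := by
    refine setLIntegral_congr_fun measurableSet_Ioc fun b hb => ?_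
    rw [lintegral_rpow_mul_exp_inv hσ1 hb.1, ENNReal.ofReal_mul (Real.rpow_nonneg hb.1.le _)]
  rw [e2, lintegral_mul_const' _ _ ENNReal.ofReal_ne_top, lintegral_Ioc_rpow ha hσ,
    ← ENNReal.ofReal_mul (by positivity)]

theorem enorm_phase_sub_one_sq (h ξ : E d) :
    ‖phase h ξ - 1‖ₑ ^ 2 = ENNReal.ofReal (2 - 2 * Real.cos (2 * Real.pi * inner ℝ h ξ)) := by
  rw [← ofReal_norm, ← ENNReal.ofReal_pow (norm_nonneg _)]
  congr 1
  rw [phase, show (2 : ℂ) * Real.pi * (inner ℝ h ξ : ℝ) * Complex.I =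
    ((2 * Real.pi * inner ℝ h ξ : ℝ) : ℂ) * Complex.I by push_cast; ring]
  set θ : ℝ := 2 * Real.pi * inner ℝ h ξ
  rw [Complex.sq_norm, Complex.normSq_apply, Complex.sub_re, Complex.sub_im,
    Complex.exp_ofReal_mul_I_re, Complex.exp_ofReal_mul_I_im, Complex.one_re, Complex.one_im]
  have := Real.sin_sq_add_cos_sq θ
  nlinarith

/-- The Gaussian average of `|e^{2πi h·ξ} - 1|²`. -/
theorem integral_gaussian_phase {t : ℝ} (ht : 0 < t) (ξ : E d) :
    ∫⁻ h : E d, ENNReal.ofReal (2 - 2 * Real.cos (2 * Real.pi * inner ℝ h ξ)) *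
        ENNReal.ofReal (Real.exp (-(‖h‖ ^ 2 * t))) =
      ENNReal.ofReal (2 * Real.pi ^ ((d : ℝ) / 2) * t ^ (-((d : ℝ) / 2)) *
        (1 - Real.exp (-((Real.pi ^ 2 * ‖ξ‖ ^ 2) / t)))) := by
  have hre : 0 < ((t : ℂ)).re := by simpa using ht
  have hG := GaussianFourier.integral_rexp_neg_mul_sq_norm (V := E d) ht
  have hF := GaussianFourier.integral_cexp_neg_mul_sq_norm_add (V := E d) hre
    (2 * Real.pi * Complex.I) ξ
  have hI := GaussianFourier.integrable_cexp_neg_mul_sq_norm_add (V := E d) hre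
    (2 * Real.pi * Complex.I) ξ
  have hI0 : Integrable fun h : E d => Real.exp (-t * ‖h‖ ^ 2) := by
    have := (GaussianFourier.integrable_cexp_neg_mul_sq_norm_add (V := E d) hre 0 0).re
    refine this.congr (.of_forall fun h => ?_)
    simp only [zero_mul, add_zero]
    rw [show -(t : ℂ) * (‖h‖ : ℂ) ^ 2 = ((-t * ‖h‖ ^ 2 : ℝ) : ℂ) by push_cast; ring]
    exact Complex.exp_ofReal_re _
  have hre' : ∀ h : E d, (Complex.exp (-(t : ℂ) * (‖h‖ : ℂ) ^ 2 +
      2 * Real.pi * Complex.I * (inner ℝ ξ h : ℝ))).re =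
      Real.cos (2 * Real.pi * inner ℝ h ξ) * Real.exp (-t * ‖h‖ ^ 2) := by
    intro h
    rw [Complex.exp_re]
    have harg : -(t : ℂ) * (‖h‖ : ℂ) ^ 2 + 2 * Real.pi * Complex.I * (inner ℝ ξ h : ℝ) =
        ((-t * ‖h‖ ^ 2 : ℝ) : ℂ) + ((2 * Real.pi * inner ℝ h ξ : ℝ) : ℂ) * Complex.I := by
      rw [real_inner_comm ξ h]
      push_cast
      ring
    have a1 : (-(t : ℂ) * (‖h‖ : ℂ) ^ 2 + 2 * Real.pi * Complex.I * (inner ℝ ξ h : ℝ)).re =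
        -t * ‖h‖ ^ 2 := by
      rw [harg, Complex.add_re, Complex.ofReal_re, Complex.re_ofReal_mul, Complex.I_re, mul_zero,
        add_zero]
    have a2 : (-(t : ℂ) * (‖h‖ : ℂ) ^ 2 + 2 * Real.pi * Complex.I * (inner ℝ ξ h : ℝ)).im =
        2 * Real.pi * inner ℝ h ξ := by
      rw [harg, Complex.add_im, Complex.ofReal_im, Complex.im_ofReal_mul, Complex.I_im, mul_one,
        zero_add]
    rw [a1, a2, mul_comm]
  have hIc : Integrable fun h : E d =>
      Real.cos (2 * Real.pi * inner ℝ h ξ) * Real.exp (-t * ‖h‖ ^ 2) :=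
    hI.re.congr (.of_forall fun h => hre' h)
  have hFc : ∫ h : E d, Real.cos (2 * Real.pi * inner ℝ h ξ) * Real.exp (-t * ‖h‖ ^ 2) =
      (Real.pi / t) ^ ((d : ℝ) / 2) * Real.exp (-((Real.pi ^ 2 * ‖ξ‖ ^ 2) / t)) := by
    have h1 := congrArg Complex.re hF
    have h2 : (∫ h : E d, Complex.exp (-(t : ℂ) * (‖h‖ : ℂ) ^ 2 +
        2 * Real.pi * Complex.I * (inner ℝ ξ h : ℝ))).re =
        ∫ h : E d, (Complex.exp (-(t : ℂ) * (‖h‖ : ℂ) ^ 2 +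
          2 * Real.pi * Complex.I * (inner ℝ ξ h : ℝ))).re :=
      (integral_re hI).symm
    rw [h2] at h1
    simp only [hre'] at h1
    rw [h1, finrank_euclideanSpace_fin]
    have e1 : ((Real.pi : ℂ) / t) ^ ((d : ℂ) / 2) =
        (((Real.pi / t) ^ ((d : ℝ) / 2) : ℝ) : ℂ) := by
      rw [Complex.ofReal_cpow (by positivity)]
      push_cast
      rfl
    have e2 : (2 * (Real.pi : ℂ) * Complex.I) ^ 2 * (‖ξ‖ : ℂ) ^ 2 / (4 * t) =
        ((-((Real.pi ^ 2 * ‖ξ‖ ^ 2) / t) : ℝ) : ℂ) := by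
      have : (t : ℂ) ≠ 0 := by exact_mod_cast ht.ne'
      rw [mul_pow, Complex.I_sq]
      push_cast
      field_simp
      ring
    rw [e1, e2, ← Complex.ofReal_exp, ← Complex.ofReal_mul, Complex.ofReal_re]
  have hsum : ∫ h : E d, (2 - 2 * Real.cos (2 * Real.pi * inner ℝ h ξ)) *
      Real.exp (-(‖h‖ ^ 2 * t)) = 2 * Real.pi ^ ((d : ℝ) / 2) * t ^ (-((d : ℝ) / 2)) *
        (1 - Real.exp (-((Real.pi ^ 2 * ‖ξ‖ ^ 2) / t))) := by
    have e : ∀ h : E d, (2 - 2 * Real.cos (2 * Real.pi * inner ℝ h ξ)) *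
        Real.exp (-(‖h‖ ^ 2 * t)) = 2 * Real.exp (-t * ‖h‖ ^ 2) -
          2 * (Real.cos (2 * Real.pi * inner ℝ h ξ) * Real.exp (-t * ‖h‖ ^ 2)) := by
      intro h
      rw [show -(‖h‖ ^ 2 * t) = -t * ‖h‖ ^ 2 by ring]
      ring
    simp only [e]
    rw [integral_sub (hI0.const_mul 2) (hIc.const_mul 2), integral_const_mul, integral_const_mul,
      hG, hFc, finrank_euclideanSpace_fin, Real.div_rpow Real.pi_pos.le ht.le,
      Real.rpow_neg ht.le]
    ring
  have hnn : ∀ h : E d, 0 ≤ 2 - 2 * Real.cos (2 * Real.pi * inner ℝ h ξ) := fun h => by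
    linarith [Real.cos_le_one (2 * Real.pi * inner ℝ h ξ)]
  rw [← hsum, ofReal_integral_eq_lintegral_ofReal]
  · refine lintegral_congr fun h => ?_
    rw [ENNReal.ofReal_mul (hnn h)]
  · refine ((hI0.const_mul 2).sub (hIc.const_mul 2)).congr (.of_forall fun h => ?_)
    simp only [Pi.sub_apply]
    rw [show -(‖h‖ ^ 2 * t) = -t * ‖h‖ ^ 2 by ring]
    ring
  · exact .of_forall fun h => mul_nonneg (hnn h) (Real.exp_pos _).le

theorem abs_Gamma_neg {σ : ℝ} (hσ : 0 < σ) (hσ1 : σ < 1) :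
    |Real.Gamma (-σ)| = Real.Gamma (1 - σ) / σ := by
  have h := Real.Gamma_add_one (s := -σ) (by linarith)
  have h1 := Real.Gamma_pos_of_pos (s := 1 - σ) (by linarith)
  rw [show -σ + 1 = 1 - σ by ring] at h
  have h2 : Real.Gamma (-σ) = -(Real.Gamma (1 - σ) / σ) := by
    rw [h]
    field_simp
  rw [h2, abs_neg, abs_of_pos (by positivity)]

theorem gagliardoConst_pos {σ : ℝ} (hσ : 0 < σ) (hσ1 : σ < 1) : 0 < gagliardoConst d σ := by
  have h1 := Real.Gamma_pos_of_pos (s := 1 - σ) (by linarith)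
  have h2 := Real.Gamma_pos_of_pos (s := (d : ℝ) / 2 + σ) (by positivity)
  rw [gagliardoConst, abs_Gamma_neg hσ hσ1]
  positivity

/-- The constant `c_{d,σ}` is the right one: writing `|h|^{-d-2σ}` as a superposition of Gaussians
reduces the integral to Gamma integrals. -/
theorem gagliardoConst_mul_lintegral (hd : 1 ≤ d) {σ : ℝ} (hσ : 0 < σ) (hσ1 : σ < 1) (ξ : E d) :
    ENNReal.ofReal (gagliardoConst d σ) *
        ∫⁻ h : E d, ‖phase h ξ - 1‖ₑ ^ 2 / ENNReal.ofReal (‖h‖ ^ ((d : ℝ) + 2 * σ)) =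
      ENNReal.ofReal ((2 * Real.pi * ‖ξ‖) ^ (2 * σ)) := by
  set p : ℝ := (d : ℝ) / 2 + σ with hp
  have hppos : 0 < p := by positivity
  have hΓ := Real.Gamma_pos_of_pos hppos
  have hΓ1 := Real.Gamma_pos_of_pos (s := 1 - σ) (by linarith)
  set a : ℝ := Real.pi ^ 2 * ‖ξ‖ ^ 2 with ha
  have hapos : 0 ≤ a := by positivity
  set A : E d → ℝ := fun h => 2 - 2 * Real.cos (2 * Real.pi * inner ℝ h ξ) with hA
  have hAm : Measurable A := by
    have : Continuous A := by fun_prop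
    exact this.measurable
  have : Nonempty (Fin d) := ⟨⟨0, hd⟩⟩
  have hne : ∀ᵐ h : E d, h ≠ 0 := by
    rw [ae_iff]
    simp
  have e1 : ∫⁻ h : E d, ‖phase h ξ - 1‖ₑ ^ 2 / ENNReal.ofReal (‖h‖ ^ ((d : ℝ) + 2 * σ)) =
      ∫⁻ h : E d, ENNReal.ofReal (Real.Gamma p)⁻¹ * ∫⁻ t in Ioi (0 : ℝ),
        ENNReal.ofReal (A h) * ENNReal.ofReal (t ^ (p - 1) * Real.exp (-(‖h‖ ^ 2 * t))) := by
    refine lintegral_congr_ae ?_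
    filter_upwards [hne] with h hh
    have hn : 0 < ‖h‖ := norm_pos_iff.2 hh
    have hpow : (1 / ‖h‖ ^ 2) ^ p = (‖h‖ ^ ((d : ℝ) + 2 * σ))⁻¹ := by
      rw [one_div, Real.inv_rpow (by positivity), ← Real.rpow_natCast, ← Real.rpow_mul hn.le]
      congr 2
      rw [hp]
      push_cast
      ring
    rw [lintegral_const_mul' _ _ ENNReal.ofReal_ne_top,
      lintegral_rpow_mul_exp hppos (by positivity : 0 < ‖h‖ ^ 2), hpow, enorm_phase_sub_one_sq,
      mul_left_comm, ← ENNReal.ofReal_mul (by positivity), div_eq_mul_inv,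
      ← ENNReal.ofReal_inv_of_pos (by positivity)]
    congr 2
    field_simp
  have e2 : ∫⁻ h : E d, ∫⁻ t in Ioi (0 : ℝ),
        ENNReal.ofReal (A h) * ENNReal.ofReal (t ^ (p - 1) * Real.exp (-(‖h‖ ^ 2 * t))) =
      ENNReal.ofReal (2 * Real.pi ^ ((d : ℝ) / 2)) *
        ENNReal.ofReal (a ^ σ / σ * Real.Gamma (1 - σ)) := by
    rw [lintegral_lintegral_swap (by fun_prop), ← lintegral_rpow_mul_one_sub_exp hapos hσ hσ1,
      ← lintegral_const_mul' _ _ ENNReal.ofReal_ne_top]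
    refine setLIntegral_congr_fun measurableSet_Ioi fun t ht => ?_
    have ht' : (0 : ℝ) < t := ht
    have : ∀ h : E d, ENNReal.ofReal (A h) *
        ENNReal.ofReal (t ^ (p - 1) * Real.exp (-(‖h‖ ^ 2 * t))) = ENNReal.ofReal (t ^ (p - 1)) *
          (ENNReal.ofReal (A h) * ENNReal.ofReal (Real.exp (-(‖h‖ ^ 2 * t)))) := by
      intro h
      rw [ENNReal.ofReal_mul (by positivity)]
      ring
    simp only [this]
    rw [lintegral_const_mul' _ _ ENNReal.ofReal_ne_top, hA, integral_gaussian_phase ht',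
      ← ENNReal.ofReal_mul (by positivity), ← ENNReal.ofReal_mul (by positivity)]
    congr 1
    rw [show p - 1 = (d : ℝ) / 2 + (σ - 1) by rw [hp]; ring, Real.rpow_add ht',
      Real.rpow_neg ht'.le]
    have : t ^ ((d : ℝ) / 2) ≠ 0 := by positivity
    rw [← ha]
    field_simp
  rw [e1, lintegral_const_mul' _ _ ENNReal.ofReal_ne_top, e2,
    ← ENNReal.ofReal_mul (by positivity), ← ENNReal.ofReal_mul (by positivity),
    ← ENNReal.ofReal_mul (gagliardoConst_pos hσ hσ1).le]
  congr 1
  have hpi : Real.pi ^ ((d : ℝ) / 2) ≠ 0 := by positivity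
  have e3 : (2 * Real.pi * ‖ξ‖) ^ (2 * σ) = 2 ^ (2 * σ) * a ^ σ := by
    rw [mul_assoc, Real.mul_rpow (by norm_num) (by positivity), Real.rpow_mul (x := Real.pi * ‖ξ‖)
      (by positivity)]
    congr 2
    rw [ha, ← mul_pow]
    norm_cast
  rw [e3, gagliardoConst, abs_Gamma_neg hσ hσ1, ← hp, Real.rpow_sub_one (by norm_num)]
  field_simp

/-- The Gagliardo double integral of a function on `ℝ^d` is its energy `∫ |p|^{2σ} |f̂(p)|² dp`. -/
theorem gagliardo_eq_fracLaplaceEnergy (hd : 1 ≤ d) {σ : ℝ} (hσ : 0 < σ) (hσ1 : σ < 1) (f : L2 d) :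
    ENNReal.ofReal (gagliardoConst d σ) * ∫⁻ x : E d, ∫⁻ y : E d, ‖f x - f y‖ₑ ^ 2 /
        ENNReal.ofReal (‖x - y‖ ^ ((d : ℝ) + 2 * σ)) = fracLaplaceEnergy σ f := by
  set κ : E d → ℝ≥0∞ := fun h => ENNReal.ofReal (‖h‖ ^ ((d : ℝ) + 2 * σ)) with hκ
  have hκm : Measurable κ := by fun_prop
  have hfm : Measurable (f : E d → ℂ) := (Lp.stronglyMeasurable f).measurable
  have hFm : Measurable ((𝓕 f : L2 d) : E d → ℂ) := (Lp.stronglyMeasurable _).measurable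
  have hshift : ∀ x : E d, ∫⁻ y : E d, ‖f x - f y‖ₑ ^ 2 / κ (x - y) =
      ∫⁻ h : E d, ‖f (x + h) - f x‖ₑ ^ 2 / κ h := by
    intro x
    rw [← lintegral_add_left_eq_self (fun y => ‖f x - f y‖ₑ ^ 2 / κ (x - y)) x]
    refine lintegral_congr fun h => ?_
    rw [enorm_sub_rev]
    simp [hκ]
  -- Plancherel for the difference of a translate of `f` and `f`
  have hinner : ∀ h : E d, ∫⁻ x : E d, ‖f (x + h) - f x‖ₑ ^ 2 / κ h =
      ∫⁻ ξ : E d, ‖phase h ξ - 1‖ₑ ^ 2 / κ h * ‖(𝓕 f : L2 d) ξ‖ₑ ^ 2 := by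
    intro h
    have hmem : MemLp (fun x => f (x + h)) 2 volume :=
      (Lp.memLp f).comp_measurePreserving (measurePreserving_add_right volume h)
    set fh : L2 d := hmem.toLp with hfh
    have hfh_ae : fh =ᵐ[volume] fun x => f (x + h) := hmem.coeFn_toLp
    have h1 : ∫⁻ x : E d, ‖f (x + h) - f x‖ₑ ^ 2 = ∫⁻ x, ‖(fh - f : L2 d) x‖ₑ ^ 2 := by
      refine lintegral_congr_ae ?_
      filter_upwards [hfh_ae, Lp.coeFn_sub fh f] with x h1 h2
      rw [h2, Pi.sub_apply, h1]
    have h2 : ∫⁻ x, ‖(fh - f : L2 d) x‖ₑ ^ 2 =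
        ∫⁻ ξ : E d, ‖phase h ξ - 1‖ₑ ^ 2 * ‖(𝓕 f : L2 d) ξ‖ₑ ^ 2 := by
      rw [← lintegral_enorm_sq_fourier]
      have hsub : (𝓕 (fh - f) : L2 d) = (𝓕 fh : L2 d) - (𝓕 f : L2 d) :=
        (Lp.fourierTransformₗᵢ (E d) ℂ).map_sub fh f
      rw [hsub]
      refine lintegral_congr_ae ?_
      filter_upwards [fourier_translate h hfh_ae, Lp.coeFn_sub (𝓕 fh : L2 d) (𝓕 f : L2 d)]
        with ξ h1 h2
      rw [h2, Pi.sub_apply, h1, ← mul_pow, ← enorm_mul, sub_mul, one_mul]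
    simp only [div_eq_mul_inv]
    rw [lintegral_mul_const, h1, h2, ← lintegral_mul_const]
    · refine lintegral_congr fun ξ => ?_
      ring
    · exact ((((contDiff_phase h).continuous.measurable).sub_const 1).enorm.pow_const 2).mul
        (hFm.enorm.pow_const 2)
    · exact ((hfm.comp (measurable_add_const h)).sub hfm).enorm.pow_const 2
  have hphase : Measurable fun p : E d × E d => phase p.1 p.2 := by
    unfold phase
    fun_prop
  have m1 : Measurable (Function.uncurry fun x h : E d => ‖f (x + h) - f x‖ₑ ^ 2 / κ h) := by
    refine Measurable.div ?_ (hκm.comp measurable_snd)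
    exact ((hfm.comp (measurable_fst.add measurable_snd)).sub
      (hfm.comp measurable_fst)).enorm.pow_const 2
  have m2 : Measurable (Function.uncurry fun h ξ : E d =>
      ‖phase h ξ - 1‖ₑ ^ 2 / κ h * ‖(𝓕 f : L2 d) ξ‖ₑ ^ 2) := by
    refine Measurable.mul (Measurable.div ?_ (hκm.comp measurable_fst)) ?_
    · exact (hphase.sub_const 1).enorm.pow_const 2
    · exact (hFm.comp measurable_snd).enorm.pow_const 2
  have m3 : ∀ ξ : E d, Measurable fun h : E d => ‖phase h ξ - 1‖ₑ ^ 2 / κ h := fun ξ =>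
    (((hphase.comp (measurable_id.prodMk measurable_const)).sub_const 1).enorm.pow_const 2).div hκm
  have m4 : Measurable fun ξ : E d => (∫⁻ h : E d, ‖phase h ξ - 1‖ₑ ^ 2 / κ h) *
      ‖(𝓕 f : L2 d) ξ‖ₑ ^ 2 := by
    refine Measurable.mul (Measurable.lintegral_prod_left' (f := fun p : E d × E d =>
      ‖phase p.1 p.2 - 1‖ₑ ^ 2 / κ p.1) ?_) (hFm.enorm.pow_const 2)
    exact ((hphase.sub_const 1).enorm.pow_const 2).div (hκm.comp measurable_fst)
  change ENNReal.ofReal (gagliardoConst d σ) *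
    ∫⁻ x : E d, ∫⁻ y : E d, ‖f x - f y‖ₑ ^ 2 / κ (x - y) = _
  simp only [hshift]
  rw [lintegral_lintegral_swap m1.aemeasurable, lintegral_congr hinner,
    lintegral_lintegral_swap m2.aemeasurable,
    lintegral_congr fun ξ => lintegral_mul_const (‖(𝓕 f : L2 d) ξ‖ₑ ^ 2) (m3 ξ),
    ← lintegral_const_mul _ m4]
  refine lintegral_congr fun ξ => ?_
  rw [← mul_assoc, hκ, gagliardoConst_mul_lintegral hd hσ hσ1]

end LocalUncertainty
end

noncomputable section

namespace LocalUncertainty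

/-! ### Smooth cut-off functions -/

variable {d : ℕ}

/-- Smooth functions supported in `Ω`, all of whose derivatives are bounded. -/
structure IsCutoff (Ω : Set (E d)) (η : E d → ℝ) : Prop where
  contDiff : ContDiff ℝ ∞ η
  tsupport_subset : tsupport η ⊆ Ω
  bounded : ∀ α : Fin d → ℕ, ∃ M, ∀ x, |multiDeriv α η x| ≤ M

theorem IsCutoff.partialDeriv {Ω : Set (E d)} {η : E d → ℝ} (h : IsCutoff Ω η) (k : Fin d) :
    IsCutoff Ω (partialDeriv k η) where
  contDiff := contDiff_partialDeriv k h.contDiff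
  tsupport_subset := (tsupport_partialDeriv_subset k η).trans h.tsupport_subset
  bounded α := by
    rw [← multiDeriv_add_single α k h.contDiff]
    exact h.bounded _

theorem IsCutoff.exists_bound {Ω : Set (E d)} {η : E d → ℝ} (h : IsCutoff Ω η) :
    ∃ M : ℝ, 0 ≤ M ∧ ∀ x, |η x| ≤ M := by
  obtain ⟨M, hM⟩ := h.bounded 0
  rw [multiDeriv_zero] at hM
  exact ⟨M, (abs_nonneg _).trans (hM 0), hM⟩

theorem IsCutoff.eq_zero {Ω : Set (E d)} {η : E d → ℝ} (h : IsCutoff Ω η) {x : E d} (hx : x ∉ Ω) :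
    η x = 0 :=
  image_eq_zero_of_notMem_tsupport fun h' => hx (h.tsupport_subset h')

theorem IsCutoff.exists_lipschitz {Ω : Set (E d)} {η : E d → ℝ} (h : IsCutoff Ω η) :
    ∃ M : ℝ, 0 ≤ M ∧ ∀ x y, |η x - η y| ≤ M * ‖x - y‖ := by
  choose M hM0 hM using fun k => (h.partialDeriv k).exists_bound
  have hpos : 0 ≤ ∑ k, M k := Finset.sum_nonneg fun k _ => hM0 k
  refine ⟨∑ k, M k, hpos, fun x y => ?_⟩
  have hbound : ∀ z ∈ (univ : Set (E d)), ‖fderiv ℝ η z‖ ≤ ∑ k, M k := by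
    intro z _
    refine ContinuousLinearMap.opNorm_le_bound _ hpos fun v => ?_
    have hv : v = ∑ k, v k • EuclideanSpace.single k (1 : ℝ) := by
      ext i
      simp [Finset.sum_apply, Pi.single_apply]
    conv_lhs => rw [hv, map_sum]
    refine (norm_sum_le _ _).trans ?_
    rw [Finset.sum_mul]
    refine Finset.sum_le_sum fun k _ => ?_
    rw [map_smul, norm_smul, mul_comm]
    exact mul_le_mul (hM k z) (PiLp.norm_apply_le v k) (norm_nonneg _) (hM0 k)
  have := convex_univ.norm_image_sub_le_of_norm_fderiv_le
    (fun z _ => h.contDiff.differentiable (by simp) z) hbound (mem_univ y) (mem_univ x)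
  simpa using this

/-- The convolution of the indicator function of `A` with `ψ`. -/
def mollified (A : Set (E d)) (ψ : E d → ℝ) (x : E d) : ℝ :=
  convolution (A.indicator 1) ψ (ContinuousLinearMap.lsmul ℝ ℝ) volume x

theorem mollified_apply (A : Set (E d)) (ψ : E d → ℝ) (x : E d) :
    mollified A ψ x = ∫ y, A.indicator 1 y * ψ (x - y) := by
  simp [mollified, convolution]

theorem locallyIntegrable_indicator_one {A : Set (E d)} (hA : MeasurableSet A) :
    LocallyIntegrable (A.indicator (1 : E d → ℝ)) volume :=
  (locallyIntegrable_const (1 : ℝ)).indicator hA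

theorem contDiff_mollified {A : Set (E d)} (hA : MeasurableSet A) {ψ : E d → ℝ}
    (hψ : ContDiff ℝ ∞ ψ) (hc : HasCompactSupport ψ) : ContDiff ℝ ∞ (mollified A ψ) :=
  hc.contDiff_convolution_right _ (locallyIntegrable_indicator_one hA) hψ

theorem partialDeriv_mollified {A : Set (E d)} (hA : MeasurableSet A) {ψ : E d → ℝ}
    (hψ : ContDiff ℝ ∞ ψ) (hc : HasCompactSupport ψ) (k : Fin d) :
    partialDeriv k (mollified A ψ) = mollified A (partialDeriv k ψ) := by
  ext x
  have h := hc.hasFDerivAt_convolution_right (ContinuousLinearMap.lsmul ℝ ℝ)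
    (locallyIntegrable_indicator_one hA) (hψ.of_le (by simp)) x
  have h2 : fderiv ℝ (mollified A ψ) x = _ := h.fderiv
  unfold partialDeriv
  rw [h2, convolution_precompR_apply _ (locallyIntegrable_indicator_one hA) (hc.fderiv ℝ)
    (hψ.continuous_fderiv (by simp))]
  rfl

theorem multiDeriv_mollified {A : Set (E d)} (hA : MeasurableSet A) {ψ : E d → ℝ}
    (hψ : ContDiff ℝ ∞ ψ) (hc : HasCompactSupport ψ) (α : Fin d → ℕ) :
    multiDeriv α (mollified A ψ) = mollified A (multiDeriv α ψ) := by
  induction α using multiIndex_induction generalizing ψ with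
  | h0 => simp [multiDeriv_zero]
  | hstep α k ih =>
    rw [multiDeriv_add_single α k (contDiff_mollified hA hψ hc), partialDeriv_mollified hA hψ hc,
      ih (contDiff_partialDeriv k hψ)
        (hc.of_isClosed_subset (isClosed_tsupport _) (tsupport_partialDeriv_subset k ψ)),
      multiDeriv_add_single α k hψ]

theorem abs_mollified_le {A : Set (E d)} {ψ : E d → ℝ}
    (hψ : Continuous ψ) (hc : HasCompactSupport ψ) (x : E d) :
    |mollified A ψ x| ≤ ∫ y, |ψ y| := by
  have hi : Integrable (fun y => |ψ (x - y)|) volume :=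
    ((hψ.integrable_of_hasCompactSupport hc).comp_sub_left x).abs
  rw [mollified_apply]
  calc |∫ y, A.indicator 1 y * ψ (x - y)| ≤ ∫ y, |ψ (x - y)| := by
        rw [← Real.norm_eq_abs]
        refine norm_integral_le_of_norm_le hi (.of_forall fun y => ?_)
        rw [norm_mul]
        refine mul_le_of_le_one_left (norm_nonneg _) ?_
        by_cases hy : y ∈ A <;> simp [hy]
    _ = ∫ y, |ψ y| := integral_sub_left_eq_self (fun y => |ψ y|) volume x

/-- A cut-off function between `Ω` and `Ω'`. -/
theorem exists_isCutoff {Ω Ω' : Set (E d)} (h : WellInside Ω Ω') :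
    ∃ χ : E d → ℝ, IsCutoff Ω' χ ∧ (∀ x, 0 ≤ χ x) ∧ (∀ x, χ x ≤ 1) ∧ ∀ x ∈ Ω, χ x = 1 := by
  obtain ⟨-, r, hr, hdist⟩ := h
  set A : Set (E d) := Metric.thickening (r / 2) Ω with hAdef
  have hA : MeasurableSet A := Metric.isOpen_thickening.measurableSet
  let φ : ContDiffBump (0 : E d) := ⟨r / 8, r / 4, by positivity, by linarith⟩
  set ψ : E d → ℝ := φ.normed volume with hψdef
  have hψ : ContDiff ℝ ∞ ψ := φ.contDiff_normed
  have hψc : HasCompactSupport ψ := φ.hasCompactSupport_normed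
  have hψ0 : ∀ x, 0 ≤ ψ x := fun x => φ.nonneg_normed x
  have hψs : ∀ x, ψ x ≠ 0 → ‖x‖ < r / 4 := by
    intro x hx
    have : x ∈ Function.support ψ := hx
    rw [hψdef, φ.support_normed_eq, mem_ball_zero_iff] at this
    exact this
  have hint : ∀ x : E d, ∫ y, ψ (x - y) = 1 := fun x => by
    rw [integral_sub_left_eq_self ψ volume x]
    exact φ.integral_normed
  have hi : ∀ x : E d, Integrable (fun y => ψ (x - y)) volume := fun x =>
    (hψ.continuous.integrable_of_hasCompactSupport hψc).comp_sub_left x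
  refine ⟨mollified A ψ, ⟨contDiff_mollified hA hψ hψc, ?_, fun α => ?_⟩, fun x => ?_, fun x => ?_,
    fun x hx => ?_⟩
  · have hsub : Function.support (mollified A ψ) ⊆ Metric.cthickening (3 * r / 4) Ω := by
      intro x hx
      obtain ⟨y, hyA, hy⟩ : ∃ y ∈ A, ψ (x - y) ≠ 0 := by
        by_contra! hcon
        refine hx ?_
        rw [mollified_apply]
        refine integral_eq_zero_of_ae (.of_forall fun y => ?_)
        by_cases hy : y ∈ A
        · simp [hcon y hy]
        · simp [hy]
      obtain ⟨z, hz, hyz⟩ := Metric.mem_thickening_iff.1 hyA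
      refine Metric.thickening_subset_cthickening _ _ (Metric.mem_thickening_iff.2 ⟨z, hz, ?_⟩)
      have h1 := hψs _ hy
      rw [← dist_eq_norm] at h1
      linarith [dist_triangle x y z]
    refine (closure_minimal hsub Metric.isClosed_cthickening).trans fun x hx => ?_
    by_contra hx'
    have h1 : ENNReal.ofReal r ≤ Metric.infEDist x Ω := by
      rw [Metric.le_infEDist]
      intro z hz
      rw [edist_comm, edist_dist]
      exact ENNReal.ofReal_le_ofReal (hdist z hz x hx')
    have h2 := h1.trans (Metric.mem_cthickening_iff.1 hx)
    rw [ENNReal.ofReal_le_ofReal_iff (by positivity)] at h2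
    linarith
  · rw [multiDeriv_mollified hA hψ hψc]
    exact ⟨_, abs_mollified_le (contDiff_multiDeriv α hψ).continuous
      (hψc.of_isClosed_subset (isClosed_tsupport _) (tsupport_multiDeriv_subset α ψ))⟩
  · rw [mollified_apply]
    refine integral_nonneg fun y => mul_nonneg (indicator_nonneg (fun _ _ => zero_le_one) _) (hψ0 _)
  · refine (le_abs_self _).trans ((abs_mollified_le hψ.continuous hψc x).trans ?_)
    simp only [abs_of_nonneg (hψ0 _)]
    exact φ.integral_normed.le
  · rw [mollified_apply, ← hint x]
    refine integral_congr_ae (.of_forall fun y => ?_)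
    simp only
    by_cases hy : y ∈ A
    · simp [hy]
    · have : ψ (x - y) = 0 := by
        by_contra hne
        have h1 := hψs _ hne
        refine hy (Metric.mem_thickening_iff.2 ⟨x, hx, ?_⟩)
        rw [dist_comm, dist_eq_norm]
        linarith
      simp [this]

/-! ### The Leibniz rule for a cut-off function times a Sobolev function -/

/-- `f'` is the weak partial derivative `∂_k f` on `ℝ^d`, both functions being in `L²`. -/
structure HasL2Deriv (k : Fin d) (f f' : E d → ℂ) : Prop where
  memLp : MemLp f 2 volume
  memLp_deriv : MemLp f' 2 volume
  integral_eq : ∀ φ : E d → ℝ, ContDiff ℝ ∞ φ → HasCompactSupport φ →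
    ∫ x, partialDeriv k φ x • f x = -∫ x, φ x • f' x

theorem hasCompactSupport_partialDeriv (k : Fin d) {φ : E d → ℝ} (h : HasCompactSupport φ) :
    HasCompactSupport (partialDeriv k φ) :=
  h.of_isClosed_subset (isClosed_tsupport _) (tsupport_partialDeriv_subset k φ)

theorem integrable_smul_of_memLp {f : E d → ℂ} (hf : MemLp f 2 volume) {φ : E d → ℝ}
    (hφ : Continuous φ) (hc : HasCompactSupport φ) : Integrable fun x => φ x • f x := by
  have := integrableOn_smul_of_tsupport_subset
    ((hf.locallyIntegrable (by norm_num)).locallyIntegrableOn univ) hφ hc (subset_univ _)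
  rwa [integrableOn_univ] at this

theorem HasL2Deriv.add {k : Fin d} {f f' g g' : E d → ℂ} (hf : HasL2Deriv k f f')
    (hg : HasL2Deriv k g g') :
    HasL2Deriv k (fun x => f x + g x) (fun x => f' x + g' x) where
  memLp := hf.memLp.add hg.memLp
  memLp_deriv := hf.memLp_deriv.add hg.memLp_deriv
  integral_eq φ h1 h2 := by
    have h1' := (contDiff_partialDeriv k h1).continuous
    have h2' := hasCompactSupport_partialDeriv k h2
    simp only [smul_add]
    rw [integral_add (integrable_smul_of_memLp hf.memLp h1' h2')
      (integrable_smul_of_memLp hg.memLp h1' h2'),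
      integral_add (integrable_smul_of_memLp hf.memLp_deriv h1.continuous h2)
      (integrable_smul_of_memLp hg.memLp_deriv h1.continuous h2), hf.integral_eq φ h1 h2,
      hg.integral_eq φ h1 h2, neg_add]

theorem hasL2Deriv_zero (k : Fin d) : HasL2Deriv k (fun _ => 0) (fun _ => 0) where
  memLp := MemLp.zero'
  memLp_deriv := MemLp.zero'
  integral_eq φ _ _ := by simp

theorem HasL2Deriv.fourier {k : Fin d} {f f' : E d → ℂ} (h : HasL2Deriv k f f') {F F' : L2 d}
    (hF : F =ᵐ[volume] f) (hF' : F' =ᵐ[volume] f') :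
    (𝓕 F' : L2 d) =ᵐ[volume] fun ξ => 2 * Real.pi * Complex.I * ξ k * (𝓕 F : L2 d) ξ := by
  refine fourier_of_weak fun φ h1 h2 => ?_
  have e1 : ∫ x, partialDeriv k φ x • F x = ∫ x, partialDeriv k φ x • f x :=
    integral_congr_ae (by filter_upwards [hF] with x hx using by rw [hx])
  have e2 : ∫ x, φ x • F' x = ∫ x, φ x • f' x :=
    integral_congr_ae (by filter_upwards [hF'] with x hx using by rw [hx])
  rw [e1, e2, h.integral_eq φ h1 h2]

theorem IsCutoff.memLp_smul {Ω : Set (E d)} (hΩ : IsOpen Ω) {η : E d → ℝ} (h : IsCutoff Ω η)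
    {g : E d → ℂ} (hg : MemLp g 2 (volume.restrict Ω)) :
    MemLp (fun x => η x • g x) 2 volume := by
  obtain ⟨M, hM0, hM⟩ := h.exists_bound
  have h1 : MemLp (fun x => η x • g x) 2 (volume.restrict Ω) := by
    refine MemLp.of_le_mul (c := M) hg
      (h.contDiff.continuous.aestronglyMeasurable.smul hg.1) (.of_forall fun x => ?_)
    rw [norm_smul]
    exact mul_le_mul_of_nonneg_right (hM x) (norm_nonneg _)
  have h2 : (fun x => η x • g x) = Ω.indicator fun x => η x • g x := by
    ext x
    by_cases hx : x ∈ Ω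
    · simp [hx]
    · simp [hx, h.eq_zero hx]
  rw [h2, memLp_indicator_iff_restrict hΩ.measurableSet]
  exact h1

/-- The product rule for a cut-off function and a weakly differentiable function on `Ω`; the product
is extended by zero outside of `Ω`. -/
theorem IsCutoff.hasL2Deriv_smul {Ω : Set (E d)} (hΩ : IsOpen Ω) {η : E d → ℝ} (h : IsCutoff Ω η)
    {k : Fin d} {g g' : E d → ℂ} (hw : HasWeakDeriv Ω (Pi.single k 1) g g')
    (hg : MemLp g 2 (volume.restrict Ω)) (hg' : MemLp g' 2 (volume.restrict Ω)) :
    HasL2Deriv k (fun x => η x • g x)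
      (fun x => LocalUncertainty.partialDeriv k η x • g x + η x • g' x) where
  memLp := h.memLp_smul hΩ hg
  memLp_deriv := ((h.partialDeriv k).memLp_smul hΩ hg).add (h.memLp_smul hΩ hg')
  integral_eq φ h1 h2 := by
    have hs : ContDiff ℝ ∞ fun x => η x * φ x := h.contDiff.mul h1
    have hc : HasCompactSupport fun x => η x * φ x := h2.mul_left
    have ht : tsupport (fun x => η x * φ x) ⊆ Ω :=
      (tsupport_mul_subset_left (f := η) (g := φ)).trans h.tsupport_subset
    have key := hw.integral_eq _ hs hc ht
    have hd : ∀ x, LocalUncertainty.partialDeriv k (fun x => η x * φ x) x =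
        η x * LocalUncertainty.partialDeriv k φ x +
          φ x * LocalUncertainty.partialDeriv k η x := by
      intro x
      simp only [LocalUncertainty.partialDeriv]
      have := fderiv_mul (h.contDiff.differentiable (by simp) x) (h1.differentiable (by simp) x)
      change fderiv ℝ (η * φ) x _ = _
      rw [this]
      simp
    have z : ∀ (θ : E d → ℝ) (w : E d → ℂ), (∀ x ∉ Ω, θ x = 0) →
        ∫ x in Ω, θ x • w x = ∫ x, θ x • w x := by
      intro θ w hθ
      refine setIntegral_eq_integral_of_forall_compl_eq_zero fun x hx => ?_
      rw [hθ x hx, zero_smul]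
    rw [multiDeriv_single k hs, z _ _ fun x hx => ?_, z _ _ fun x hx => ?_] at key
    · have i1 : Integrable fun x => LocalUncertainty.partialDeriv k φ x • η x • g x :=
        integrable_smul_of_memLp (h.memLp_smul hΩ hg) (contDiff_partialDeriv k h1).continuous
          (hasCompactSupport_partialDeriv k h2)
      have i2 : Integrable fun x => φ x • LocalUncertainty.partialDeriv k η x • g x :=
        integrable_smul_of_memLp ((h.partialDeriv k).memLp_smul hΩ hg) h1.continuous h2
      have i3 : Integrable fun x => φ x • η x • g' x :=
        integrable_smul_of_memLp (h.memLp_smul hΩ hg') h1.continuous h2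
      have e1 : ∫ x, LocalUncertainty.partialDeriv k (fun x => η x * φ x) x • g x =
          (∫ x, LocalUncertainty.partialDeriv k φ x • η x • g x) +
            ∫ x, φ x • LocalUncertainty.partialDeriv k η x • g x := by
        rw [← integral_add i1 i2]
        refine integral_congr_ae (.of_forall fun x => ?_)
        simp only [hd, smul_smul, ← add_smul]
        ring_nf
      have e2 : ∫ x, (η x * φ x) • g' x = ∫ x, φ x • η x • g' x := by
        refine integral_congr_ae (.of_forall fun x => ?_)
        simp only [smul_smul, mul_comm]
      rw [e1, e2] at key
      simp only [smul_add]
      rw [integral_add i2 i3, neg_add]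
      have : ∑ i, (Pi.single k 1 : Fin d → ℕ) i = 1 := by simp
      rw [this, pow_one] at key
      linear_combination key
    · rw [h.eq_zero hx, zero_mul]
    · exact image_eq_zero_of_notMem_tsupport
        fun h' => hx (ht (tsupport_partialDeriv_subset k _ h'))

/-- A differential operator with cut-off coefficients, given as a list of pairs `(η, β)`, applied
to `u`: the function `∑ η D^β u`. -/
def evalTerms (Ω : Set (E d)) (l : List ((E d → ℝ) × (Fin d → ℕ))) (u : E d → ℂ) (x : E d) : ℂ :=
  (l.map fun p => p.1 x • weakDeriv Ω p.2 u x).sum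

/-- The terms of `∂_k ∑ η D^β u`. -/
def derivTerms (k : Fin d) : List ((E d → ℝ) × (Fin d → ℕ)) → List ((E d → ℝ) × (Fin d → ℕ))
  | [] => []
  | p :: l => (partialDeriv k p.1, p.2) :: (p.1, p.2 + Pi.single k 1) :: derivTerms k l

/-- The coefficients are cut-off functions, and the order is at most `m`. -/
def TermsLE (Ω : Set (E d)) (m : ℕ) (l : List ((E d → ℝ) × (Fin d → ℕ))) : Prop :=
  ∀ p ∈ l, IsCutoff Ω p.1 ∧ ∑ i, p.2 i ≤ m

theorem TermsLE.derivTerms {Ω : Set (E d)} {m : ℕ} {l : List ((E d → ℝ) × (Fin d → ℕ))}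
    (h : TermsLE Ω m l) (k : Fin d) : TermsLE Ω (m + 1) (derivTerms k l) := by
  induction l with
  | nil => intro p hp; simp [LocalUncertainty.derivTerms] at hp
  | cons q l ih =>
    have hq := h q (by simp)
    intro p hp
    simp only [LocalUncertainty.derivTerms, List.mem_cons] at hp
    rcases hp with rfl | rfl | hp
    · exact ⟨hq.1.partialDeriv k, by simp only; omega⟩
    · refine ⟨hq.1, ?_⟩
      simp only
      rw [sum_add_single]
      omega
    · exact ih (fun p hp => h p (by simp [hp])) p hp

/-- All weak derivatives up to order `m` exist on `Ω` and are square integrable. -/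
def HasL2Derivs (Ω : Set (E d)) (m : ℕ) (u : E d → ℂ) : Prop :=
  ∀ β : Fin d → ℕ, ∑ i, β i ≤ m →
    HasWeakDeriv Ω β u (weakDeriv Ω β u) ∧ MemLp (weakDeriv Ω β u) 2 (volume.restrict Ω)

theorem HasL2Derivs.mono {Ω : Set (E d)} {m n : ℕ} {u : E d → ℂ} (h : HasL2Derivs Ω n u)
    (hmn : m ≤ n) : HasL2Derivs Ω m u := fun β hβ => h β (hβ.trans hmn)

theorem memLp_evalTerms {Ω : Set (E d)} (hΩ : IsOpen Ω) {m : ℕ}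
    {l : List ((E d → ℝ) × (Fin d → ℕ))} (hl : TermsLE Ω m l) {u : E d → ℂ}
    (hu : HasL2Derivs Ω m u) : MemLp (evalTerms Ω l u) 2 volume := by
  induction l with
  | nil => exact MemLp.zero'
  | cons q l ih =>
    have hq := hl q (by simp)
    have h1 := hq.1.memLp_smul hΩ (hu _ hq.2).2
    have h2 := h1.add (ih fun p hp => hl p (by simp [hp]))
    refine h2.ae_eq (.of_forall fun x => ?_)
    simp [evalTerms]

theorem hasL2Deriv_evalTerms {Ω : Set (E d)} (hΩ : IsOpen Ω) {m : ℕ}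
    {l : List ((E d → ℝ) × (Fin d → ℕ))} (hl : TermsLE Ω m l) {u : E d → ℂ}
    (hu : HasL2Derivs Ω (m + 1) u) (k : Fin d) :
    HasL2Deriv k (evalTerms Ω l u) (evalTerms Ω (derivTerms k l) u) := by
  induction l with
  | nil => exact hasL2Deriv_zero k
  | cons q l ih =>
    have hq := hl q (by simp)
    have h0 := hu q.2 (by omega)
    have h1 := hu (q.2 + Pi.single k 1) (by rw [sum_add_single]; omega)
    have h2 := (hq.1.hasL2Deriv_smul hΩ (h0.1.step h1.1) h0.2 h1.2).add
      (ih fun p hp => hl p (by simp [hp]))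
    have e : evalTerms Ω (derivTerms k (q :: l)) u = fun x =>
        partialDeriv k q.1 x • weakDeriv Ω q.2 u x +
          q.1 x • weakDeriv Ω (q.2 + Pi.single k 1) u x + evalTerms Ω (derivTerms k l) u x := by
      ext x
      simp [evalTerms, derivTerms, add_assoc]
    rw [e]
    exact h2

/-- The Leibniz rule: `D^α (χ u) = χ D^α u + ∑ η D^β u` with a sum over finitely many terms of order
less than `|α|`. On the Fourier side, `D^α` is the multiplication by its symbol. -/
theorem exists_leibniz {Ω : Set (E d)} (hΩ : IsOpen Ω) {χ : E d → ℝ} (hχ : IsCutoff Ω χ)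
    (α : Fin d → ℕ) :
    ∃ l : List ((E d → ℝ) × (Fin d → ℕ)), (∀ p ∈ l, IsCutoff Ω p.1 ∧ ∑ i, p.2 i < ∑ i, α i) ∧
      ∀ u : E d → ℂ, HasL2Derivs Ω (∑ i, α i) u → ∀ v V : L2 d,
        v =ᵐ[volume] (fun x => χ x • u x) →
        V =ᵐ[volume] (fun x => χ x • weakDeriv Ω α u x + evalTerms Ω l u x) →
        (𝓕 V : L2 d) =ᵐ[volume] fun ξ => symb α ξ * (𝓕 v : L2 d) ξ := by
  induction α using multiIndex_induction with
  | h0 =>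
    refine ⟨[], by simp, fun u hu v V hv hV => ?_⟩
    have h0 := (hu 0 le_rfl).1
    have h1 : weakDeriv Ω 0 u =ᵐ[volume.restrict Ω] u :=
      (hasWeakDeriv_zero h0.locallyIntegrable).weakDeriv_ae_eq hΩ
    have h2 : ∀ᵐ x, x ∈ Ω → weakDeriv Ω 0 u x = u x := by
      rw [Filter.EventuallyEq, ae_restrict_iff' hΩ.measurableSet] at h1
      exact h1
    have : V = v := by
      refine Lp.ext ?_
      filter_upwards [hv, hV, h2] with x h1 h2 h3
      rw [h1, h2]
      by_cases hx : x ∈ Ω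
      · simp [evalTerms, h3 hx]
      · simp [evalTerms, hχ.eq_zero hx]
    rw [this]
    exact .of_forall fun ξ => by simp [symb_zero]
  | hstep α k ih =>
    obtain ⟨l, hl, hlF⟩ := ih
    rw [sum_add_single]
    refine ⟨(partialDeriv k χ, α) :: derivTerms k l, ?_, fun u hu v V hv hV => ?_⟩
    · intro p hp
      rcases List.mem_cons.1 hp with rfl | hp
      · exact ⟨hχ.partialDeriv k, Nat.lt_succ_self _⟩
      · rcases Nat.eq_zero_or_pos (∑ i, α i) with h0 | h0
        · have : l = [] := by
            refine List.eq_nil_iff_forall_not_mem.2 fun q hq => ?_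
            have := (hl q hq).2
            omega
          simp [this, derivTerms] at hp
        · have hT : TermsLE Ω (∑ i, α i - 1) l := fun q hq =>
            ⟨(hl q hq).1, by have := (hl q hq).2; omega⟩
          have := hT.derivTerms k p hp
          exact ⟨this.1, by have := this.2; omega⟩
    · have hT : TermsLE Ω (∑ i, α i) ((χ, α) :: l) := by
        intro q hq
        rcases List.mem_cons.1 hq with rfl | hq
        · exact ⟨hχ, le_rfl⟩
        · exact ⟨(hl q hq).1, (hl q hq).2.le⟩
      have hL2 := hasL2Deriv_evalTerms hΩ hT hu k
      set V₀ : L2 d := hL2.memLp.toLp with hV₀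
      have hV₀e : V₀ =ᵐ[volume] evalTerms Ω ((χ, α) :: l) u := hL2.memLp.coeFn_toLp
      have h1 := hlF u (hu.mono (Nat.le_succ _)) v V₀ hv (by
        filter_upwards [hV₀e] with x hx
        rw [hx]
        simp [evalTerms])
      have h2 := hL2.fourier hV₀e (F' := V) (by
        filter_upwards [hV] with x hx
        rw [hx]
        simp only [evalTerms, derivTerms, List.map_cons, List.sum_cons]
        ring)
      filter_upwards [h1, h2] with ξ h1 h2
      rw [h2, h1, symb_add_single]
      ring

end LocalUncertainty
end

noncomputable section

namespace LocalUncertainty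

/-! ### The energy of a function cut off to the inside of a domain -/

variable {d : ℕ}

theorem enorm_add_sq_le {ε : ℝ} (hε : 0 < ε) (a b : ℂ) :
    ‖a + b‖ₑ ^ 2 ≤ ENNReal.ofReal (1 + ε) * ‖a‖ₑ ^ 2 + ENNReal.ofReal (1 + 1 / ε) * ‖b‖ₑ ^ 2 := by
  simp only [← ofReal_norm]
  rw [← ENNReal.ofReal_pow (norm_nonneg _), ← ENNReal.ofReal_pow (norm_nonneg _),
    ← ENNReal.ofReal_pow (norm_nonneg _), ← ENNReal.ofReal_mul (by positivity),
    ← ENNReal.ofReal_mul (by positivity), ← ENNReal.ofReal_add (by positivity) (by positivity)]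
  refine ENNReal.ofReal_le_ofReal ?_
  have h1 : ‖a + b‖ ^ 2 ≤ (‖a‖ + ‖b‖) ^ 2 := by
    gcongr
    exact norm_add_le a b
  have h2 : (1 + ε) * ‖a‖ ^ 2 + (1 + 1 / ε) * ‖b‖ ^ 2 - (‖a‖ + ‖b‖) ^ 2 =
      (ε * ‖a‖ - ‖b‖) ^ 2 / ε := by
    field_simp
    ring
  have h3 : 0 ≤ (ε * ‖a‖ - ‖b‖) ^ 2 / ε := by positivity
  linarith

theorem fracLaplaceEnergy_add_le {ε : ℝ} (hε : 0 < ε) (σ : ℝ) (a b : L2 d) :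
    fracLaplaceEnergy σ (a + b) ≤ ENNReal.ofReal (1 + ε) * fracLaplaceEnergy σ a +
      ENNReal.ofReal (1 + 1 / ε) * fracLaplaceEnergy σ b := by
  have hm : ∀ w : L2 d, AEMeasurable (fun ξ : E d =>
      ENNReal.ofReal ((2 * Real.pi * ‖ξ‖) ^ (2 * σ)) * ‖(𝓕 w : L2 d) ξ‖ₑ ^ 2) volume := fun w =>
    (measurable_fracWeight σ).aemeasurable.mul (aemeasurable_fourier_sq w)
  unfold fracLaplaceEnergy
  rw [← lintegral_const_mul'' _ (hm a), ← lintegral_const_mul'' _ (hm b),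
    ← lintegral_add_left' ((hm a).const_mul _)]
  refine lintegral_mono_ae ?_
  have hadd : (𝓕 (a + b) : L2 d) = 𝓕 a + 𝓕 b := FourierTransform.fourier_add a b
  rw [hadd]
  filter_upwards [Lp.coeFn_add (𝓕 a : L2 d) (𝓕 b : L2 d)] with ξ hξ
  rw [hξ, Pi.add_apply]
  refine (mul_le_mul_right (enorm_add_sq_le hε _ _) _).trans_eq ?_
  ring

theorem fracLaplaceEnergy_zero (v : L2 d) : fracLaplaceEnergy 0 v = ∫⁻ x, ‖v x‖ₑ ^ 2 := by
  rw [← lintegral_enorm_sq_fourier]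
  simp [fracLaplaceEnergy]

/-- The multinomial decomposition of the energy into the energies of the derivatives of order
`m`. -/
theorem fracLaplaceEnergy_eq_sum {m : ℕ} {σ : ℝ} (hσ : 0 ≤ σ) (v : L2 d)
    (V : (Fin d → ℕ) → L2 d)
    (hV : ∀ α ∈ Finset.piAntidiag (Finset.univ : Finset (Fin d)) m,
      (𝓕 (V α) : L2 d) =ᵐ[volume] fun ξ => symb α ξ * (𝓕 v : L2 d) ξ) :
    fracLaplaceEnergy (m + σ) v = ∑ α ∈ Finset.piAntidiag (Finset.univ : Finset (Fin d)) m,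
      (Nat.multinomial Finset.univ α : ℝ≥0∞) * fracLaplaceEnergy σ (V α) := by
  have e : ∀ α ∈ Finset.piAntidiag (Finset.univ : Finset (Fin d)) m,
      (Nat.multinomial Finset.univ α : ℝ≥0∞) * fracLaplaceEnergy σ (V α) =
        ∫⁻ ξ : E d, ((Nat.multinomial Finset.univ α : ℝ≥0∞) * ‖symb α ξ‖ₑ ^ 2) *
          (ENNReal.ofReal ((2 * Real.pi * ‖ξ‖) ^ (2 * σ)) * ‖(𝓕 v : L2 d) ξ‖ₑ ^ 2) := by
    intro α hα
    unfold fracLaplaceEnergy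
    rw [← lintegral_const_mul' _ _ (ENNReal.natCast_ne_top _)]
    refine lintegral_congr_ae ?_
    filter_upwards [hV α hα] with ξ hξ
    rw [hξ, enorm_mul, mul_pow]
    ring
  rw [Finset.sum_congr rfl e, ← lintegral_finsetSum' _ fun α _ => ?_]
  · unfold fracLaplaceEnergy
    refine lintegral_congr fun ξ => ?_
    rw [← Finset.sum_mul, sum_multinomial_symb, ← mul_assoc, ← ENNReal.ofReal_mul (by positivity),
      ← Real.rpow_add_of_nonneg (by positivity) (by positivity) (by positivity), mul_add]
  · exact ((continuous_symb α).measurable.enorm.pow_const 2).const_mul _ |>.aemeasurable.mul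
      ((measurable_fracWeight σ).aemeasurable.mul (aemeasurable_fourier_sq v))

/-- The energy of order `σ ≤ 1` is bounded by the `H¹` norm. -/
theorem fracLaplaceEnergy_le_of_hasL2Deriv {σ : ℝ} (hσ : 0 ≤ σ) (hσ1 : σ ≤ 1) {b : L2 d}
    {f : E d → ℂ} {f' : Fin d → E d → ℂ} (hb : b =ᵐ[volume] f) (h : ∀ k, HasL2Deriv k f (f' k)) :
    fracLaplaceEnergy σ b ≤ (∫⁻ x, ‖f x‖ₑ ^ 2) + ∑ k, ∫⁻ x, ‖f' k x‖ₑ ^ 2 := by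
  have e0 : ∫⁻ x, ‖f x‖ₑ ^ 2 = ∫⁻ ξ, ‖(𝓕 b : L2 d) ξ‖ₑ ^ 2 := by
    rw [lintegral_enorm_sq_fourier]
    exact lintegral_congr_ae (by filter_upwards [hb] with x hx using by rw [hx])
  have e1 : ∀ k, ∫⁻ x, ‖f' k x‖ₑ ^ 2 =
      ∫⁻ ξ : E d, ENNReal.ofReal ((2 * Real.pi * ξ k) ^ 2) * ‖(𝓕 b : L2 d) ξ‖ₑ ^ 2 := by
    intro k
    have hF := (h k).fourier hb (h k).memLp_deriv.coeFn_toLp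
    have : ∫⁻ x, ‖f' k x‖ₑ ^ 2 = ∫⁻ x, ‖(h k).memLp_deriv.toLp (f' k) x‖ₑ ^ 2 :=
      lintegral_congr_ae (by
        filter_upwards [(h k).memLp_deriv.coeFn_toLp] with x hx using by rw [hx])
    rw [this, ← lintegral_enorm_sq_fourier]
    refine lintegral_congr_ae ?_
    filter_upwards [hF] with ξ hξ
    rw [hξ, enorm_mul, mul_pow, ← ofReal_norm, ← ENNReal.ofReal_pow (norm_nonneg _)]
    congr 2
    simp [mul_pow, abs_of_pos Real.pi_pos]
  rw [e0, Finset.sum_congr rfl fun k _ => e1 k, ← lintegral_finsetSum' _ fun k _ => ?_,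
    ← lintegral_add_left' (aemeasurable_fourier_sq b)]
  · refine lintegral_mono fun ξ => ?_
    simp only
    rw [← Finset.sum_mul, ← one_add_mul, ← ENNReal.ofReal_sum_of_nonneg fun k _ => sq_nonneg _]
    gcongr
    rw [← ENNReal.ofReal_one, ← ENNReal.ofReal_add zero_le_one
      (Finset.sum_nonneg fun k _ => sq_nonneg _)]
    refine ENNReal.ofReal_le_ofReal ?_
    have hsum : ∑ k, (2 * Real.pi * ξ k) ^ 2 = (2 * Real.pi * ‖ξ‖) ^ 2 := by
      rw [mul_pow, EuclideanSpace.real_norm_sq_eq, Finset.mul_sum]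
      simp only [mul_pow]
    rw [hsum]
    have hr : 0 ≤ 2 * Real.pi * ‖ξ‖ := by positivity
    generalize 2 * Real.pi * ‖ξ‖ = r at hr
    rcases le_total r 1 with h1 | h1
    · have := Real.rpow_le_one hr h1 (by linarith : 0 ≤ 2 * σ)
      nlinarith [sq_nonneg r]
    · have := Real.rpow_le_rpow_of_exponent_le h1 (by linarith : 2 * σ ≤ 2)
      rw [Real.rpow_two] at this
      linarith
  · refine AEMeasurable.mul ?_ (aemeasurable_fourier_sq b)
    refine Measurable.aemeasurable ?_
    fun_prop

/-- The double integral in the Gagliardo seminorm on `Ω`. -/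
def gagliardoSq (σ : ℝ) (Ω : Set (E d)) (f : E d → ℂ) : ℝ≥0∞ :=
  ∫⁻ x in Ω, ∫⁻ y in Ω, ‖f x - f y‖ₑ ^ 2 / ENNReal.ofReal (‖x - y‖ ^ ((d : ℝ) + 2 * σ))

theorem gagliardoSq_congr {σ : ℝ} {Ω : Set (E d)} {f g : E d → ℂ}
    (h : f =ᵐ[volume.restrict Ω] g) : gagliardoSq σ Ω f = gagliardoSq σ Ω g := by
  refine lintegral_congr_ae ?_
  filter_upwards [h] with x hx
  refine lintegral_congr_ae ?_
  filter_upwards [h] with y hy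
  rw [hx, hy]

/-- The kernel `min(M²|h|², 1) / |h|^{d+2σ}`, which bounds `|χ(x) - χ(x-h)|² / |h|^{d+2σ}` for a
cut-off function `0 ≤ χ ≤ 1` with Lipschitz constant `M`. -/
def lipKernel (σ M : ℝ) (h : E d) : ℝ≥0∞ :=
  ENNReal.ofReal (min (M ^ 2 * ‖h‖ ^ 2) 1) / ENNReal.ofReal (‖h‖ ^ ((d : ℝ) + 2 * σ))

theorem measurable_lipKernel (σ M : ℝ) : Measurable (lipKernel σ M : E d → ℝ≥0∞) := by
  unfold lipKernel
  fun_prop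

theorem lintegral_lipKernel_lt_top (hd : 1 ≤ d) {σ : ℝ} (hσ : 0 < σ) (hσ1 : σ < 1) (M : ℝ) :
    ∫⁻ h : E d, lipKernel σ M h < ⊤ := by
  have : Nontrivial (E d) := by
    have : Nonempty (Fin d) := ⟨⟨0, hd⟩⟩
    infer_instance
  obtain ⟨p, hp⟩ : ∃ p : ℝ, p = (d : ℝ) + 2 * σ := ⟨_, rfl⟩
  set F : ℝ → ℝ := fun r => min (M ^ 2 * r ^ 2) 1 / r ^ p with hF
  have hFm : Measurable F := by
    rw [hF]
    fun_prop
  have h1 : ∀ h : E d, lipKernel σ M h = ENNReal.ofReal (F ‖h‖) := by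
    intro h
    rcases eq_or_ne h 0 with rfl | hne
    · simp [lipKernel, hF]
    · have : 0 < ‖h‖ := norm_pos_iff.2 hne
      rw [lipKernel, hF, ENNReal.ofReal_div_of_pos (by positivity), hp]
  have hint : Integrable (fun h : E d => F ‖h‖) volume := by
    rw [integrable_fun_norm_addHaar volume (f := F), finrank_euclideanSpace_fin,
      ← Ioc_union_Ioi_eq_Ioi zero_le_one]
    have hmeas : ∀ S : Set ℝ, AEStronglyMeasurable (fun y : ℝ => y ^ (d - 1) • F y)
        (volume.restrict S) := fun S => by
      refine Measurable.aestronglyMeasurable ?_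
      simp only [smul_eq_mul]
      exact (measurable_id.pow_const _).mul hFm
    have hpow : ∀ y : ℝ, 0 < y → y ^ (d - 1) * (y ^ p)⁻¹ = y ^ (-1 - 2 * σ) := by
      intro y hy
      rw [← Real.rpow_neg hy.le, ← Real.rpow_natCast, ← Real.rpow_add hy, Nat.cast_sub hd, hp]
      congr 1
      push_cast
      ring
    refine IntegrableOn.union ?_ ?_
    · have hi : IntegrableOn (fun y : ℝ => M ^ 2 * y ^ (1 - 2 * σ)) (Ioc 0 1) := by
        refine Integrable.const_mul ?_ _
        have := (intervalIntegral.intervalIntegrable_rpow' (a := 0) (b := 1)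
          (r := 1 - 2 * σ) (by linarith))
        exact (intervalIntegrable_iff_integrableOn_Ioc_of_le zero_le_one).1 this
      refine Integrable.mono' hi (hmeas _) ?_
      filter_upwards [ae_restrict_mem measurableSet_Ioc] with y hy
      have hy0 : 0 < y := hy.1
      have hF0 : 0 ≤ y ^ (d - 1) • F y := by
        simp only [hF, smul_eq_mul]
        positivity
      rw [Real.norm_of_nonneg hF0]
      simp only [hF, smul_eq_mul]
      calc y ^ (d - 1) * (min (M ^ 2 * y ^ 2) 1 / y ^ p)
          ≤ y ^ (d - 1) * (M ^ 2 * y ^ 2 / y ^ p) := by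
            gcongr
            exact min_le_left _ _
        _ = M ^ 2 * (y ^ 2 * (y ^ (d - 1) * (y ^ p)⁻¹)) := by ring
        _ = M ^ 2 * y ^ (1 - 2 * σ) := by
            rw [hpow y hy0, ← Real.rpow_natCast y 2, ← Real.rpow_add hy0]
            congr 2
            push_cast
            ring
    · have hi : IntegrableOn (fun y : ℝ => y ^ (-1 - 2 * σ)) (Ioi 1) :=
        integrableOn_Ioi_rpow_of_lt (by linarith) one_pos
      refine Integrable.mono' hi (hmeas _) ?_
      filter_upwards [ae_restrict_mem measurableSet_Ioi] with y hy
      have hy0 : 0 < y := one_pos.trans hy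
      have hF0 : 0 ≤ y ^ (d - 1) • F y := by
        simp only [hF, smul_eq_mul]
        positivity
      rw [Real.norm_of_nonneg hF0, ← hpow y hy0]
      simp only [hF, smul_eq_mul]
      rw [div_eq_mul_inv]
      gcongr
      exact mul_le_of_le_one_left (by positivity) (min_le_right _ _)
  rw [lintegral_congr h1]
  exact hint.lintegral_lt_top

theorem lintegral_lipKernel_mul (σ M : ℝ) {N : E d → ℝ≥0∞} (hN : Measurable N) :
    ∫⁻ x, ∫⁻ y, lipKernel σ M (x - y) * (N x + N y) =
      2 * (∫⁻ h : E d, lipKernel σ M h) * ∫⁻ x, N x := by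
  have hm := measurable_lipKernel (d := d) σ M
  have hK : Measurable fun z : E d × E d => lipKernel σ M (z.1 - z.2) :=
    hm.comp (measurable_fst.sub measurable_snd)
  have hm1 : ∀ x, Measurable fun y : E d => lipKernel σ M (x - y) := fun x =>
    hm.comp (measurable_const.sub measurable_id)
  have hm2 : ∀ y, Measurable fun x : E d => lipKernel σ M (x - y) := fun y =>
    hm.comp (measurable_id.sub measurable_const)
  have h1 : ∀ x, ∫⁻ y, lipKernel σ M (x - y) * N x =
      (∫⁻ h : E d, lipKernel σ M h) * N x := by
    intro x
    rw [lintegral_mul_const _ (hm1 x),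
      lintegral_sub_left_eq_self (lipKernel σ M) x]
  have h2 : ∀ y, ∫⁻ x, lipKernel σ M (x - y) * N y =
      (∫⁻ h : E d, lipKernel σ M h) * N y := by
    intro y
    rw [lintegral_mul_const _ (hm2 y),
      lintegral_sub_right_eq_self (lipKernel σ M) y]
  have h3 : ∀ x, ∫⁻ y, lipKernel σ M (x - y) * (N x + N y) =
      (∫⁻ h : E d, lipKernel σ M h) * N x + ∫⁻ y, lipKernel σ M (x - y) * N y := by
    intro x
    rw [← h1, ← lintegral_add_left ((hm1 x).mul_const _)]
    exact lintegral_congr fun y => mul_add _ _ _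
  rw [lintegral_congr h3, lintegral_add_left (hN.const_mul _), lintegral_const_mul _ hN,
    lintegral_lintegral_swap (hK.mul (hN.comp measurable_snd)).aemeasurable,
    lintegral_congr h2, lintegral_const_mul _ hN]
  ring

theorem gagliardoSq_cutoff_le_of_measurable {Ω : Set (E d)} (hΩ : IsOpen Ω) {χ : E d → ℝ}
    (hχ : IsCutoff Ω χ) (h0 : ∀ x, 0 ≤ χ x) (h1 : ∀ x, χ x ≤ 1) {M : ℝ}
    (hM : ∀ x y, |χ x - χ y| ≤ M * ‖x - y‖) (σ : ℝ) {ε : ℝ} (hε : 0 < ε) {D : E d → ℂ}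
    (hD : Measurable D) :
    gagliardoSq σ univ (fun x => χ x • D x) ≤
      ENNReal.ofReal (1 + ε) * gagliardoSq σ Ω D + ENNReal.ofReal (1 + 1 / ε) *
        (2 * (∫⁻ h : E d, lipKernel σ M h) * ∫⁻ x in Ω, ‖D x‖ₑ ^ 2) := by
  set N : E d → ℝ≥0∞ := Ω.indicator fun x => ‖D x‖ₑ ^ 2 with hNdef
  have hN : Measurable N := (hD.enorm.pow_const 2).indicator hΩ.measurableSet
  set w : E d → E d → ℝ≥0∞ := fun x y => ENNReal.ofReal (‖x - y‖ ^ ((d : ℝ) + 2 * σ)) with hw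
  set A : E d → E d → ℝ≥0∞ := fun x y =>
    Ω.indicator (fun x => Ω.indicator (fun y => ‖D x - D y‖ₑ ^ 2 / w x y) y) x with hA
  have hwm : Measurable fun z : E d × E d => w z.1 z.2 := by
    simp only [hw]
    fun_prop
  have hAm : Measurable fun z : E d × E d => A z.1 z.2 := by
    have : (fun z : E d × E d => A z.1 z.2) =
        (Ω ×ˢ Ω).indicator fun z => ‖D z.1 - D z.2‖ₑ ^ 2 / w z.1 z.2 := by
      ext z
      by_cases hz1 : z.1 ∈ Ω <;> by_cases hz2 : z.2 ∈ Ω <;> simp [hA, hz1, hz2, indicator]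
    rw [this]
    refine Measurable.indicator ?_ (hΩ.measurableSet.prod hΩ.measurableSet)
    exact (((hD.comp measurable_fst).sub (hD.comp measurable_snd)).enorm.pow_const 2).div hwm
  have hAm' : ∀ x, Measurable fun y : E d => A x y := fun x => hAm.comp measurable_prodMk_left
  have hχm : ∀ x y, ‖((χ x - χ y : ℝ) : ℂ)‖ₑ ^ 2 ≤
      ENNReal.ofReal (min (M ^ 2 * ‖x - y‖ ^ 2) 1) := by
    intro x y
    rw [← ofReal_norm, ← ENNReal.ofReal_pow (norm_nonneg _), Complex.norm_real, Real.norm_eq_abs]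
    refine ENNReal.ofReal_le_ofReal (le_min ?_ ?_)
    · rw [← mul_pow]
      gcongr
      exact hM x y
    · rw [sq_abs]
      have := h0 x; have := h0 y; have := h1 x; have := h1 y
      nlinarith
  have hc1 : (1 : ℝ≥0∞) ≤ ENNReal.ofReal (1 + 1 / ε) := by
    rw [← ENNReal.ofReal_one]
    refine ENNReal.ofReal_le_ofReal ?_
    have : 0 < 1 / ε := by positivity
    linarith
  -- the commutator term `(χ(x) - χ(y)) D` is bounded by the integrable kernel
  have key : ∀ x y, ‖χ x • D x - χ y • D y‖ₑ ^ 2 / w x y ≤ ENNReal.ofReal (1 + ε) * A x y +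
      ENNReal.ofReal (1 + 1 / ε) * (lipKernel σ M (x - y) * (N x + N y)) := by
    intro x y
    have hK : ∀ X : ℝ≥0∞, ENNReal.ofReal (min (M ^ 2 * ‖x - y‖ ^ 2) 1) * X / w x y =
        lipKernel σ M (x - y) * X := by
      intro X
      rw [lipKernel, ENNReal.div_eq_inv_mul, ENNReal.div_eq_inv_mul, mul_assoc]
    by_cases hx : x ∈ Ω
    · by_cases hy : y ∈ Ω
      · have hAe : A x y = ‖D x - D y‖ₑ ^ 2 / w x y := by simp [hA, hx, hy]
        have hNe : ‖D y‖ₑ ^ 2 ≤ N x + N y := by simp [hNdef, hy]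
        have hsplit : χ x • D x - χ y • D y =
            (χ x : ℂ) * (D x - D y) + ((χ x - χ y : ℝ) : ℂ) * D y := by
          simp only [Complex.real_smul]
          push_cast
          ring
        have hb1 : ‖(χ x : ℂ) * (D x - D y)‖ₑ ^ 2 ≤ ‖D x - D y‖ₑ ^ 2 := by
          rw [enorm_mul]
          refine pow_le_pow_left' (mul_le_of_le_one_left' ?_) 2
          rw [← ofReal_norm, Complex.norm_real, Real.norm_of_nonneg (h0 x),
            ← ENNReal.ofReal_one]
          exact ENNReal.ofReal_le_ofReal (h1 x)
        have hb2 : ‖((χ x - χ y : ℝ) : ℂ) * D y‖ₑ ^ 2 ≤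
            ENNReal.ofReal (min (M ^ 2 * ‖x - y‖ ^ 2) 1) * (N x + N y) := by
          rw [enorm_mul, mul_pow]
          exact mul_le_mul' (hχm x y) hNe
        rw [hsplit, hAe, ← hK, ← mul_div_assoc, ← mul_div_assoc, ← ENNReal.add_div]
        gcongr
        refine (enorm_add_sq_le hε _ _).trans ?_
        gcongr
      · have hNe : ‖D x‖ₑ ^ 2 ≤ N x + N y := by simp [hNdef, hx]
        rw [← hK]
        refine le_add_left (le_trans ?_ (le_mul_of_one_le_left' hc1))
        refine ENNReal.div_le_div_right ?_ _
        have : χ x • D x - χ y • D y = ((χ x - χ y : ℝ) : ℂ) * D x := by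
          simp [hχ.eq_zero hy, Complex.real_smul]
        rw [this, enorm_mul, mul_pow]
        exact mul_le_mul' (hχm x y) hNe
    · have hNe : Ω.indicator (fun y => ‖D y‖ₑ ^ 2) y ≤ N x + N y := le_add_left le_rfl
      rw [← hK]
      refine le_add_left (le_trans ?_ (le_mul_of_one_le_left' hc1))
      refine ENNReal.div_le_div_right ?_ _
      by_cases hy : y ∈ Ω
      · rw [indicator_of_mem hy] at hNe
        have : χ x • D x - χ y • D y = ((χ x - χ y : ℝ) : ℂ) * D y := by
          simp [hχ.eq_zero hx, Complex.real_smul]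
        rw [this, enorm_mul, mul_pow]
        exact mul_le_mul' (hχm x y) hNe
      · simp [hχ.eq_zero hx, hχ.eq_zero hy]
  have hAint : ∫⁻ x, ∫⁻ y, A x y = gagliardoSq σ Ω D := by
    unfold gagliardoSq
    rw [← lintegral_indicator hΩ.measurableSet]
    refine lintegral_congr fun x => ?_
    by_cases hx : x ∈ Ω
    · simp only [hA, indicator_of_mem hx]
      rw [lintegral_indicator hΩ.measurableSet]
    · simp [hA, hx]
  have hNint : ∫⁻ x, N x = ∫⁻ x in Ω, ‖D x‖ₑ ^ 2 := lintegral_indicator hΩ.measurableSet _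
  calc gagliardoSq σ univ (fun x => χ x • D x)
      = ∫⁻ x, ∫⁻ y, ‖χ x • D x - χ y • D y‖ₑ ^ 2 / w x y := by
        simp only [gagliardoSq, Measure.restrict_univ, hw]
    _ ≤ ∫⁻ x, ∫⁻ y, (ENNReal.ofReal (1 + ε) * A x y +
        ENNReal.ofReal (1 + 1 / ε) * (lipKernel σ M (x - y) * (N x + N y))) :=
        lintegral_mono fun x => lintegral_mono fun y => key x y
    _ = ∫⁻ x, (ENNReal.ofReal (1 + ε) * ∫⁻ y, A x y) + ENNReal.ofReal (1 + 1 / ε) *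
        ∫⁻ y, lipKernel σ M (x - y) * (N x + N y) := by
        refine lintegral_congr fun x => ?_
        rw [lintegral_add_left ((hAm' x).const_mul _),
          lintegral_const_mul' _ _ ENNReal.ofReal_ne_top,
          lintegral_const_mul' _ _ ENNReal.ofReal_ne_top]
    _ = _ := by
        rw [lintegral_add_left (hAm.lintegral_prod_right'.const_mul _),
          lintegral_const_mul' _ _ ENNReal.ofReal_ne_top,
          lintegral_const_mul' _ _ ENNReal.ofReal_ne_top, hAint, lintegral_lipKernel_mul σ M hN,
          hNint]

/-- Multiplication by a cut-off function extends a function on `Ω` to `ℝ^d`, and increases the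
Gagliardo seminorm by an arbitrarily small factor and a multiple of the `L²` norm. -/
theorem exists_gagliardoSq_cutoff_le (hd : 1 ≤ d) {Ω : Set (E d)} (hΩ : IsOpen Ω) {χ : E d → ℝ}
    (hχ : IsCutoff Ω χ) (h0 : ∀ x, 0 ≤ χ x) (h1 : ∀ x, χ x ≤ 1) {σ : ℝ} (hσ : 0 < σ) (hσ1 : σ < 1)
    {ε : ℝ} (hε : 0 < ε) :
    ∃ C : ℝ≥0, ∀ D : E d → ℂ, MemLp D 2 (volume.restrict Ω) →
      gagliardoSq σ univ (fun x => χ x • D x) ≤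
        ENNReal.ofReal (1 + ε) * gagliardoSq σ Ω D + C * ∫⁻ x in Ω, ‖D x‖ₑ ^ 2 := by
  obtain ⟨M, -, hM⟩ := hχ.exists_lipschitz
  have hJ := lintegral_lipKernel_lt_top hd hσ hσ1 M
  have hfin : ENNReal.ofReal (1 + 1 / ε) * (2 * ∫⁻ h : E d, lipKernel σ M h) ≠ ⊤ :=
    ENNReal.mul_ne_top ENNReal.ofReal_ne_top (ENNReal.mul_ne_top (by norm_num) hJ.ne)
  refine ⟨(ENNReal.ofReal (1 + 1 / ε) * (2 * ∫⁻ h : E d, lipKernel σ M h)).toNNReal,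
    fun D hD => ?_⟩
  rw [ENNReal.coe_toNNReal hfin]
  have hae := hD.1.ae_eq_mk
  have hae' : ∀ᵐ x, x ∈ Ω → D x = hD.1.mk D x := by
    rw [Filter.EventuallyEq, ae_restrict_iff' hΩ.measurableSet] at hae
    exact hae
  have hL : gagliardoSq σ univ (fun x => χ x • D x) =
      gagliardoSq σ univ (fun x => χ x • hD.1.mk D x) := by
    refine gagliardoSq_congr ?_
    rw [Measure.restrict_univ]
    filter_upwards [hae'] with x hx
    by_cases hxΩ : x ∈ Ω
    · rw [hx hxΩ]
    · simp [hχ.eq_zero hxΩ]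
  have hR : ∫⁻ x in Ω, ‖D x‖ₑ ^ 2 = ∫⁻ x in Ω, ‖hD.1.mk D x‖ₑ ^ 2 :=
    lintegral_congr_ae (by filter_upwards [hae] with x hx using by rw [hx])
  rw [hL, hR, gagliardoSq_congr hae]
  refine (gagliardoSq_cutoff_le_of_measurable hΩ hχ h0 h1 hM σ hε
    hD.1.stronglyMeasurable_mk.measurable).trans_eq ?_
  ring

theorem lintegral_weakDeriv_le_lowerOrderSq {s : ℝ} {α : Fin d → ℕ} (hα : ∑ i, α i < ⌈s⌉₊)
    (Ω : Set (E d)) (u : E d → ℂ) :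
    ∫⁻ x in Ω, ‖weakDeriv Ω α u x‖ₑ ^ 2 ≤ lowerOrderSq s Ω u := by
  unfold lowerOrderSq
  refine le_trans ?_ (Finset.single_le_sum
    (f := fun k => ∑ α ∈ Finset.piAntidiag (Finset.univ : Finset (Fin d)) k,
      ∫⁻ x in Ω, ‖weakDeriv Ω α u x‖ₑ ^ 2) (fun _ _ => zero_le) (Finset.mem_range.2 hα))
  exact Finset.single_le_sum (f := fun α => ∫⁻ x in Ω, ‖weakDeriv Ω α u x‖ₑ ^ 2)
    (fun _ _ => zero_le) (by simp)

theorem MemHs.hasL2Derivs {s : ℝ} {Ω : Set (E d)} {u : E d → ℂ}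
    (h : MemHs s Ω u) : HasL2Derivs Ω ⌊s⌋₊ u := by
  intro β hβ
  have hw := hasWeakDeriv_weakDeriv (h.1 β hβ)
  refine ⟨hw, hw.locallyIntegrable_deriv.aestronglyMeasurable, ?_⟩
  rw [eLpNorm_lt_top_iff_lintegral_rpow_enorm_lt_top (by norm_num) (by norm_num)]
  have h1 : ∫⁻ x in Ω, ‖weakDeriv Ω β u x‖ₑ ^ 2 ≤ hsNormSq s Ω u := by
    unfold hsNormSq
    refine le_add_left (le_trans ?_ (Finset.single_le_sum
      (f := fun k => ∑ α ∈ Finset.piAntidiag (Finset.univ : Finset (Fin d)) k,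
        ∫⁻ x in Ω, ‖weakDeriv Ω α u x‖ₑ ^ 2) (fun _ _ => zero_le)
      (Finset.mem_range.2 (Nat.lt_succ_of_le hβ))))
    exact Finset.single_le_sum (f := fun α => ∫⁻ x in Ω, ‖weakDeriv Ω α u x‖ₑ ^ 2)
      (fun _ _ => zero_le) (by simp)
  simpa using h1.trans_lt h.2

theorem exists_evalTerms_le {s : ℝ} {Ω : Set (E d)} (hΩ : IsOpen Ω) {m : ℕ} (hm : m < ⌈s⌉₊)
    {l : List ((E d → ℝ) × (Fin d → ℕ))} (hl : TermsLE Ω m l) :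
    ∃ C : ℝ≥0, ∀ u : E d → ℂ, HasL2Derivs Ω m u →
      ∫⁻ x, ‖evalTerms Ω l u x‖ₑ ^ 2 ≤ C * lowerOrderSq s Ω u := by
  induction l with
  | nil => exact ⟨0, fun u _ => by simp [evalTerms]⟩
  | cons p l ih =>
    obtain ⟨C, hC⟩ := ih fun q hq => hl q (by simp [hq])
    have hp := hl p (by simp)
    obtain ⟨M, hM0, hM⟩ := hp.1.exists_bound
    lift M to ℝ≥0 using hM0
    refine ⟨2 * M ^ 2 + 2 * C, fun u hu => ?_⟩
    have h1 : ∫⁻ x, ‖p.1 x • weakDeriv Ω p.2 u x‖ₑ ^ 2 ≤ (M : ℝ≥0∞) ^ 2 * lowerOrderSq s Ω u := by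
      refine le_trans ?_ (mul_le_mul_right
        (lintegral_weakDeriv_le_lowerOrderSq (hp.2.trans_lt hm) Ω u) _)
      rw [← lintegral_const_mul' _ _ (by finiteness), ← lintegral_indicator hΩ.measurableSet]
      refine lintegral_mono fun x => ?_
      by_cases hx : x ∈ Ω
      · rw [indicator_of_mem hx, enorm_smul, mul_pow]
        gcongr
        rw [Real.enorm_eq_ofReal_abs]
        exact ENNReal.ofReal_le_of_le_toReal (hM x)
      · simp [hp.1.eq_zero hx]
    have hm1 := (hp.1.memLp_smul hΩ (hu _ hp.2).2).1.enorm.pow_const 2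
    have h2 : ∀ x, ‖evalTerms Ω (p :: l) u x‖ₑ ^ 2 ≤
        2 * ‖p.1 x • weakDeriv Ω p.2 u x‖ₑ ^ 2 + 2 * ‖evalTerms Ω l u x‖ₑ ^ 2 := by
      intro x
      have h := enorm_add_sq_le one_pos (p.1 x • weakDeriv Ω p.2 u x) (evalTerms Ω l u x)
      norm_num at h
      simpa [evalTerms] using h
    calc ∫⁻ x, ‖evalTerms Ω (p :: l) u x‖ₑ ^ 2
        ≤ ∫⁻ x, (2 * ‖p.1 x • weakDeriv Ω p.2 u x‖ₑ ^ 2 + 2 * ‖evalTerms Ω l u x‖ₑ ^ 2) :=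
          lintegral_mono h2
      _ = 2 * (∫⁻ x, ‖p.1 x • weakDeriv Ω p.2 u x‖ₑ ^ 2) +
          2 * ∫⁻ x, ‖evalTerms Ω l u x‖ₑ ^ 2 := by
          rw [lintegral_add_left' (hm1.const_mul _), lintegral_const_mul' _ _ (by norm_num),
            lintegral_const_mul' _ _ (by norm_num)]
      _ ≤ 2 * ((M : ℝ≥0∞) ^ 2 * lowerOrderSq s Ω u) + 2 * (C * lowerOrderSq s Ω u) := by
          gcongr
          exact hC u hu
      _ = _ := by
          push_cast
          ring

/-- The contribution of the derivative `f = D^α u` to the seminorm of `u`: the `L²` norm for `σ = 0`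
and the Gagliardo seminorm for `0 < σ < 1`. -/
def derivEnergy (σ : ℝ) (Ω : Set (E d)) (f : E d → ℂ) : ℝ≥0∞ :=
  if σ = 0 then ∫⁻ x in Ω, ‖f x‖ₑ ^ 2 else ENNReal.ofReal (gagliardoConst d σ) * gagliardoSq σ Ω f

theorem hsSeminormSq_eq_sum (s : ℝ) (Ω : Set (E d)) (u : E d → ℂ) :
    hsSeminormSq s Ω u = ∑ α ∈ Finset.piAntidiag (Finset.univ : Finset (Fin d)) ⌊s⌋₊,
      (Nat.multinomial Finset.univ α : ℝ≥0∞) *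
        derivEnergy (Int.fract s) Ω (weakDeriv Ω α u) := by
  by_cases h : Int.fract s = 0
  · simp [hsSeminormSq, derivEnergy, h]
  · simp only [hsSeminormSq, derivEnergy, if_neg h, Finset.mul_sum]
    refine Finset.sum_congr rfl fun α _ => ?_
    rw [mul_left_comm]
    rfl

/-- The energy of `χ D`, where `D` stands for a derivative of order `⌊s⌋` on `Ω`. The error term
must be absent for `σ = 0`, as `⌊s⌋` is then not less than `s` and `‖D‖²_{L²}` is not of lower
order. -/
theorem exists_fracLaplaceEnergy_cutoff_le (hd : 1 ≤ d) {Ω : Set (E d)} (hΩ : IsOpen Ω)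
    {χ : E d → ℝ} (hχ : IsCutoff Ω χ) (h0 : ∀ x, 0 ≤ χ x) (h1 : ∀ x, χ x ≤ 1) {σ : ℝ}
    (hσ : 0 ≤ σ) (hσ1 : σ < 1) {ε : ℝ} (hε : 0 < ε) :
    ∃ C : ℝ≥0, (σ = 0 → C = 0) ∧ ∀ D : E d → ℂ, MemLp D 2 (volume.restrict Ω) →
      ∀ a : L2 d, a =ᵐ[volume] (fun x => χ x • D x) →
        fracLaplaceEnergy σ a ≤ ENNReal.ofReal (1 + ε) * derivEnergy σ Ω D +
          C * ∫⁻ x in Ω, ‖D x‖ₑ ^ 2 := by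
  rcases hσ.eq_or_lt with rfl | hσ
  · refine ⟨0, fun _ => rfl, fun D _ a ha => ?_⟩
    rw [fracLaplaceEnergy_zero, derivEnergy, if_pos rfl]
    refine le_add_right (le_trans ?_ (le_mul_of_one_le_left' ?_))
    · rw [← lintegral_indicator hΩ.measurableSet]
      refine lintegral_mono_ae ?_
      filter_upwards [ha] with x hx
      rw [hx]
      by_cases hxΩ : x ∈ Ω
      · rw [indicator_of_mem hxΩ, enorm_smul]
        refine pow_le_pow_left' (mul_le_of_le_one_left' ?_) 2
        rw [Real.enorm_of_nonneg (h0 x), ← ENNReal.ofReal_one]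
        exact ENNReal.ofReal_le_ofReal (h1 x)
      · simp [hχ.eq_zero hxΩ]
    · rw [← ENNReal.ofReal_one]
      exact ENNReal.ofReal_le_ofReal (by linarith)
  · obtain ⟨C, hC⟩ := exists_gagliardoSq_cutoff_le hd hΩ hχ h0 h1 hσ hσ1 hε
    refine ⟨(gagliardoConst d σ).toNNReal * C, fun h => absurd h hσ.ne', fun D hD a ha => ?_⟩
    have e : fracLaplaceEnergy σ a = ENNReal.ofReal (gagliardoConst d σ) *
        gagliardoSq σ univ fun x => χ x • D x := by
      have h2 : gagliardoSq σ univ a = gagliardoSq σ univ fun x => χ x • D x :=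
        gagliardoSq_congr (by rwa [Measure.restrict_univ])
      rw [← gagliardo_eq_fracLaplaceEnergy hd hσ hσ1, ← h2]
      simp only [gagliardoSq, Measure.restrict_univ]
    rw [e, derivEnergy, if_neg hσ.ne']
    refine (mul_le_mul_right (hC D hD) _).trans_eq ?_
    rw [mul_add, ENNReal.coe_mul, ENNReal.ofReal]
    ring

theorem hasL2Deriv_evalTerms_of_lt {Ω : Set (E d)} (hΩ : IsOpen Ω) {m : ℕ}
    {l : List ((E d → ℝ) × (Fin d → ℕ))} (hl : ∀ p ∈ l, IsCutoff Ω p.1 ∧ ∑ i, p.2 i < m)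
    (k : Fin d) :
    TermsLE Ω m (derivTerms k l) ∧ ∀ u : E d → ℂ, HasL2Derivs Ω m u →
      HasL2Deriv k (evalTerms Ω l u) (evalTerms Ω (derivTerms k l) u) := by
  cases m with
  | zero =>
    have : l = [] := List.eq_nil_iff_forall_not_mem.2 fun p hp => by simpa using (hl p hp).2
    subst this
    exact ⟨fun p hp => by simp [derivTerms] at hp, fun u _ => hasL2Deriv_zero k⟩
  | succ m =>
    have hT : TermsLE Ω m l := fun p hp => ⟨(hl p hp).1, Nat.le_of_lt_succ (hl p hp).2⟩
    exact ⟨hT.derivTerms k, fun u hu => hasL2Deriv_evalTerms hΩ hT hu k⟩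

/-- The terms of order less than `⌊s⌋` in the Leibniz rule for `D^α (χ u)`, `|α| = ⌊s⌋`, have an
energy of order `s - ⌊s⌋` which is controlled by the derivatives of order less than `s`. -/
theorem exists_fracLaplaceEnergy_evalTerms_le {s : ℝ} (hs : 0 < s) {Ω : Set (E d)} (hΩ : IsOpen Ω)
    {l : List ((E d → ℝ) × (Fin d → ℕ))} (hl : ∀ p ∈ l, IsCutoff Ω p.1 ∧ ∑ i, p.2 i < ⌊s⌋₊) :
    ∃ C : ℝ≥0, ∀ u : E d → ℂ, HasL2Derivs Ω ⌊s⌋₊ u → ∀ b : L2 d,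
      b =ᵐ[volume] evalTerms Ω l u →
        fracLaplaceEnergy (Int.fract s) b ≤ C * lowerOrderSq s Ω u := by
  have hT : TermsLE Ω (⌊s⌋₊ - 1) l := fun p hp =>
    ⟨(hl p hp).1, by have := (hl p hp).2; omega⟩
  have hceil : 0 < ⌈s⌉₊ := Nat.ceil_pos.2 hs
  have hfc := Nat.floor_le_ceil s
  obtain ⟨C, hC⟩ := exists_evalTerms_le hΩ (s := s) (m := ⌊s⌋₊ - 1) (by omega) hT
  by_cases h : Int.fract s = 0
  · refine ⟨C, fun u hu b hb => ?_⟩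
    rw [h, fracLaplaceEnergy_zero]
    refine le_trans (le_of_eq ?_) (hC u (hu.mono (Nat.sub_le _ _)))
    exact lintegral_congr_ae (by filter_upwards [hb] with x hx using by rw [hx])
  · have hc := ceil_eq_floor_add_one_of_fract_ne_zero hs h
    choose C' hC' using fun k => exists_evalTerms_le hΩ (s := s) (m := ⌊s⌋₊) (by omega)
      (hasL2Deriv_evalTerms_of_lt hΩ hl k).1
    refine ⟨C + ∑ k, C' k, fun u hu b hb => ?_⟩
    refine (fracLaplaceEnergy_le_of_hasL2Deriv (Int.fract_nonneg s) (Int.fract_lt_one s).le hb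
      fun k => (hasL2Deriv_evalTerms_of_lt hΩ hl k).2 u hu).trans ?_
    rw [ENNReal.coe_add, ENNReal.ofNNReal_finsetSum, add_mul, Finset.sum_mul]
    gcongr with k
    · exact hC u (hu.mono (Nat.sub_le _ _))
    · exact hC' k u hu

theorem exists_fracLaplaceEnergy_deriv_le (hd : 1 ≤ d) {s : ℝ} (hs : 0 < s) {Ω : Set (E d)}
    (hΩ : IsOpen Ω) {χ : E d → ℝ} (hχ : IsCutoff Ω χ) (h0 : ∀ x, 0 ≤ χ x) (h1 : ∀ x, χ x ≤ 1)
    {ε : ℝ} (hε : 0 < ε) {α : Fin d → ℕ} (hα : ∑ i, α i = ⌊s⌋₊) :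
    ∃ C : ℝ≥0, ∀ u : E d → ℂ, HasL2Derivs Ω ⌊s⌋₊ u → ∀ v : L2 d,
      v =ᵐ[volume] (fun x => χ x • u x) → ∃ V : L2 d,
        (𝓕 V : L2 d) =ᵐ[volume] (fun ξ => symb α ξ * (𝓕 v : L2 d) ξ) ∧
        fracLaplaceEnergy (Int.fract s) V ≤
          ENNReal.ofReal (1 + ε) * derivEnergy (Int.fract s) Ω (weakDeriv Ω α u) +
            C * lowerOrderSq s Ω u := by
  -- `ε₀` is chosen such that `(1 + ε₀)² ≤ 1 + ε`
  obtain ⟨ε₀, hε₀, hε1, hε2⟩ : ∃ ε₀ : ℝ, 0 < ε₀ ∧ ε₀ ≤ 1 ∧ ε₀ ≤ ε / 3 :=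
    ⟨min 1 (ε / 3), lt_min one_pos (by linarith), min_le_left _ _, min_le_right _ _⟩
  obtain ⟨l, hl, hlF⟩ := exists_leibniz hΩ hχ α
  rw [hα] at hl hlF
  obtain ⟨C₁, hC₁0, hC₁⟩ := exists_fracLaplaceEnergy_cutoff_le hd hΩ hχ h0 h1
    (Int.fract_nonneg s) (Int.fract_lt_one s) hε₀
  obtain ⟨C₂, hC₂⟩ := exists_fracLaplaceEnergy_evalTerms_le hs hΩ hl
  refine ⟨(1 + ε₀).toNNReal * C₁ + (1 + 1 / ε₀).toNNReal * C₂, fun u hu v hv => ?_⟩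
  have hD := (hu α hα.le).2
  have hmema := hχ.memLp_smul hΩ hD
  have hmemb := memLp_evalTerms hΩ
    (fun p hp => ⟨(hl p hp).1, (hl p hp).2.le⟩ : TermsLE Ω ⌊s⌋₊ l) hu
  refine ⟨hmema.toLp + hmemb.toLp, hlF u hu v _ hv ?_, ?_⟩
  · filter_upwards [Lp.coeFn_add hmema.toLp hmemb.toLp, hmema.coeFn_toLp, hmemb.coeFn_toLp]
      with x e1 e2 e3
    rw [e1, Pi.add_apply, e2, e3]
  · refine (fracLaplaceEnergy_add_le hε₀ _ _ _).trans ?_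
    have b1 := hC₁ _ hD _ hmema.coeFn_toLp
    have b2 := hC₂ u hu _ hmemb.coeFn_toLp
    have b3 : (C₁ : ℝ≥0∞) * ∫⁻ x in Ω, ‖weakDeriv Ω α u x‖ₑ ^ 2 ≤ C₁ * lowerOrderSq s Ω u := by
      by_cases h : Int.fract s = 0
      · simp [hC₁0 h]
      · have hc := ceil_eq_floor_add_one_of_fract_ne_zero hs h
        gcongr
        exact lintegral_weakDeriv_le_lowerOrderSq (by omega) Ω u
    have b4 : ENNReal.ofReal (1 + ε₀) * ENNReal.ofReal (1 + ε₀) ≤ ENNReal.ofReal (1 + ε) := by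
      rw [← ENNReal.ofReal_mul (by positivity)]
      refine ENNReal.ofReal_le_ofReal ?_
      nlinarith
    calc _ ≤ ENNReal.ofReal (1 + ε₀) * (ENNReal.ofReal (1 + ε₀) *
            derivEnergy (Int.fract s) Ω (weakDeriv Ω α u) + C₁ * lowerOrderSq s Ω u) +
          ENNReal.ofReal (1 + 1 / ε₀) * (C₂ * lowerOrderSq s Ω u) := by
          gcongr
          exact b1.trans (by gcongr)
      _ = ENNReal.ofReal (1 + ε₀) * ENNReal.ofReal (1 + ε₀) *
            derivEnergy (Int.fract s) Ω (weakDeriv Ω α u) +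
          (ENNReal.ofReal (1 + ε₀) * C₁ + ENNReal.ofReal (1 + 1 / ε₀) * C₂) *
            lowerOrderSq s Ω u := by ring
      _ ≤ _ := by
          gcongr
          push_cast
          rfl

/-- The energy of `χ u` exceeds the seminorm of `u` on `Ω` by an arbitrarily small factor and a
multiple of the derivatives of order less than `s`. -/
theorem exists_fracLaplaceEnergy_smul_le (hd : 1 ≤ d) {s : ℝ} (hs : 0 < s) {Ω : Set (E d)}
    (hΩ : IsOpen Ω) {χ : E d → ℝ} (hχ : IsCutoff Ω χ) (h0 : ∀ x, 0 ≤ χ x) (h1 : ∀ x, χ x ≤ 1)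
    {ε : ℝ} (hε : 0 < ε) :
    ∃ C : ℝ≥0, ∀ u : E d → ℂ, MemHs s Ω u → ∀ v : L2 d, v =ᵐ[volume] (fun x => χ x • u x) →
      fracLaplaceEnergy s v ≤ ENNReal.ofReal (1 + ε) * hsSeminormSq s Ω u +
        C * lowerOrderSq s Ω u := by
  have hall : ∀ α : Fin d → ℕ, ∃ C : ℝ≥0, ∑ i, α i = ⌊s⌋₊ →
      ∀ u : E d → ℂ, HasL2Derivs Ω ⌊s⌋₊ u → ∀ v : L2 d,
      v =ᵐ[volume] (fun x => χ x • u x) → ∃ V : L2 d,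
        (𝓕 V : L2 d) =ᵐ[volume] (fun ξ => symb α ξ * (𝓕 v : L2 d) ξ) ∧
        fracLaplaceEnergy (Int.fract s) V ≤
          ENNReal.ofReal (1 + ε) * derivEnergy (Int.fract s) Ω (weakDeriv Ω α u) +
            C * lowerOrderSq s Ω u := by
    intro α
    by_cases hα : ∑ i, α i = ⌊s⌋₊
    · obtain ⟨C, hC⟩ := exists_fracLaplaceEnergy_deriv_le hd hs hΩ hχ h0 h1 hε hα
      exact ⟨C, fun _ => hC⟩
    · exact ⟨0, fun h => absurd h hα⟩
  choose C hC using hall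
  refine ⟨∑ α ∈ Finset.piAntidiag (Finset.univ : Finset (Fin d)) ⌊s⌋₊,
    (Nat.multinomial Finset.univ α : ℝ≥0) * C α, fun u hu v hv => ?_⟩
  have hsum : ∀ α ∈ Finset.piAntidiag (Finset.univ : Finset (Fin d)) ⌊s⌋₊, ∑ i, α i = ⌊s⌋₊ :=
    fun α hα => (Finset.mem_piAntidiag.1 hα).1
  have hV : ∀ α : Fin d → ℕ, ∃ V : L2 d,
      α ∈ Finset.piAntidiag (Finset.univ : Finset (Fin d)) ⌊s⌋₊ →
        (𝓕 V : L2 d) =ᵐ[volume] (fun ξ => symb α ξ * (𝓕 v : L2 d) ξ) ∧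
        fracLaplaceEnergy (Int.fract s) V ≤
          ENNReal.ofReal (1 + ε) * derivEnergy (Int.fract s) Ω (weakDeriv Ω α u) +
            C α * lowerOrderSq s Ω u := by
    intro α
    by_cases hα : α ∈ Finset.piAntidiag (Finset.univ : Finset (Fin d)) ⌊s⌋₊
    · obtain ⟨V, hV⟩ := hC α (hsum α hα) u (hu.hasL2Derivs) v hv
      exact ⟨V, fun _ => hV⟩
    · exact ⟨0, fun h => absurd h hα⟩
  choose V hV using hV
  have e := fracLaplaceEnergy_eq_sum (m := ⌊s⌋₊) (Int.fract_nonneg s) v V fun α hα => (hV α hα).1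
  rw [floor_add_fract_eq hs] at e
  rw [e, hsSeminormSq_eq_sum, Finset.mul_sum, ENNReal.ofNNReal_finsetSum, Finset.sum_mul,
    ← Finset.sum_add_distrib]
  refine Finset.sum_le_sum fun α hα => (mul_le_mul_right (hV α hα).2 _).trans_eq ?_
  push_cast
  ring

/-! ### The one-body bound -/

theorem fracLaplaceEnergy_smul (s : ℝ) (c : ℂ) (w : L2 d) :
    fracLaplaceEnergy s (c • w) = ‖c‖ₑ ^ 2 * fracLaplaceEnergy s w := by
  unfold fracLaplaceEnergy
  rw [← lintegral_const_mul' _ _ (by finiteness)]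
  have h : (𝓕 (c • w) : L2 d) = c • (𝓕 w : L2 d) := FourierTransform.fourier_smul c w
  rw [h]
  refine lintegral_congr_ae ?_
  filter_upwards [Lp.coeFn_smul c (𝓕 w : L2 d)] with ξ hξ
  rw [hξ, Pi.smul_apply, enorm_smul, mul_pow]
  ring

/-- The Gagliardo–Nirenberg inequality without normalization. -/
theorem gnConst_mul_le {s : ℝ} (hs : 0 < s) (v : L2 d) :
    gnConst d s * ∫⁻ x, (‖v x‖ₑ ^ 2) ^ (1 + 2 * s / (d : ℝ)) ≤
      fracLaplaceEnergy s v * (‖v‖ₑ ^ 2) ^ (2 * s / (d : ℝ)) := by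
  have hq : 0 ≤ 2 * s / (d : ℝ) := by positivity
  obtain ⟨q, hqdef⟩ : ∃ q : ℝ, q = 2 * s / (d : ℝ) := ⟨_, rfl⟩
  rw [← hqdef] at hq ⊢
  rcases eq_or_ne v 0 with rfl | hv
  · have : ∫⁻ x, (‖(0 : L2 d) x‖ₑ ^ 2) ^ (1 + q) = 0 := by
      rw [← lintegral_zero (μ := (volume : Measure (E d)))]
      refine lintegral_congr_ae ?_
      filter_upwards [Lp.coeFn_zero (E := ℂ) (p := 2) (μ := (volume : Measure (E d)))] with x hx
      rw [hx]
      simp only [Pi.zero_apply, enorm_zero]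
      rw [zero_pow two_ne_zero, ENNReal.zero_rpow_of_pos (by linarith)]
    rw [this, mul_zero]
    exact zero_le
  · have hn : ‖v‖ ≠ 0 := norm_ne_zero_iff.2 hv
    obtain ⟨w, hw1, hvw⟩ : ∃ w : L2 d, ‖w‖ = 1 ∧ v = ((‖v‖ : ℝ) : ℂ) • w := by
      refine ⟨((‖v‖ : ℝ) : ℂ)⁻¹ • v, ?_, ?_⟩
      · rw [norm_smul, norm_inv, Complex.norm_real, norm_norm, inv_mul_cancel₀ hn]
      · rw [smul_smul, mul_inv_cancel₀ (by exact_mod_cast hn), one_smul]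
    obtain ⟨N, hN⟩ : ∃ N : ℝ≥0∞, N = ‖v‖ₑ := ⟨_, rfl⟩
    have hN0 : N ≠ 0 := by rw [hN]; simpa using hv
    have hNt : N ≠ ⊤ := by rw [hN]; finiteness
    have hc : ‖((‖v‖ : ℝ) : ℂ)‖ₑ = N := by
      rw [hN, ← ofReal_norm, Complex.norm_real, norm_norm, ofReal_norm]
    have he : fracLaplaceEnergy s v = N ^ 2 * fracLaplaceEnergy s w := by
      rw [← hc, ← fracLaplaceEnergy_smul, ← hvw]
    have hi : ∫⁻ x, (‖v x‖ₑ ^ 2) ^ (1 + q) =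
        (N ^ 2) ^ (1 + q) * ∫⁻ x, ‖w x‖ₑ ^ (2 * (1 + q)) := by
      rw [← lintegral_const_mul' _ _ (ENNReal.rpow_ne_top_of_nonneg (by linarith) (by finiteness))]
      have hae : v =ᵐ[volume] fun x => ((‖v‖ : ℝ) : ℂ) • w x := by
        conv_lhs => rw [hvw]
        exact Lp.coeFn_smul _ w
      refine lintegral_congr_ae ?_
      filter_upwards [hae] with x hx
      rw [hx, enorm_smul, mul_pow, hc, ENNReal.mul_rpow_of_nonneg _ _ (by linarith),
        ENNReal.rpow_mul, ENNReal.rpow_two]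
    have hgoal : gnConst d s * ∫⁻ x, ‖w x‖ₑ ^ (2 * (1 + q)) ≤ fracLaplaceEnergy s w := by
      rcases eq_or_ne (fracLaplaceEnergy s w) ⊤ with ht | ht
      · rw [ht]
        exact le_top
      · have hfull : hsNormSqFull s w < ⊤ :=
          ENNReal.add_lt_top.2 ⟨by finiteness, ht.lt_top⟩
        have hle : gnConst d s ≤ fracLaplaceEnergy s w / ∫⁻ x, ‖w x‖ₑ ^ (2 * (1 + q)) := by
          rw [hqdef]
          exact iInf_le_of_le w (iInf_le_of_le hw1 (iInf_le_of_le hfull le_rfl))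
        refine (mul_le_mul_left hle _).trans ?_
        rw [mul_comm]
        exact ENNReal.mul_div_le
    rw [hi, he, ← hN, ENNReal.rpow_add _ _ (pow_ne_zero 2 hN0) (by finiteness), ENNReal.rpow_one]
    calc gnConst d s * (N ^ 2 * (N ^ 2) ^ q * ∫⁻ x, ‖w x‖ₑ ^ (2 * (1 + q)))
        = N ^ 2 * (N ^ 2) ^ q * (gnConst d s * ∫⁻ x, ‖w x‖ₑ ^ (2 * (1 + q))) := by ring
      _ ≤ N ^ 2 * (N ^ 2) ^ q * fracLaplaceEnergy s w := by gcongr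
      _ = N ^ 2 * fracLaplaceEnergy s w * (N ^ 2) ^ q := by ring

/-- The local uncertainty principle for a single function `u`: the Gagliardo–Nirenberg inequality
for `χ u`, with a cut-off function `χ` between `Ω` and `Ω'`. -/
theorem exists_oneBodyBound (hd : 1 ≤ d) {s : ℝ} (hs : 0 < s) {δ : ℝ} (hδ : 0 < δ) (hδ1 : δ < 1)
    {Ω Ω' : Set (E d)} (hΩ : IsOpen Ω) (hw : WellInside Ω Ω') (hext : IsExtensionDomain s Ω') :
    {C : ℝ | 0 ≤ C ∧ OneBodyBound s δ Ω Ω' C}.Nonempty := by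
  have hΩ' := hext.1
  obtain ⟨χ, hχ, h0, h1, hχΩ⟩ := exists_isCutoff hw
  -- `(1 - δ) (1 + 2 ε) = 1`
  obtain ⟨ε, hε, hδε⟩ : ∃ ε : ℝ, 0 < ε ∧ (1 - δ) * (1 + ε + ε) = 1 := by
    have : 0 < 1 - δ := by linarith
    refine ⟨δ / (2 * (1 - δ)), by positivity, ?_⟩
    field_simp
    ring
  obtain ⟨C₁, hC₁⟩ := exists_fracLaplaceEnergy_smul_le hd hs hΩ' hχ h0 h1 hε
  have hε' : 0 < ε / (C₁ + 1) := by positivity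
  obtain ⟨C₂, hC₂⟩ := exists_lowerOrderSq_le hs hext hε'
  refine ⟨C₁ * C₂, by positivity, fun u hu => ?_⟩
  by_cases hus : MemHs s Ω' u
  swap
  · rw [localEnergy, if_neg hus, top_add]
    exact le_top
  rw [localEnergy, if_pos hus]
  have hmem := hχ.memLp_smul hΩ' hu
  obtain ⟨v, hv⟩ : ∃ v : L2 d, v =ᵐ[volume] fun x => χ x • u x := ⟨hmem.toLp, hmem.coeFn_toLp⟩
  obtain ⟨S, hS⟩ : ∃ S, S = hsSeminormSq s Ω' u := ⟨_, rfl⟩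
  obtain ⟨B, hB⟩ : ∃ B, B = ∫⁻ x in Ω', ‖u x‖ₑ ^ 2 := ⟨_, rfl⟩
  have hq : 0 ≤ 2 * s / (d : ℝ) := by positivity
  have hX : ∫⁻ x in Ω, (‖u x‖ₑ ^ 2) ^ (1 + 2 * s / (d : ℝ)) ≤
      ∫⁻ x, (‖v x‖ₑ ^ 2) ^ (1 + 2 * s / (d : ℝ)) := by
    refine le_trans (le_of_eq ?_) (setLIntegral_le_lintegral Ω _)
    refine lintegral_congr_ae ?_
    filter_upwards [ae_restrict_of_ae hv, ae_restrict_mem hΩ.measurableSet] with x hx hxΩ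
    rw [hx, hχΩ x hxΩ, one_smul]
  have hvB : ‖v‖ₑ ^ 2 ≤ B := by
    rw [← lintegral_enorm_sq_L2, hB, ← lintegral_indicator hΩ'.measurableSet]
    refine lintegral_mono_ae ?_
    filter_upwards [hv] with x hx
    rw [hx]
    by_cases hxΩ : x ∈ Ω'
    · rw [indicator_of_mem hxΩ, enorm_smul]
      refine pow_le_pow_left' (mul_le_of_le_one_left' ?_) 2
      rw [Real.enorm_of_nonneg (h0 x), ← ENNReal.ofReal_one]
      exact ENNReal.ofReal_le_ofReal (h1 x)
    · simp [hχ.eq_zero hxΩ]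
  have hgn : gnConst d s * ∫⁻ x in Ω, (‖u x‖ₑ ^ 2) ^ (1 + 2 * s / (d : ℝ)) ≤
      fracLaplaceEnergy s v * B ^ (2 * s / (d : ℝ)) := by
    refine (mul_le_mul_right hX _).trans ((gnConst_mul_le hs v).trans ?_)
    gcongr
  have hen : ENNReal.ofReal (1 - δ) * fracLaplaceEnergy s v ≤
      S + ENNReal.ofReal (C₁ * C₂) * B := by
    have a1 := hC₁ u hus v hv
    have a2 := hC₂ u hu hus
    rw [← hS] at a1 a2
    rw [← hB] at a2
    have a3 : (C₁ : ℝ≥0∞) * ENNReal.ofReal (ε / (C₁ + 1)) ≤ ENNReal.ofReal ε := by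
      rw [← ENNReal.ofReal_coe_nnreal, ← ENNReal.ofReal_mul (NNReal.coe_nonneg C₁)]
      refine ENNReal.ofReal_le_ofReal ?_
      rw [mul_div_assoc', div_le_iff₀ (by positivity)]
      nlinarith
    have a4 : ENNReal.ofReal (C₁ * C₂) = (C₁ : ℝ≥0∞) * C₂ := by
      rw [ENNReal.ofReal_mul (NNReal.coe_nonneg C₁), ENNReal.ofReal_coe_nnreal,
        ENNReal.ofReal_coe_nnreal]
    have a5 : ENNReal.ofReal (1 - δ) ≤ 1 := by
      rw [← ENNReal.ofReal_one]
      exact ENNReal.ofReal_le_ofReal (by linarith)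
    have a6 : ENNReal.ofReal (1 - δ) * (ENNReal.ofReal (1 + ε) + ENNReal.ofReal ε) = 1 := by
      rw [← ENNReal.ofReal_add (by linarith) hε.le, ← ENNReal.ofReal_mul (by linarith), hδε,
        ENNReal.ofReal_one]
    calc ENNReal.ofReal (1 - δ) * fracLaplaceEnergy s v
        ≤ ENNReal.ofReal (1 - δ) * (ENNReal.ofReal (1 + ε) * S +
          C₁ * (ENNReal.ofReal (ε / (C₁ + 1)) * S + C₂ * B)) := by
          gcongr
          exact a1.trans (by gcongr)
      _ = ENNReal.ofReal (1 - δ) * ((ENNReal.ofReal (1 + ε) +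
          C₁ * ENNReal.ofReal (ε / (C₁ + 1))) * S) +
            ENNReal.ofReal (1 - δ) * (C₁ * C₂ * B) := by ring
      _ ≤ ENNReal.ofReal (1 - δ) * ((ENNReal.ofReal (1 + ε) + ENNReal.ofReal ε) * S) +
            1 * (C₁ * C₂ * B) := by gcongr
      _ = S + ENNReal.ofReal (C₁ * C₂) * B := by rw [← mul_assoc, a6, a4, one_mul, one_mul]
  rw [← hS, ← hB]
  refine le_trans ?_ hen
  rw [mul_comm (gnConst d s), mul_assoc, ← mul_div_assoc]
  gcongr
  refine (ENNReal.div_le_div_right hgn _).trans ?_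
  rw [mul_comm, mul_div_assoc]
  exact ENNReal.mul_div_le

end LocalUncertainty
end

theorem lemma4p2 (d : ℕ) (hd : 1 ≤ d) (s : ℝ) (hs : 0 < s) :
    ∃ C : ℝ → Set (E d) → Set (E d) → ℝ,
      ∀ (δ : ℝ) (Ω Ω' : Set (E d)), 0 < δ → δ < 1 → IsOpen Ω → Ω.Nonempty →
        WellInside Ω Ω' → IsExtensionDomain s Ω' →
        0 ≤ C δ Ω Ω' ∧ (Ω' ≠ univ → 0 < C δ Ω Ω') ∧
        (∀ L : ℝ, 0 < L → C δ Ω Ω' = C δ (L • Ω) (L • Ω') * L ^ (2 * s)) ∧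
        ∀ (n : ℕ) (Ψ : (Fin (n + 1) → E d) → ℂ), IsNormalized Ψ →
          gnConst d s * ENNReal.ofReal (1 - δ) *
              ((∫⁻ x in Ω, density Ψ x ^ (1 + 2 * s / (d : ℝ))) /
                (∫⁻ x in Ω', density Ψ x) ^ (2 * s / (d : ℝ)))
            ≤ localKineticEnergy s Ω' Ψ +
              ENNReal.ofReal (C δ Ω Ω') * ∫⁻ x in Ω', density Ψ x := by
  refine ⟨fun δ Ω Ω' => localConst s δ Ω Ω', fun δ Ω Ω' hδ hδ1 hΩ hne hw hext => ?_⟩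
  have hone := exists_oneBodyBound hd hs hδ hδ1 hΩ hw hext
  exact ⟨localConst_nonneg s δ Ω Ω', localConst_pos hne hw,
    fun L hL => localConst_dilate hd hL hs δ hext.1,
    fun n Ψ hΨ => (OneBodyBound.localConst hone).many_body hd hs hext.1 hw.1 hΨ.1⟩
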